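/- Let $g\ge 0$. A \emph{spectral curve of genus $g$ of a CMC torus in $\mathbb S^3$} is described by data $(a,b_1,b_2,\lambda_1,\lambda_2)$ as follows. The polynomial $a\in\mathbb C[\lambda]$ has degree $2g$ and $2g$ distinct roots, with $\bar\lambda^{-2g}\overline{a(\lambda)}=a(\bar\lambda^{-1})$ for $\lambda\neq 0$ and $\lambda^{-g}a(\lambda)\ge 0$ for $|\lambda|=1$. The curve is $\Sigma:\ \nu^2=\lambda a(\lambda)$, with points $y^+,y^-$ over $\lambda=0,\infty$ and involutions $\sigma(\lambda,\nu)=(\lambda,-\nu)$, $\eta(\lambda,\nu)=(\bar\lambda^{-1},-\bar\nu\bar\lambda^{-g-1})$, $\varrho=\eta\circ\sigma$. The polynomials $b_1,b_2$ have degree at most $g+1$, $\bar\lambda^{-g-1}\overline{b_i(\lambda)}=b_i(\bar\lambda^{-1})$, and the singular parts at $y^\pm$ of the differentials $\pi\frac{b_i}{\nu}\frac{d\lambda}{\lambda}$, $i=1,2$, are linearly independent over $\mathbb R$ (so both have double poles at $y^\pm$). There are nowhere vanishing holomorphic functions $\mu_1,\mu_2$ on $\Sigma\setminus\{y^+,y^-\}$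 with $d\ln\mu_i=\pi\frac{b_i}{\nu}\frac{d\lambda}{\lambda}$, $\mu_i\circ\sigma=\mu_i^{-1}$, $\mu_i\circ\eta=\bar\mu_i$, $\mu_i\circ\varrho=\bar\mu_i^{-1}$. The sym points $\lambda_1\ne\lambda_2$ lie on the unit circle, and $\mu_1,\mu_2$ take values in $\{1,-1\}$ at the four points of $\Sigma$ over $\lambda_1,\lambda_2$ (closing conditions). A \emph{smooth family} is a $C^\infty$ map $t\mapsto D(t)$ from an interval $(-\varepsilon,\varepsilon)$, $\varepsilon>0$, to the space of coefficients of $(a,b_1,b_2)$ and of $(\lambda_1,\lambda_2)$ such that every $D(t)$ is such a spectral curve of genus $g$. For real $r>0$ and $\theta$, the coordinate changes $\lambda\mapsto e^{i\theta}\lambda$, $\nu\mapsto r e^{i(g+1)\theta/2}\nu$ act on the data; write $(r,\theta)\cdot D$ for the result. \textbf{Theorem.} Let $S$ be a spectral curve of genus $g$ of a CMC torus in $\mathbb S^3$, with functions $\mu_1,\mu_2$. If $d\ln\mu_1$ and $d\ln\mu_2$ have no common roots, then $S$ is contained in a smooth one-dimensional family of spectral curves of genus $g$ of CMC tori in $\mathbb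 S^3$, unique up to reparametrization, rotations of $\lambda$ and rescalings of $\nu$. That is, there is a smooth family $D$ on an interval $(-\varepsilon,\varepsilon)$ with $D(0)=S$ such that: (i) the velocity $D'(t)$ is at no $t$ tangent to the orbit of $D(t)$ under the coordinate changes; (ii) there are functions $\mu_1^t,\mu_2^t$ for $D(t)$ as above, equal to $\mu_1,\mu_2$ at $t=0$, whose values $\pm1$ at the points over the sym points $\lambda_1(t),\lambda_2(t)$ are the values of $\mu_1,\mu_2$ over $\lambda_1(0),\lambda_2(0)$, for all $t$; (iii) for every smooth family $E$ on an interval $(-\delta,\delta)$ with $E(0)=S$ there are $\delta'\in(0,\delta]$ and smooth real functions $\tau,r,\theta$ on $(-\delta',\delta')$ with $\tau(0)=0$, $r(0)=1$, $\theta(0)=0$, such that $|\tau(s)|<\varepsilon$, $r(s)>0$ and $E(s)=(r(s),\theta(s))\cdot D(\tau(s))$ for all $|s|<\delta'$. -/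

import Mathlib

open scoped ContDiff ComplexConjugate

noncomputable section

/-- The polynomial with a given list of coefficients. -/
def coeffPoly {n : ℕ} (c : Fin n → ℂ) : Polynomial ℂ :=
  ∑ k : Fin n, Polynomial.monomial (k : ℕ) (c k)

/-- The finite dimensional parameter space in which the spectral data of genus `g` live:
the coefficients of a polynomial `a` of degree at most `2 g`, the coefficients of two polynomials
`b₁, b₂` of degree at most `g + 1`, and the two sym points. -/
abbrev SpectralData (g : ℕ) : Type :=
  (Fin (2 * g + 1) → ℂ) × (Fin 2 → Fin (g + 2) → ℂ) × (Fin 2 → ℂ)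

namespace SpectralData

variable {g : ℕ}

/-- The polynomial `a`. -/
def a (S : SpectralData g) : Polynomial ℂ := coeffPoly S.1

/-- The polynomials `b₁`, `b₂`. -/
def b (S : SpectralData g) (i : Fin 2) : Polynomial ℂ := coeffPoly (S.2.1 i)

/-- The sym points `λ₁`, `λ₂`. -/
def sym (S : SpectralData g) (j : Fin 2) : ℂ := S.2.2 j

/-- The curve `ν² = λ a(λ)` without the two branch points `y⁺`, `y⁻` over `λ = 0, ∞`, as the set
of the pairs `(λ, ν)`. -/
def curve (S : SpectralData g) : Set (ℂ × ℂ) :=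
  {p | p.1 ≠ 0 ∧ p.2 ^ 2 = p.1 * S.a.eval p.1}

/-- The holomorphic vector field `2 ν ∂_λ + (λ a(λ))' ∂_ν`. When the roots of `λ a(λ)` are simple,
it is tangent to the curve and has no zeros on it. -/
def tangent (S : SpectralData g) (p : ℂ × ℂ) : ℂ × ℂ :=
  (2 * p.2, (Polynomial.X * S.a).derivative.eval p.1)

/-- The differential form `π (b_i(λ) / ν) (dλ / λ)`, given through its value on the nowhere
vanishing tangent field `tangent`: there `dλ = 2 ν`, so that the value is `2 π b_i(λ) / λ`, also
at the branch points `ν = 0`. In particular the form has a root at a point of the curve exactly if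
this number is zero. -/
def logForm (S : SpectralData g) (i : Fin 2) (p : ℂ × ℂ) : ℂ :=
  2 * (Real.pi : ℂ) * (S.b i).eval p.1 / p.1

/-- The hyperelliptic involution `σ`. -/
def hyp (p : ℂ × ℂ) : ℂ × ℂ := (p.1, -p.2)

/-- The anti-holomorphic involution `η` (for genus `g`). -/
def etaInv (g : ℕ) (p : ℂ × ℂ) : ℂ × ℂ :=
  ((conj p.1)⁻¹, -(conj p.2 * ((conj p.1)⁻¹) ^ (g + 1)))

/-- The anti-holomorphic involution `ϱ = η ∘ σ` (for genus `g`). -/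
def rhoInv (g : ℕ) (p : ℂ × ℂ) : ℂ × ℂ :=
  ((conj p.1)⁻¹, conj p.2 * ((conj p.1)⁻¹) ^ (g + 1))

/-- `μ` is holomorphic on the curve (locally the restriction of a holomorphic function of `(λ, ν)`),
has no zeros there, and `d ln μ` is the form `π (b_i / ν) (dλ / λ)`. -/
def HasLogDifferential (S : SpectralData g) (i : Fin 2) (μ : ℂ × ℂ → ℂ) : Prop :=
  ∀ p ∈ S.curve, μ p ≠ 0 ∧ ∃ F : ℂ × ℂ → ℂ, AnalyticAt ℂ F p ∧
    (∀ᶠ q in nhdsWithin p S.curve, μ q = F q) ∧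
    fderiv ℂ F p (S.tangent p) / μ p = S.logForm i p

/-- `S` is the spectral data of a cmc torus in the 3-sphere of spectral genus `g`, with the
functions `μ₁`, `μ₂` on the curve `ν² = λ a(λ)`. -/
structure IsSpectral (S : SpectralData g) (μ : Fin 2 → ℂ × ℂ → ℂ) : Prop where
  /-- `a` has degree `2 g`. -/
  a_degree : S.a.coeff (2 * g) ≠ 0
  /-- `a` has `2 g` pairwise distinct roots. -/
  a_simple : S.a.Separable
  /-- The reality condition on `a`. -/
  a_real : ∀ z : ℂ, z ≠ 0 → ((conj z)⁻¹) ^ (2 * g) * conj (S.a.eval z) = S.a.eval (conj z)⁻¹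
  /-- `λ⁻ᵍ a(λ) ≥ 0` on the unit circle. -/
  a_nonneg : ∀ z : ℂ, ‖z‖ = 1 → ∃ x : ℝ, 0 ≤ x ∧ (z⁻¹) ^ g * S.a.eval z = (x : ℂ)
  /-- The reality condition on `b₁`, `b₂`. -/
  b_real : ∀ i, ∀ z : ℂ, z ≠ 0 →
    ((conj z)⁻¹) ^ (g + 1) * conj ((S.b i).eval z) = (S.b i).eval (conj z)⁻¹
  /-- The singular parts of the differentials at `y⁺` are linearly independent over the reals
  (in particular both have a double pole there). -/
  indep_plus : LinearIndependent ℝ fun i : Fin 2 => (S.b i).coeff 0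
  /-- The same at `y⁻`. -/
  indep_minus : LinearIndependent ℝ fun i : Fin 2 => (S.b i).coeff (g + 1)
  /-- `μ_i` is holomorphic without zeros, with `d ln μ_i = π (b_i / ν) (dλ / λ)`. -/
  mu_log : ∀ i, S.HasLogDifferential i (μ i)
  mu_hyp : ∀ i, ∀ p ∈ S.curve, μ i (hyp p) = (μ i p)⁻¹
  mu_eta : ∀ i, ∀ p ∈ S.curve, μ i (etaInv g p) = conj (μ i p)
  mu_rho : ∀ i, ∀ p ∈ S.curve, μ i (rhoInv g p) = (conj (μ i p))⁻¹
  /-- The sym points are two distinct points of the unit circle. -/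
  sym_norm : ∀ j, ‖S.sym j‖ = 1
  sym_ne : S.sym 0 ≠ S.sym 1
  /-- `μ₁` and `μ₂` are `1` or `-1` at the four points of the curve over the sym points. -/
  closing : ∀ i j, ∀ p ∈ S.curve, p.1 = S.sym j → μ i p = 1 ∨ μ i p = -1

/-- The two differentials have no common root on the curve. -/
def NoCommonRoots (S : SpectralData g) : Prop :=
  ∀ p ∈ S.curve, ¬ (S.logForm 0 p = 0 ∧ S.logForm 1 p = 0)

/-- The change of coordinates `λ ↦ exp(i θ) λ`, `ν ↦ r exp(i (g + 1) θ / 2) ν` (a rotation of `λ`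
and a rescaling of `ν`), expressed in the spectral data. For real `θ` and `r ≠ 0` these are the
linear coordinate changes that are compatible with the involutions. -/
def transform (r θ : ℝ) (S : SpectralData g) : SpectralData g :=
  (fun k => (r : ℂ) ^ 2 * Complex.exp (((g : ℂ) - (k : ℕ)) * θ * Complex.I) * S.1 k,
   fun i k => (r : ℂ) * Complex.exp ((((g : ℂ) + 1) / 2 - (k : ℕ)) * θ * Complex.I) * S.2.1 i k,
   fun j => Complex.exp (θ * Complex.I) * S.2.2 j)

end SpectralData

/-- A smooth family of spectral data of cmc tori in the 3-sphere of genus `g`, with parameter in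
the interval `(-ε, ε)`. -/
def IsSmoothSpectralFamily {g : ℕ} (ε : ℝ) (D : ℝ → SpectralData g) : Prop :=
  0 < ε ∧ ContDiffOn ℝ ∞ D (Set.Ioo (-ε) ε) ∧
    ∀ t ∈ Set.Ioo (-ε) ε, ∃ μ : Fin 2 → ℂ × ℂ → ℂ, (D t).IsSpectral μ

/-- The family is one dimensional: up to coordinate changes it has nowhere zero velocity, that is,
the velocity is nowhere tangent to the orbit of the coordinate changes. -/
def IsOneDimensional {g : ℕ} (ε : ℝ) (D : ℝ → SpectralData g) : Prop :=
  ∀ t ∈ Set.Ioo (-ε) ε, ∀ x y : ℝ,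
    deriv D t ≠ deriv (fun s : ℝ => (D t).transform (Real.exp (x * s)) (y * s)) 0

end

/-!
The proof studies infinitesimal deformations of spectral data, integrates the resulting vector
field, and shows that every smooth family follows it up to coordinate changes.

**Infinitesimal deformations.** Along a family, `∂ₜ ln μ_i = π c_i / ν` with polynomials `c_i` of
degree at most `g + 1`. That `∂ₜ` and `d` commute on `ln μ_i` is the linearized Whitham equation
`2 a ḃ_i - b_i ȧ = 2 λ a c_i' - (λ a)' c_i`, and `μ_i` keeps its value at the sym points when
`c_i(λ_j) + b_i(λ_j) λ̇_j / λ_j = 0`. Both are linear in `(ȧ, ḃ, λ̇, c)`. At the roots of `a` and at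
the sym points they make `(c₁, c₂)` proportional to `(b₁, b₂)`, so that `a (λ - λ₁) (λ - λ₂)` divides
`c₁ b₂ - c₂ b₁` (`Regular.a_dvd_wronski`). By degree the quotient is a constant, the speed of the
deformation. At speed zero `c₁ b₂ = c₂ b₁`, and as `b₁` and `b₂` have no common root, `c_i` is a
constant multiple of `b_i`; what is left are the rotations of `λ` and the rescalings of `ν`. With
three scalar normalizations for speed, rotation and rescaling the system `linearization` is
therefore injective (`Regular.eq_zero`). It has as many equations as unknowns, hence it is
bijective (`Regular.linearization_bijective`). So there is exactly one normalized infinitesimal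
deformation `unitVar`. It depends smoothly on the data, is compatible with the real structure
(`IsReal.flip_eq`), and its velocity is not tangent to the orbit of the coordinate changes
(`velocity_unitVar_ne`).

**Existence.** Let `D` be the integral curve of `unitVar` through the given data
(`exists_integralCurve`). Away from small discs around the branch points, the curves of `D t` and
`D 0` are identified by continuing `ν`, and `μ_i` times the exponential of `∫ π c_i / ν dt` has the
logarithmic differential that belongs to `D t` (`IsDeformation.hasLogDifferentialAt`) and the values
`±1` at the moving sym points (`IsDeformation.transported_sym`). Over a disc around one
branch point of `D t` that is not at `λ = 0`, the differential has a primitive `ν G(λ)`, hence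
`exp (ν G)` is a local solution which `σ` inverts (`exists_log_primitive`). On the surrounding
annulus it agrees with the transported function up to a sign, which is absorbed in it
(`exists_glue`). The compatibility with `η` holds because a function is determined by its
logarithmic differential and one value, and at a sym point both sides are the same sign
(`IsReal.conj_etaInv`). This is `IsSpectral.exists_family`.

**Uniqueness.** In an arbitrary smooth family no regularity in `t` of the functions `μ_i` is
assumed. It follows from `μ_i ∘ σ = μ_i⁻¹`: this gives `μ_i² = μ_i / (μ_i ∘ σ)`, which is the
exponential of the integral of `d ln μ_i` along a path that starts at the image of the point under `σ`
and runs around a branch point. The function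
`ν ∂ₜ ln μ_i / π` depends only on `λ`, its singularities at the branch points are removable
(`IsLogFamily.exists_entire`), and the symmetry under `η` bounds its growth at infinity, so it is a
polynomial `c_i` (`IsLogFamily.exists_polynomial`). Hence the velocity of the family comes from an
infinitesimal deformation (`IsSmoothSpectralFamily.exists_variation`) and is a smooth combination
of `unitVar`, the rotation and the rescaling (`exists_reducedData_eq`). The coefficients, integrated,
give `τ`, `θ` and `r`, and the uniqueness of solutions of differential equations identifies the family
with the transformed integral curve (`exists_reparametrization`).
-/

noncomputable section

section
open Polynomial

/-! ### Polynomials of bounded degree and their conjugate reversal -/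

theorem coeff_coeffPoly {n : ℕ} (c : Fin n → ℂ) (k : ℕ) :
    (coeffPoly c).coeff k = if h : k < n then c ⟨k, h⟩ else 0 := by
  simp only [coeffPoly, finsetSum_coeff, coeff_monomial]
  split_ifs with h
  · rw [Finset.sum_eq_single ⟨k, h⟩]
    · simp
    · intro j _ hj
      rw [if_neg]
      exact fun e => hj (Fin.ext e)
    · simp
  · refine Finset.sum_eq_zero fun j _ => ?_
    rw [if_neg]
    intro e
    exact h (e ▸ j.2)

@[simp] theorem coeff_coeffPoly_fin {n : ℕ} (c : Fin n → ℂ) (k : Fin n) :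
    (coeffPoly c).coeff k = c k := by
  simp [coeff_coeffPoly]

theorem coeffPoly_natDegree_le {n : ℕ} (c : Fin (n + 1) → ℂ) : (coeffPoly c).natDegree ≤ n := by
  rw [natDegree_le_iff_coeff_eq_zero]
  intro k hk
  rw [coeff_coeffPoly, dif_neg (by omega)]

theorem coeffPoly_coeff {n : ℕ} {p : ℂ[X]} (hp : p.natDegree ≤ n) :
    coeffPoly (fun k : Fin (n + 1) => p.coeff k) = p := by
  ext k
  rw [coeff_coeffPoly]
  split_ifs with h
  · rfl
  · exact (coeff_eq_zero_of_natDegree_lt (by omega)).symm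

theorem coeffPoly_injective {n : ℕ} : Function.Injective (coeffPoly (n := n)) := by
  intro c d h
  ext k
  rw [← coeff_coeffPoly_fin c, h, coeff_coeffPoly_fin]

@[simp] theorem coeffPoly_add {n : ℕ} (c d : Fin n → ℂ) :
    coeffPoly (c + d) = coeffPoly c + coeffPoly d := by
  ext k; simp only [coeff_coeffPoly, coeff_add]; split_ifs <;> simp

@[simp] theorem coeffPoly_smul {n : ℕ} (z : ℂ) (c : Fin n → ℂ) :
    coeffPoly (z • c) = C z * coeffPoly c := by
  ext k; simp only [coeff_coeffPoly, coeff_C_mul]; split_ifs <;> simp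

@[simp] theorem coeffPoly_zero {n : ℕ} : coeffPoly (0 : Fin n → ℂ) = 0 := by
  ext k; simp [coeff_coeffPoly]

theorem coeffPoly_eq_zero {n : ℕ} {c : Fin n → ℂ} (h : coeffPoly c = 0) : c = 0 :=
  coeffPoly_injective (by simpa using h)

/-- The polynomial `z ↦ zⁿ conj (p (1 / conj z))`: the coefficients are conjugated and their order
is reversed. -/
def conjRev (n : ℕ) (p : ℂ[X]) : ℂ[X] := (p.reflect n).map (starRingEnd ℂ)

theorem coeff_conjRev (n : ℕ) (p : ℂ[X]) (k : ℕ) :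
    (conjRev n p).coeff k = conj (p.coeff (revAt n k)) := by
  simp [conjRev, coeff_reflect]

theorem coeff_conjRev_of_le {n k : ℕ} (p : ℂ[X]) (h : k ≤ n) :
    (conjRev n p).coeff k = conj (p.coeff (n - k)) := by
  rw [coeff_conjRev, revAt_le h]

@[simp] theorem conjRev_add (n : ℕ) (p q : ℂ[X]) : conjRev n (p + q) = conjRev n p + conjRev n q := by
  ext; simp [coeff_conjRev]

@[simp] theorem conjRev_sub (n : ℕ) (p q : ℂ[X]) : conjRev n (p - q) = conjRev n p - conjRev n q := by
  ext; simp [coeff_conjRev]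

@[simp] theorem conjRev_zero (n : ℕ) : conjRev n 0 = 0 := by
  ext; simp [coeff_conjRev]

theorem conjRev_C_mul (n : ℕ) (z : ℂ) (p : ℂ[X]) :
    conjRev n (C z * p) = C (conj z) * conjRev n p := by
  ext; simp [coeff_conjRev]

theorem conjRev_mul {m n : ℕ} {p q : ℂ[X]} (hp : p.natDegree ≤ m) (hq : q.natDegree ≤ n) :
    conjRev (m + n) (p * q) = conjRev m p * conjRev n q := by
  simp [conjRev, reflect_mul p q hp hq]

theorem conjRev_natDegree_le {n : ℕ} {p : ℂ[X]} (hp : p.natDegree ≤ n) :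
    (conjRev n p).natDegree ≤ n := by
  rw [natDegree_le_iff_coeff_eq_zero]
  intro k hk
  rw [coeff_conjRev, revAt_eq_self_of_lt hk, coeff_eq_zero_of_natDegree_lt (by omega), map_zero]

theorem coeff_X_mul_derivative (p : ℂ[X]) (k : ℕ) :
    (X * derivative p).coeff k = (k : ℂ) * p.coeff k := by
  cases k with
  | zero => simp
  | succ k => rw [coeff_X_mul, coeff_derivative]; push_cast; ring

theorem conjRev_X_mul_derivative {n : ℕ} {p : ℂ[X]} (hp : p.natDegree ≤ n) :
    conjRev n (X * derivative p) = C (n : ℂ) * conjRev n p - X * derivative (conjRev n p) := by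
  ext k
  rw [coeff_sub, coeff_C_mul, coeff_X_mul_derivative, coeff_conjRev, coeff_conjRev,
    coeff_X_mul_derivative]
  rcases le_or_gt k n with h | h
  · rw [revAt_le h, Nat.cast_sub h]
    simp; ring
  · rw [revAt_eq_self_of_lt h, coeff_eq_zero_of_natDegree_lt (by omega)]
    simp

theorem eval_conjRev {n : ℕ} {p : ℂ[X]} (hp : p.natDegree ≤ n) {z : ℂ} (hz : z ≠ 0) :
    (conjRev n p).eval z = z ^ n * conj (p.eval (conj z)⁻¹) := by
  rw [eval_eq_sum_range' (Nat.lt_succ_of_le (conjRev_natDegree_le hp)),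
    eval_eq_sum_range' (Nat.lt_succ_of_le hp), map_sum, Finset.mul_sum,
    ← Finset.sum_range_reflect]
  refine Finset.sum_congr rfl fun k hk => ?_
  have hk' : k ≤ n := by simpa [Nat.lt_succ_iff] using hk
  have e : n + 1 - 1 - k = n - k := by omega
  rw [e, coeff_conjRev_of_le _ (Nat.sub_le _ _), Nat.sub_sub_self hk']
  simp only [map_mul, map_pow, map_inv₀, Complex.conj_conj]
  rw [← Nat.sub_add_cancel hk', pow_add, Nat.sub_add_cancel hk']
  rw [inv_pow, mul_assoc, mul_comm (z ^ k), mul_assoc, inv_mul_cancel₀ (pow_ne_zero _ hz)]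
  ring

/-- The reality condition on the values of a polynomial in terms of its coefficients. -/
theorem conjRev_eq_self_iff {n : ℕ} {p : ℂ[X]} (hp : p.natDegree ≤ n) :
    conjRev n p = p ↔
      ∀ z : ℂ, z ≠ 0 → ((conj z)⁻¹) ^ n * conj (p.eval z) = p.eval (conj z)⁻¹ := by
  constructor
  · intro h z hz
    have hz' : (conj z)⁻¹ ≠ 0 := by simpa using hz
    conv_rhs => rw [← h]
    rw [eval_conjRev hp hz']
    simp
  · intro h
    refine Polynomial.eq_of_infinite_eval_eq _ _ (Set.Infinite.mono (s := {0}ᶜ) ?_ ?_)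
    · intro z hz
      have hz : z ≠ 0 := hz
      have hz' : (conj z)⁻¹ ≠ 0 := by simpa using hz
      have := h _ hz'
      simp only [Set.mem_ofPred_eq]
      rw [eval_conjRev hp hz]
      simpa using this
    · exact (Set.finite_singleton (0 : ℂ)).infinite_compl

theorem conjRev_coeffPoly {n : ℕ} (c : Fin (n + 1) → ℂ) :
    conjRev n (coeffPoly c) = coeffPoly fun k => conj (c (Fin.rev k)) := by
  ext k
  rw [coeff_conjRev, coeff_coeffPoly, coeff_coeffPoly]
  rcases le_or_gt k n with h | h
  · rw [revAt_le h, dif_pos (by omega), dif_pos (by omega)]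
    congr 2
    ext; simp
  · rw [revAt_eq_self_of_lt h, dif_neg (by omega), dif_neg (by omega), map_zero]

end

section
open Polynomial

/-! ### The linearized Whitham equations -/

/-- Infinitesimal deformations of spectral data: the velocities of the coefficients of `a`, `b₁`,
`b₂`, the logarithmic derivatives `y_j` of the sym points, and the coefficients of the numerators
`c₁`, `c₂` of `∂ₜ ln μ_i = π c_i / ν`. -/
abbrev Variation (g : ℕ) : Type := SpectralData g × (Fin 2 → Fin (g + 2) → ℂ)

/-- The space of values of the extended linearization. -/
abbrev VariationTarget (g : ℕ) : Type :=
  (Fin 2 → Fin (3 * g + 2) → ℂ) × (Fin 2 → Fin 2 → ℂ) × (ℂ × ℂ × ℂ)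

namespace SpectralData

variable {g : ℕ}

/-- The polynomial `c_i` of a variation. -/
def _root_.Variation.c (v : Variation g) (i : Fin 2) : ℂ[X] := coeffPoly (v.2 i)

@[simp] theorem a_add (v w : SpectralData g) : (v + w).a = v.a + w.a := coeffPoly_add _ _
@[simp] theorem a_smul (z : ℂ) (v : SpectralData g) : (z • v).a = C z * v.a := coeffPoly_smul _ _
@[simp] theorem b_add (v w : SpectralData g) (i : Fin 2) : (v + w).b i = v.b i + w.b i :=
  coeffPoly_add _ _
@[simp] theorem b_smul (z : ℂ) (v : SpectralData g) (i : Fin 2) : (z • v).b i = C z * v.b i :=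
  coeffPoly_smul _ _
@[simp] theorem sym_add (v w : SpectralData g) (j : Fin 2) : (v + w).sym j = v.sym j + w.sym j := rfl
@[simp] theorem sym_smul (z : ℂ) (v : SpectralData g) (j : Fin 2) : (z • v).sym j = z * v.sym j :=
  rfl
@[simp] theorem _root_.Variation.c_add (v w : Variation g) (i : Fin 2) :
    (v + w).c i = v.c i + w.c i := coeffPoly_add _ _
@[simp] theorem _root_.Variation.c_smul (z : ℂ) (v : Variation g) (i : Fin 2) :
    (z • v).c i = C z * v.c i := coeffPoly_smul _ _

theorem a_natDegree_le (S : SpectralData g) : S.a.natDegree ≤ 2 * g := coeffPoly_natDegree_le _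
theorem b_natDegree_le (S : SpectralData g) (i : Fin 2) : (S.b i).natDegree ≤ g + 1 :=
  coeffPoly_natDegree_le _
theorem _root_.Variation.c_natDegree_le (v : Variation g) (i : Fin 2) :
    (v.c i).natDegree ≤ g + 1 := coeffPoly_natDegree_le _

/-- The defect of the linearized Whitham equation
`2 a ḃ_i - b_i ȧ = 2 λ a c_i' - (λ a)' c_i`, which expresses that
`∂ₜ (b_i / ν) dλ / λ = d (c_i / ν)`. -/
def whitham (S : SpectralData g) (v : Variation g) (i : Fin 2) : ℂ[X] :=
  C 2 * (S.a * v.1.b i) - S.b i * v.1.a - C 2 * (S.a * (X * derivative (v.c i))) +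
    (S.a + X * derivative S.a) * v.c i

/-- The defect of the condition that the value of `μ_i` at the sym point `λ_j` does not change. -/
def closingDefect (S : SpectralData g) (v : Variation g) (i j : Fin 2) : ℂ :=
  (v.c i).eval (S.sym j) + (S.b i).eval (S.sym j) * v.1.sym j

/-- The polynomial `c₁ b₂ - c₂ b₁`. -/
def wronski (S : SpectralData g) (v : Variation g) : ℂ[X] := v.c 0 * S.b 1 - v.c 1 * S.b 0

/-- A symmetrized leading coefficient of `c₁ b₂ - c₂ b₁`, which measures the velocity along the
family transversally to the coordinate changes. -/
def speed (S : SpectralData g) (v : Variation g) : ℂ :=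
  (S.wronski v).coeff (2 * g + 2) * (S.sym 0 * S.sym 1 * S.a.coeff 0) +
    (S.wronski v).coeff 0 * S.a.coeff (2 * g)

/-- The value of `speed` that is used to normalize the velocity. -/
def unitSpeed (S : SpectralData g) : ℂ :=
  (S.sym 1 - S.sym 0) * (S.a.coeff 0 * S.a.coeff (2 * g))

/-- A variation is an infinitesimal deformation if it satisfies the linearized Whitham equations
and preserves the closing conditions. -/
def IsInfinitesimal (S : SpectralData g) (v : Variation g) : Prop :=
  (∀ i, S.whitham v i = 0) ∧ ∀ i j, S.closingDefect v i j = 0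

theorem natDegree_X_mul_derivative_le {n : ℕ} {p : ℂ[X]} (hp : p.natDegree ≤ n) :
    (X * derivative p).natDegree ≤ n := by
  rw [natDegree_le_iff_coeff_eq_zero]
  intro k hk
  rw [coeff_X_mul_derivative, coeff_eq_zero_of_natDegree_lt (by omega), mul_zero]

theorem natDegree_sub_le_of_degree_le {n : ℕ} {p q : ℂ[X]} (hp : p.natDegree ≤ n)
    (hq : q.natDegree ≤ n) : (p - q).natDegree ≤ n :=
  (natDegree_sub_le_of_le hp hq).trans (max_self n).le

theorem whitham_natDegree_le (S : SpectralData g) (v : Variation g) (i : Fin 2) :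
    (S.whitham v i).natDegree ≤ 3 * g + 1 := by
  have ha := S.a_natDegree_le
  have hb := S.b_natDegree_le i
  have ha' := v.1.a_natDegree_le
  have hb' := v.1.b_natDegree_le i
  have hc := v.c_natDegree_le i
  have hc' := natDegree_X_mul_derivative_le hc
  have ha'' : (S.a + X * derivative S.a).natDegree ≤ 2 * g :=
    natDegree_add_le_of_degree_le ha (natDegree_X_mul_derivative_le ha)
  have e : 2 * g + (g + 1) ≤ 3 * g + 1 := by omega
  have e' : (g + 1) + 2 * g ≤ 3 * g + 1 := by omega
  refine natDegree_add_le_of_degree_le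
    (natDegree_sub_le_of_degree_le (natDegree_sub_le_of_degree_le ?_ ?_) ?_) ?_
  · exact (natDegree_C_mul_le _ _).trans ((natDegree_mul_le_of_le ha hb').trans e)
  · exact (natDegree_mul_le_of_le hb ha').trans e'
  · exact (natDegree_C_mul_le _ _).trans ((natDegree_mul_le_of_le ha hc').trans e)
  · exact (natDegree_mul_le_of_le ha'' hc).trans e

/-- The linearized Whitham equations, the closing conditions, and three normalizations that remove
the freedom of the speed, of the rotations of `λ` and of the rescalings of `ν`. -/
def linearization (S : SpectralData g) : Variation g →ₗ[ℂ] VariationTarget g where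
  toFun v := (fun i k => (S.whitham v i).coeff k, fun i j => S.closingDefect v i j,
    (S.speed v, v.1.sym 0, v.1.a.coeff g))
  map_add' v w := by
    refine Prod.ext ?_ (Prod.ext ?_ (Prod.ext ?_ (Prod.ext ?_ ?_)))
    · funext i k
      have : S.whitham (v + w) i = S.whitham v i + S.whitham w i := by
        simp only [whitham, Prod.fst_add, b_add, a_add, Variation.c_add, derivative_add]; ring
      simp [this]
    · funext i j
      simp only [closingDefect, Prod.fst_add, Variation.c_add, eval_add, sym_add, Prod.snd_add,
        Pi.add_apply]
      ring
    · have : S.wronski (v + w) = S.wronski v + S.wronski w := by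
        simp only [wronski, Variation.c_add]; ring
      simp only [speed, this, coeff_add, Prod.fst_add, Prod.snd_add]
      ring
    · rfl
    · simp
  map_smul' z v := by
    refine Prod.ext ?_ (Prod.ext ?_ (Prod.ext ?_ (Prod.ext ?_ ?_)))
    · funext i k
      have : S.whitham (z • v) i = C z * S.whitham v i := by
        simp only [whitham, Prod.smul_fst, b_smul, a_smul, Variation.c_smul, derivative_C_mul]; ring
      simp [this]
    · funext i j
      simp only [closingDefect, Prod.smul_fst, Variation.c_smul, eval_mul, eval_C, sym_smul,
        Prod.smul_snd, Pi.smul_apply, RingHom.id_apply, smul_eq_mul]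
      ring
    · have : S.wronski (z • v) = C z * S.wronski v := by
        simp only [wronski, Variation.c_smul]; ring
      simp only [speed, this, coeff_C_mul, Prod.smul_fst, Prod.smul_snd, RingHom.id_apply,
        smul_eq_mul]
      ring
    · rfl
    · simp

theorem linearization_eq_iff (S : SpectralData g) (v : Variation g) (x y z : ℂ) :
    S.linearization v = (0, 0, (x, y, z)) ↔
      S.IsInfinitesimal v ∧ S.speed v = x ∧ v.1.sym 0 = y ∧ v.1.a.coeff g = z := by
  have key : (fun (i : Fin 2) (k : Fin (3 * g + 2)) => (S.whitham v i).coeff k) = 0 ↔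
      ∀ i, S.whitham v i = 0 := by
    constructor
    · intro h i
      rw [← coeffPoly_coeff (S.whitham_natDegree_le v i)]
      have := congrFun h i
      exact (congrArg coeffPoly this).trans coeffPoly_zero
    · intro h
      funext i k
      simp [h i]
  have key' : (fun i j => S.closingDefect v i j) = 0 ↔ ∀ i j, S.closingDefect v i j = 0 := by
    simp [funext_iff]
  simp only [linearization, LinearMap.coe_mk, AddHom.coe_mk, Prod.mk.injEq, key, key',
    IsInfinitesimal, and_assoc]

/-- Spectral data whose roots and leading coefficients are in general position. -/
structure Regular (S : SpectralData g) : Prop where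
  lead : S.a.coeff (2 * g) ≠ 0
  const : S.a.coeff 0 ≠ 0
  mid : S.a.coeff g ≠ 0
  separable : S.a.Separable
  a_sym : ∀ j, S.a.eval (S.sym j) ≠ 0
  sym_ne : S.sym 0 ≠ S.sym 1
  sym_ne_zero : ∀ j, S.sym j ≠ 0
  b_lead : ∀ i, (S.b i).coeff (g + 1) ≠ 0
  coprime : IsCoprime (S.b 0) (S.b 1)

theorem natDegree_eq_of_coeff_ne_zero {n : ℕ} {p : ℂ[X]} (hp : p.natDegree ≤ n)
    (h : p.coeff n ≠ 0) : p.natDegree = n :=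
  le_antisymm hp (le_natDegree_of_ne_zero h)

/-- The polynomial `a` divides `c₁ b₂ - c₂ b₁`, since at a root of `a` both `c_i` are multiples of
`b_i` with the same factor. -/
theorem Regular.a_dvd_wronski {S : SpectralData g} (hS : S.Regular) {v : Variation g}
    (hv : ∀ i, S.whitham v i = 0) : S.a ∣ S.wronski v := by
  have h0 := hv 0
  have h1 := hv 1
  have hX : IsCoprime S.a X := by
    rw [isCoprime_comm, irreducible_X.coprime_iff_not_dvd, X_dvd_iff]
    exact hS.const
  have h2 : S.a ∣ (X * derivative S.a) * S.wronski v := by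
    refine ⟨(C 2 * v.1.b 1 - C 2 * (X * derivative (v.c 1)) + v.c 1) * S.b 0 -
      (C 2 * v.1.b 0 - C 2 * (X * derivative (v.c 0)) + v.c 0) * S.b 1, ?_⟩
    simp only [whitham] at h0 h1
    simp only [wronski]
    linear_combination S.b 1 * h0 - S.b 0 * h1
  exact (hX.mul_right hS.separable).dvd_of_dvd_mul_left h2

/-- An infinitesimal deformation without speed is the sum of a rotation of `λ` and a rescaling
of `ν`; so it vanishes if it is normalized. -/
theorem Regular.eq_zero {S : SpectralData g} (hS : S.Regular) {v : Variation g}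
    (hv : S.IsInfinitesimal v) (h1 : S.speed v = 0) (h2 : v.1.sym 0 = 0)
    (h3 : v.1.a.coeff g = 0) : v = 0 := by
  obtain ⟨hw, hc⟩ := hv
  have ha0 : S.a ≠ 0 := fun h => hS.lead (by simp [h])
  have hadeg := natDegree_eq_of_coeff_ne_zero S.a_natDegree_le hS.lead
  have hwdeg : (S.wronski v).natDegree ≤ 2 * g + 2 := by
    have e : (g + 1) + (g + 1) = 2 * g + 2 := by ring
    exact natDegree_sub_le_of_degree_le
      ((natDegree_mul_le_of_le (v.c_natDegree_le 0) (S.b_natDegree_le 1)).trans e.le)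
      ((natDegree_mul_le_of_le (v.c_natDegree_le 1) (S.b_natDegree_le 0)).trans e.le)
  obtain ⟨Q, hQ⟩ := hS.a_dvd_wronski hw
  have hwsym : ∀ j, (S.wronski v).eval (S.sym j) = 0 := by
    intro j
    have e0 := hc 0 j
    have e1 := hc 1 j
    simp only [closingDefect] at e0 e1
    simp only [wronski, eval_sub, eval_mul]
    linear_combination (S.b 1).eval (S.sym j) * e0 - (S.b 0).eval (S.sym j) * e1
  have hQsym : ∀ j, Q.IsRoot (S.sym j) := by
    intro j
    have := hwsym j
    rw [hQ, eval_mul] at this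
    exact (mul_eq_zero.1 this).resolve_left (hS.a_sym j)
  have hQ0 : Q = 0 := by
    by_contra hQne
    have hQdeg : Q.natDegree ≤ 2 := by
      have := natDegree_mul ha0 hQne
      rw [← hQ] at this
      omega
    -- `Q` is a multiple of `(λ - λ₁) (λ - λ₂)`, and `speed` detects the factor.
    obtain ⟨q, hq⟩ : (X - C (S.sym 0)) * (X - C (S.sym 1)) ∣ Q :=
      (isCoprime_X_sub_C_of_isUnit_sub (sub_ne_zero.2 hS.sym_ne).isUnit).mul_dvd
        (dvd_iff_isRoot.2 (hQsym 0)) (dvd_iff_isRoot.2 (hQsym 1))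
    have hmon : ((X - C (S.sym 0)) * (X - C (S.sym 1))).Monic :=
      (monic_X_sub_C _).mul (monic_X_sub_C _)
    have hqne : q ≠ 0 := by rintro rfl; exact hQne (by simpa using hq)
    have hmdeg : ((X - C (S.sym 0)) * (X - C (S.sym 1))).natDegree = 2 := by
      rw [(monic_X_sub_C _).natDegree_mul (monic_X_sub_C _)]; simp
    have hqdeg : q.natDegree = 0 := by
      have := hmon.natDegree_mul' hqne
      rw [← hq, hmdeg] at this
      omega
    obtain ⟨x, rfl⟩ : ∃ x, q = C x := ⟨_, eq_C_of_natDegree_eq_zero hqdeg⟩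
    have hQ2 : Q.coeff 2 = x := by
      have : Q = C x * X ^ 2 - C (x * (S.sym 0 + S.sym 1)) * X + C (x * (S.sym 0 * S.sym 1)) := by
        rw [hq]; simp only [C_mul, C_add]; ring
      rw [this]
      simp
    have hQc : Q.coeff 0 = x * (S.sym 0 * S.sym 1) := by
      rw [hq]; simp only [mul_coeff_zero, coeff_sub, coeff_X_zero, coeff_C_zero]; ring
    have l1 : (S.wronski v).coeff (2 * g + 2) = S.a.coeff (2 * g) * x := by
      rw [hQ, coeff_mul_add_eq_of_natDegree_le S.a_natDegree_le hQdeg, hQ2]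
    have l2 : (S.wronski v).coeff 0 = S.a.coeff 0 * (x * (S.sym 0 * S.sym 1)) := by
      rw [hQ, mul_coeff_zero, hQc]
    rw [speed, l1, l2] at h1
    have : (2 * (S.a.coeff (2 * g) * S.a.coeff 0 * (S.sym 0 * S.sym 1))) * x = 0 := by
      linear_combination h1
    have hx : x = 0 := (mul_eq_zero.1 this).resolve_left
      (mul_ne_zero two_ne_zero (mul_ne_zero (mul_ne_zero hS.lead hS.const)
        (mul_ne_zero (hS.sym_ne_zero 0) (hS.sym_ne_zero 1))))
    exact hqne (by simp [hx])
  have hwr : v.c 0 * S.b 1 = v.c 1 * S.b 0 := by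
    have : S.wronski v = 0 := by rw [hQ, hQ0, mul_zero]
    exact sub_eq_zero.1 this
  have hb0 : ∀ i, S.b i ≠ 0 := fun i h => hS.b_lead i (by simp [h])
  have hbdeg := fun i => natDegree_eq_of_coeff_ne_zero (S.b_natDegree_le i) (hS.b_lead i)
  -- `b₁` and `b₂` are coprime, so that `c_i = x b_i` with a common factor `x`.
  obtain ⟨x, hx⟩ : ∃ x : ℂ, v.c 0 = C x * S.b 0 := by
    obtain ⟨q, hq⟩ : S.b 0 ∣ v.c 0 := hS.coprime.dvd_of_dvd_mul_right ⟨v.c 1, by rw [hwr]; ring⟩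
    rcases eq_or_ne q 0 with rfl | hqne
    · exact ⟨0, by simpa using hq⟩
    have hqdeg : q.natDegree = 0 := by
      have h := natDegree_mul (hb0 0) hqne
      have h' := v.c_natDegree_le 0
      rw [← hq, hbdeg] at h
      omega
    exact ⟨q.coeff 0, by rw [hq, eq_C_of_natDegree_eq_zero hqdeg]; simp [mul_comm]⟩
  have hx1 : v.c 1 = C x * S.b 1 := by
    rw [hx] at hwr
    exact mul_right_cancel₀ (hb0 0) (by rw [← hwr]; ring)
  have hxi : ∀ i, v.c i = C x * S.b i := by
    intro i; fin_cases i
    · exact hx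
    · exact hx1
  have hbsym : ∀ z : ℂ, ∃ i, (S.b i).eval z ≠ 0 := by
    intro z
    by_contra! h
    obtain ⟨p, q, hpq⟩ := hS.coprime
    have := congrArg (eval z) hpq
    simp [h 0, h 1] at this
  have hx0 : x = 0 := by
    obtain ⟨i, hi⟩ := hbsym (S.sym 0)
    have := hc i 0
    rw [closingDefect, hxi, h2, eval_mul, eval_C, mul_zero, add_zero] at this
    exact (mul_eq_zero.1 this).resolve_right hi
  have hc0 : ∀ i, v.c i = 0 := fun i => by rw [hxi, hx0]; simp
  have hab : ∀ i, C 2 * (S.a * v.1.b i) = S.b i * v.1.a := by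
    intro i
    have := hw i
    rw [whitham, hc0] at this
    simpa [sub_eq_zero] using this
  have hda : S.a ∣ v.1.a := by
    obtain ⟨p, q, hpq⟩ := hS.coprime
    refine ⟨C 2 * (p * v.1.b 0 + q * v.1.b 1), ?_⟩
    linear_combination (-v.1.a) * hpq - p * hab 0 - q * hab 1
  have hva : v.1.a = 0 := by
    obtain ⟨q, hq⟩ := hda
    rcases eq_or_ne q 0 with rfl | hqne
    · simpa using hq
    have hqdeg : q.natDegree = 0 := by
      have h := natDegree_mul ha0 hqne
      have h' := v.1.a_natDegree_le
      rw [← hq, hadeg] at h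
      omega
    obtain ⟨w, rfl⟩ : ∃ w, q = C w := ⟨_, eq_C_of_natDegree_eq_zero hqdeg⟩
    rw [hq, coeff_mul_C] at h3
    rw [hq, (mul_eq_zero.1 h3).resolve_left hS.mid]
    simp
  have hvb : ∀ i, v.1.b i = 0 := by
    intro i
    have := hab i
    rw [hva, mul_zero] at this
    simpa [ha0] using this
  have hvy : ∀ j, v.1.sym j = 0 := by
    intro j
    obtain ⟨i, hi⟩ := hbsym (S.sym j)
    have := hc i j
    rw [closingDefect, hc0, eval_zero, zero_add] at this
    exact (mul_eq_zero.1 this).resolve_left hi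
  refine Prod.ext (Prod.ext ?_ (Prod.ext ?_ ?_)) ?_
  · exact coeffPoly_eq_zero hva
  · funext i; exact coeffPoly_eq_zero (hvb i)
  · funext j; exact hvy j
  · funext i; exact coeffPoly_eq_zero (hc0 i)

theorem finrank_variation (g : ℕ) :
    Module.finrank ℂ (Variation g) = Module.finrank ℂ (VariationTarget g) := by
  simp only [Module.finrank_prod, Module.finrank_pi_fintype,
    Module.finrank_self, Finset.sum_const, Finset.card_univ, Fintype.card_fin, smul_eq_mul]
  ring

theorem Regular.linearization_bijective {S : SpectralData g} (hS : S.Regular) :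
    Function.Bijective S.linearization := by
  have hinj : Function.Injective S.linearization := by
    rw [← LinearMap.ker_eq_bot, LinearMap.ker_eq_bot']
    intro v hv
    obtain ⟨h, h1, h2, h3⟩ := (S.linearization_eq_iff v 0 0 0).1 hv
    exact hS.eq_zero h h1 h2 h3
  exact ⟨hinj, (LinearMap.injective_iff_surjective_of_finrank_eq_finrank
    (finrank_variation g)).1 hinj⟩

end SpectralData

end

section
open Polynomial
namespace SpectralData

variable {g : ℕ}

/-! ### The real structure -/

/-- Conjugation and reversal of a list of coefficients. -/
def revConj {n : ℕ} (c : Fin n → ℂ) : Fin n → ℂ := fun k => conj (c (Fin.rev k))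

theorem coeffPoly_revConj {n : ℕ} (c : Fin (n + 1) → ℂ) :
    coeffPoly (revConj c) = conjRev n (coeffPoly c) := (conjRev_coeffPoly c).symm

theorem coeffPoly_neg {n : ℕ} (c : Fin n → ℂ) : coeffPoly (-c) = -coeffPoly c := by
  ext k; simp only [coeff_coeffPoly, coeff_neg]; split_ifs <;> simp

/-- The reality conditions on the spectral data, in terms of the coefficients. -/
structure IsReal (S : SpectralData g) : Prop where
  a : conjRev (2 * g) S.a = S.a
  b : ∀ i, conjRev (g + 1) (S.b i) = S.b i
  sym : ∀ j, ‖S.sym j‖ = 1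

/-- The real structure on the variations. The variations that it fixes are tangent to the real
spectral data, and the functions `c_i / ν` belonging to them are compatible with the involution
`η`; the latter is the reason for the sign of `c_i`. -/
def flip (v : Variation g) : Variation g :=
  ((revConj v.1.1, fun i => revConj (v.1.2.1 i), fun j => -conj (v.1.2.2 j)),
    fun i => -revConj (v.2 i))

theorem flip_a (v : Variation g) : (flip v).1.a = conjRev (2 * g) v.1.a := coeffPoly_revConj _
theorem flip_b (v : Variation g) (i : Fin 2) : (flip v).1.b i = conjRev (g + 1) (v.1.b i) :=
  coeffPoly_revConj _
theorem flip_sym (v : Variation g) (j : Fin 2) : (flip v).1.sym j = -conj (v.1.sym j) := rfl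
theorem flip_c (v : Variation g) (i : Fin 2) : (flip v).c i = -conjRev (g + 1) (v.c i) := by
  rw [Variation.c, flip, coeffPoly_neg, coeffPoly_revConj]; rfl

theorem IsReal.whitham_flip {S : SpectralData g} (hS : S.IsReal) (v : Variation g) (i : Fin 2) :
    S.whitham (flip v) i = conjRev (3 * g + 1) (S.whitham v i) := by
  have e : 3 * g + 1 = 2 * g + (g + 1) := by ring
  have hX : (S.a + X * derivative S.a).natDegree ≤ 2 * g :=
    natDegree_add_le_of_degree_le S.a_natDegree_le
      (natDegree_X_mul_derivative_le S.a_natDegree_le)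
  have e1 : conjRev (3 * g + 1) (S.a * v.1.b i) = S.a * conjRev (g + 1) (v.1.b i) := by
    rw [e, conjRev_mul S.a_natDegree_le (v.1.b_natDegree_le i), hS.a]
  have e2 : conjRev (3 * g + 1) (S.b i * v.1.a) = S.b i * conjRev (2 * g) v.1.a := by
    rw [e, add_comm, conjRev_mul (S.b_natDegree_le i) v.1.a_natDegree_le, hS.b]
  have e3 : conjRev (3 * g + 1) (S.a * (X * derivative (v.c i))) =
      S.a * (C ((g + 1 : ℕ) : ℂ) * conjRev (g + 1) (v.c i) -
        X * derivative (conjRev (g + 1) (v.c i))) := by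
    rw [e, conjRev_mul S.a_natDegree_le (natDegree_X_mul_derivative_le (v.c_natDegree_le i)), hS.a,
      conjRev_X_mul_derivative (v.c_natDegree_le i)]
  have e4 : conjRev (3 * g + 1) ((S.a + X * derivative S.a) * v.c i) =
      (S.a + (C ((2 * g : ℕ) : ℂ) * S.a - X * derivative S.a)) * conjRev (g + 1) (v.c i) := by
    rw [e, conjRev_mul hX (v.c_natDegree_le i), conjRev_add, hS.a,
      conjRev_X_mul_derivative S.a_natDegree_le, hS.a]
  simp only [whitham, conjRev_add, conjRev_sub, conjRev_C_mul, e1, e2, e3, e4, flip_a, flip_b,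
    flip_c, derivative_neg]
  simp only [Nat.cast_add, Nat.cast_mul, Nat.cast_one, Nat.cast_ofNat, C_add,
    C_mul, C_1, map_ofNat]
  ring

theorem inv_conj_of_norm_eq_one {z : ℂ} (hz : ‖z‖ = 1) : (conj z)⁻¹ = z := by
  rw [Complex.inv_def, Complex.conj_conj, Complex.normSq_conj, Complex.normSq_eq_norm_sq, hz]
  simp

theorem IsReal.sym_ne_zero {S : SpectralData g} (hS : S.IsReal) (j : Fin 2) : S.sym j ≠ 0 := by
  intro h
  have := hS.sym j
  simp [h] at this

theorem IsReal.closingDefect_flip {S : SpectralData g} (hS : S.IsReal) (v : Variation g)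
    (i j : Fin 2) :
    S.closingDefect (flip v) i j = -(S.sym j ^ (g + 1) * conj (S.closingDefect v i j)) := by
  have h : (S.b i).eval (S.sym j) = S.sym j ^ (g + 1) * conj ((S.b i).eval (S.sym j)) := by
    conv_lhs => rw [← hS.b i, eval_conjRev (S.b_natDegree_le i) (hS.sym_ne_zero j),
      inv_conj_of_norm_eq_one (hS.sym j)]
  rw [closingDefect, closingDefect, flip_c, eval_neg,
    eval_conjRev (v.c_natDegree_le i) (hS.sym_ne_zero j), inv_conj_of_norm_eq_one (hS.sym j),
    flip_sym, map_add, map_mul]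
  linear_combination (-conj (v.1.sym j)) * h

theorem IsReal.coeff_a {S : SpectralData g} (hS : S.IsReal) {k : ℕ} (hk : k ≤ 2 * g) :
    conj (S.a.coeff (2 * g - k)) = S.a.coeff k := by
  conv_rhs => rw [← hS.a, coeff_conjRev_of_le _ hk]

theorem IsReal.speed_flip {S : SpectralData g} (hS : S.IsReal) (v : Variation g) :
    S.speed (flip v) = -(S.sym 0 * S.sym 1 * conj (S.speed v)) := by
  have hw : S.wronski (flip v) = -conjRev (2 * g + 2) (S.wronski v) := by
    have e : 2 * g + 2 = (g + 1) + (g + 1) := by ring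
    rw [e, wronski, wronski, conjRev_sub, conjRev_mul (v.c_natDegree_le 0) (S.b_natDegree_le 1),
      conjRev_mul (v.c_natDegree_le 1) (S.b_natDegree_le 0), hS.b, hS.b, flip_c, flip_c]
    ring
  have h0 := hS.coeff_a (Nat.zero_le _)
  have h1 := hS.coeff_a le_rfl
  have s0 := inv_conj_of_norm_eq_one (hS.sym 0)
  have s1 := inv_conj_of_norm_eq_one (hS.sym 1)
  have t0 := hS.sym_ne_zero 0
  have t1 := hS.sym_ne_zero 1
  simp only [Nat.sub_zero, Nat.sub_self] at h0 h1
  rw [speed, speed, hw, coeff_neg, coeff_neg, coeff_conjRev_of_le _ le_rfl,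
    coeff_conjRev_of_le _ (Nat.zero_le _)]
  simp only [map_add, map_mul, Nat.sub_zero, Nat.sub_self, h0, h1]
  rw [← inv_inv (conj (S.sym 0)), ← inv_inv (conj (S.sym 1)), s0, s1]
  field_simp
  ring

theorem IsReal.unitSpeed_eq {S : SpectralData g} (hS : S.IsReal) :
    S.unitSpeed = -(S.sym 0 * S.sym 1 * conj S.unitSpeed) := by
  have h0 := hS.coeff_a (Nat.zero_le _)
  have h1 := hS.coeff_a le_rfl
  have s0 := inv_conj_of_norm_eq_one (hS.sym 0)
  have s1 := inv_conj_of_norm_eq_one (hS.sym 1)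
  have t0 := hS.sym_ne_zero 0
  have t1 := hS.sym_ne_zero 1
  simp only [Nat.sub_zero, Nat.sub_self] at h0 h1
  rw [unitSpeed]
  simp only [map_sub, map_mul, h0, h1]
  rw [← inv_inv (conj (S.sym 0)), ← inv_inv (conj (S.sym 1)), s0, s1]
  field_simp
  ring

theorem IsReal.isInfinitesimal_flip {S : SpectralData g} (hS : S.IsReal) {v : Variation g}
    (hv : S.IsInfinitesimal v) : S.IsInfinitesimal (flip v) := by
  constructor
  · intro i; rw [hS.whitham_flip, hv.1, conjRev_zero]
  · intro i j; rw [hS.closingDefect_flip, hv.2]; simp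

/-- A variation is the normalized one: an infinitesimal deformation with unit speed that fixes the
first sym point and the middle coefficient of `a`. -/
def IsUnitVariation (S : SpectralData g) (v : Variation g) : Prop :=
  S.linearization v = (0, 0, (S.unitSpeed, 0, 0))

theorem isUnitVariation_iff (S : SpectralData g) (v : Variation g) : S.IsUnitVariation v ↔
    S.IsInfinitesimal v ∧ S.speed v = S.unitSpeed ∧ v.1.sym 0 = 0 ∧ v.1.a.coeff g = 0 :=
  S.linearization_eq_iff v _ _ _

/-- The normalized infinitesimal deformation of real data is real, since it is unique and the real
structure preserves the normalizations. -/
theorem IsReal.flip_eq {S : SpectralData g} (hS : S.IsReal)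
    (hb : Function.Bijective S.linearization) {v : Variation g} (hv : S.IsUnitVariation v) :
    flip v = v := by
  refine hb.1 (Eq.trans ?_ (Eq.symm hv))
  obtain ⟨h, h1, h2, h3⟩ := (S.isUnitVariation_iff v).1 hv
  refine (S.isUnitVariation_iff _).2 ⟨hS.isInfinitesimal_flip h, ?_, ?_, ?_⟩
  · rw [hS.speed_flip, h1, ← hS.unitSpeed_eq]
  · rw [flip_sym, h2]; simp
  · rw [flip_a, coeff_conjRev_of_le _ (by omega), show 2 * g - g = g by omega, h3, map_zero]

/-! ### Rotations and rescalings -/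

/-- The variation that belongs to the rotations of `λ`. -/
def rotVar (S : SpectralData g) : Variation g :=
  ((fun k => Complex.I * ((g : ℂ) - (k : ℕ)) * S.1 k,
    fun i k => Complex.I * (((g : ℂ) + 1) / 2 - (k : ℕ)) * S.2.1 i k, fun _ => Complex.I),
    fun i k => -Complex.I * S.2.1 i k)

/-- The variation that belongs to the rescalings of `ν`. -/
def scaleVar (S : SpectralData g) : Variation g :=
  ((fun k => 2 * S.1 k, S.2.1, 0), 0)

theorem rotVar_a (S : SpectralData g) :
    S.rotVar.1.a = C Complex.I * (C (g : ℂ) * S.a - X * derivative S.a) := by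
  ext k
  rw [coeff_C_mul, coeff_sub, coeff_C_mul, coeff_X_mul_derivative, a, a, coeff_coeffPoly,
    coeff_coeffPoly, rotVar]
  split_ifs <;> simp; ring

theorem rotVar_b (S : SpectralData g) (i : Fin 2) :
    S.rotVar.1.b i = C Complex.I * (C (((g : ℂ) + 1) / 2) * S.b i - X * derivative (S.b i)) := by
  ext k
  rw [coeff_C_mul, coeff_sub, coeff_C_mul, coeff_X_mul_derivative, b, b, coeff_coeffPoly,
    coeff_coeffPoly, rotVar]
  split_ifs <;> simp; ring

theorem rotVar_c (S : SpectralData g) (i : Fin 2) : S.rotVar.c i = C (-Complex.I) * S.b i :=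
  coeffPoly_smul (-Complex.I) (S.2.1 i)

theorem scaleVar_a (S : SpectralData g) : S.scaleVar.1.a = C 2 * S.a := coeffPoly_smul 2 S.1
theorem scaleVar_b (S : SpectralData g) (i : Fin 2) : S.scaleVar.1.b i = S.b i := rfl
theorem scaleVar_c (S : SpectralData g) (i : Fin 2) : S.scaleVar.c i = 0 := coeffPoly_zero

theorem isInfinitesimal_rotVar (S : SpectralData g) : S.IsInfinitesimal S.rotVar := by
  constructor
  · intro i
    have h2 : (C (((g : ℂ) + 1) / 2) : ℂ[X]) * C 2 = C (g : ℂ) + 1 := by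
      rw [← C_mul, div_mul_cancel₀ _ two_ne_zero, C_add, C_1]
    rw [whitham, rotVar_a, rotVar_b, rotVar_c, derivative_C_mul]
    simp only [C_neg]
    linear_combination (C Complex.I * S.a * S.b i) * h2
  · intro i j
    rw [closingDefect, rotVar_c, eval_mul, eval_C]
    change _ + _ * Complex.I = 0
    ring

theorem isInfinitesimal_scaleVar (S : SpectralData g) : S.IsInfinitesimal S.scaleVar := by
  constructor
  · intro i
    rw [whitham, scaleVar_a, scaleVar_b, scaleVar_c]
    simp; ring
  · intro i j
    rw [closingDefect, scaleVar_c]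
    change _ + _ * (0 : ℂ) = 0
    simp

/-- The coordinate changes, acting on variations. -/
def transformVar (r θ : ℝ) (v : Variation g) : Variation g :=
  (((v.1.transform r θ).1, (v.1.transform r θ).2.1, v.1.2.2),
    (transform r θ (v.1.1, v.2, v.1.2.2)).2.1)

theorem transform_a (r θ : ℝ) (S : SpectralData g) :
    (S.transform r θ).a = C ((r : ℂ) ^ 2 * Complex.exp (g * θ * Complex.I)) *
      S.a.comp (C (Complex.exp (-(θ * Complex.I))) * X) := by
  ext k
  rw [coeff_C_mul, comp_C_mul_X_coeff, a, a, coeff_coeffPoly, coeff_coeffPoly, transform]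
  split_ifs
  · simp only
    rw [← Complex.exp_nat_mul, show ((g : ℂ) - k) * θ * Complex.I =
      g * θ * Complex.I + k * (-(θ * Complex.I)) by ring, Complex.exp_add]
    ring
  · simp

theorem transform_b_aux (r θ : ℝ) (S : SpectralData g) (i : Fin 2) :
    (S.transform r θ).b i = C ((r : ℂ) * Complex.exp ((g + 1) / 2 * θ * Complex.I)) *
      (S.b i).comp (C (Complex.exp (-(θ * Complex.I))) * X) := by
  ext k
  rw [coeff_C_mul, comp_C_mul_X_coeff, b, b, coeff_coeffPoly, coeff_coeffPoly, transform]
  split_ifs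
  · simp only
    rw [← Complex.exp_nat_mul, show (((g : ℂ) + 1) / 2 - k) * θ * Complex.I =
      (g + 1) / 2 * θ * Complex.I + k * (-(θ * Complex.I)) by ring, Complex.exp_add]
    ring
  · simp

theorem transformVar_c (r θ : ℝ) (v : Variation g) (i : Fin 2) :
    (transformVar r θ v).c i = C ((r : ℂ) * Complex.exp ((g + 1) / 2 * θ * Complex.I)) *
      (v.c i).comp (C (Complex.exp (-(θ * Complex.I))) * X) :=
  transform_b_aux r θ (v.1.1, v.2, v.1.2.2) i

theorem X_mul_derivative_comp (p : ℂ[X]) (u : ℂ) :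
    X * derivative (p.comp (C u * X)) = (X * derivative p).comp (C u * X) := by
  rw [derivative_comp, derivative_C_mul, derivative_X, mul_comp, X_comp]; ring

theorem whitham_transform (r θ : ℝ) (S : SpectralData g) (v : Variation g) (i : Fin 2) :
    (S.transform r θ).whitham (transformVar r θ v) i =
      C ((r : ℂ) ^ 2 * Complex.exp (g * θ * Complex.I) *
        ((r : ℂ) * Complex.exp ((g + 1) / 2 * θ * Complex.I))) *
      (S.whitham v i).comp (C (Complex.exp (-(θ * Complex.I))) * X) := by
  have h1 : (transformVar r θ v).1.a = (v.1.transform r θ).a := rfl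
  have h2 : (transformVar r θ v).1.b i = (v.1.transform r θ).b i := rfl
  rw [whitham, whitham, h1, h2, transformVar_c, transform_a, transform_a, transform_b_aux,
    transform_b_aux, derivative_C_mul, derivative_C_mul, mul_left_comm X, mul_left_comm X,
    X_mul_derivative_comp, X_mul_derivative_comp]
  simp only [add_comp, sub_comp, mul_comp, C_comp, C_mul, X_comp]
  ring

theorem eval_transform_sym (θ : ℝ) (S : SpectralData g) (r : ℝ) (j : Fin 2) (p : ℂ[X]) :
    (p.comp (C (Complex.exp (-(θ * Complex.I))) * X)).eval ((S.transform r θ).sym j) =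
      p.eval (S.sym j) := by
  rw [eval_comp]
  congr 1
  simp only [eval_mul, eval_C, eval_X, transform, sym]
  rw [← mul_assoc, ← Complex.exp_add]
  simp

theorem closingDefect_transform (r θ : ℝ) (S : SpectralData g) (v : Variation g) (i j : Fin 2) :
    (S.transform r θ).closingDefect (transformVar r θ v) i j =
      (r : ℂ) * Complex.exp ((g + 1) / 2 * θ * Complex.I) * S.closingDefect v i j := by
  have h3 : (transformVar r θ v).1.sym j = v.1.sym j := rfl
  rw [closingDefect, closingDefect, h3, transformVar_c, transform_b_aux, eval_mul, eval_mul,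
    eval_transform_sym, eval_transform_sym, eval_C]
  ring

theorem transform_sym (r θ : ℝ) (S : SpectralData g) (j : Fin 2) :
    (S.transform r θ).sym j = Complex.exp (θ * Complex.I) * S.sym j := rfl

/-- The normalized variation is equivariant under the coordinate changes. -/
theorem IsUnitVariation.transform (r θ : ℝ) {S : SpectralData g} {v : Variation g}
    (hv : S.IsUnitVariation v) : (S.transform r θ).IsUnitVariation (transformVar r θ v) := by
  obtain ⟨⟨hw, hc⟩, h1, h2, h3⟩ := (S.isUnitVariation_iff v).1 hv
  refine (isUnitVariation_iff _ _).2 ⟨⟨fun i => ?_, fun i j => ?_⟩, ?_, h2, ?_⟩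
  · rw [whitham_transform, hw]; simp
  · rw [closingDefect_transform, hc, mul_zero]
  · have hwr : (S.transform r θ).wronski (transformVar r θ v) =
        C (((r : ℂ) * Complex.exp ((g + 1) / 2 * θ * Complex.I)) ^ 2) *
          (S.wronski v).comp (C (Complex.exp (-(θ * Complex.I))) * X) := by
      rw [wronski, wronski, transformVar_c, transformVar_c, transform_b_aux, transform_b_aux]
      simp only [sub_comp, mul_comp, C_pow]; ring
    have e1 : Complex.exp ((g + 1) / 2 * θ * Complex.I) ^ 2 =
        Complex.exp (θ * Complex.I) ^ (g + 1) := by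
      rw [← Complex.exp_nat_mul, ← Complex.exp_nat_mul]; congr 1; push_cast; ring
    have e2 : Complex.exp (g * θ * Complex.I) = Complex.exp (θ * Complex.I) ^ g := by
      rw [← Complex.exp_nat_mul]; congr 1; ring
    have hne : Complex.exp (θ * Complex.I) ≠ 0 := Complex.exp_ne_zero _
    rw [speed, unitSpeed] at *
    rw [hwr, transform_a, transform_sym, transform_sym]
    simp only [coeff_C_mul, comp_C_mul_X_coeff, pow_zero, mul_one, mul_pow, e1, e2,
      Complex.exp_neg]
    generalize Complex.exp (θ * Complex.I) = E at *
    have f1 : E⁻¹ ^ (2 * g) = (E ^ g)⁻¹ ^ 2 := by rw [inv_pow, inv_pow, ← pow_mul, mul_comm]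
    have f2 : E⁻¹ ^ (2 * g + 2) = (E ^ g)⁻¹ ^ 2 * E⁻¹ ^ 2 := by rw [pow_add, f1]
    rw [f1, f2, pow_succ E g]
    have hF : E ^ g ≠ 0 := pow_ne_zero _ hne
    generalize E ^ g = F at *
    field_simp
    linear_combination (r : ℂ) ^ 4 * h1
  · change (v.1.transform r θ).a.coeff g = 0
    rw [transform_a, coeff_C_mul, comp_C_mul_X_coeff, h3]
    simp

end SpectralData

end

section
open Polynomial
namespace SpectralData

variable {g : ℕ}

/-! ### The vector field of the deformation -/

/-- The velocity of the spectral data that belongs to a variation. -/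
def velocity (S : SpectralData g) (v : Variation g) : SpectralData g :=
  (v.1.1, v.1.2.1, fun j => v.1.2.2 j * S.2.2 j)

/-- A polynomial that depends on spectral data has smooth coefficients. -/
def SmoothCoeffs (P : SpectralData g → ℂ[X]) : Prop :=
  ∀ k, ContDiff ℂ ∞ fun S => (P S).coeff k

theorem smoothCoeffs_a : SmoothCoeffs (g := g) a := by
  intro k
  simp only [a, coeff_coeffPoly]
  split_ifs
  · fun_prop
  · exact contDiff_const

theorem smoothCoeffs_b (i : Fin 2) : SmoothCoeffs (g := g) fun S => S.b i := by
  intro k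
  simp only [b, coeff_coeffPoly]
  split_ifs
  · fun_prop
  · exact contDiff_const

theorem smoothCoeffs_const (p : ℂ[X]) : SmoothCoeffs (g := g) fun _ => p :=
  fun _ => contDiff_const

theorem SmoothCoeffs.add {P Q : SpectralData g → ℂ[X]} (hP : SmoothCoeffs P) (hQ : SmoothCoeffs Q) :
    SmoothCoeffs fun S => P S + Q S := by
  intro k; simp only [coeff_add]; exact (hP k).add (hQ k)

theorem SmoothCoeffs.sub {P Q : SpectralData g → ℂ[X]} (hP : SmoothCoeffs P) (hQ : SmoothCoeffs Q) :
    SmoothCoeffs fun S => P S - Q S := by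
  intro k; simp only [coeff_sub]; exact (hP k).sub (hQ k)

theorem SmoothCoeffs.mul {P Q : SpectralData g → ℂ[X]} (hP : SmoothCoeffs P) (hQ : SmoothCoeffs Q) :
    SmoothCoeffs fun S => P S * Q S := by
  intro k
  simp only [coeff_mul]
  exact ContDiff.sum fun x _ => (hP x.1).mul (hQ x.2)

theorem SmoothCoeffs.X_mul_derivative {P : SpectralData g → ℂ[X]} (hP : SmoothCoeffs P) :
    SmoothCoeffs fun S => X * derivative (P S) := by
  intro k
  simp only [coeff_X_mul_derivative]
  exact contDiff_const.mul (hP k)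

theorem SmoothCoeffs.eval {P : SpectralData g → ℂ[X]} (hP : SmoothCoeffs P) {n : ℕ}
    (hn : ∀ S, (P S).natDegree ≤ n) {f : SpectralData g → ℂ} (hf : ContDiff ℂ ∞ f) :
    ContDiff ℂ ∞ fun S => (P S).eval (f S) := by
  have : (fun S => (P S).eval (f S)) =
      fun S => ∑ k ∈ Finset.range (n + 1), (P S).coeff k * f S ^ k :=
    funext fun S => eval_eq_sum_range' (Nat.lt_succ_of_le (hn S)) _
  rw [this]
  exact ContDiff.sum fun k _ => (hP k).mul (hf.pow k)

theorem contDiff_sym (j : Fin 2) : ContDiff ℂ ∞ fun S : SpectralData g => S.sym j := by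
  unfold sym; fun_prop

/-- The linearization as a continuous linear map. -/
def linearizationL (S : SpectralData g) : Variation g →L[ℂ] VariationTarget g :=
  LinearMap.toContinuousLinearMap S.linearization

@[simp] theorem linearizationL_apply (S : SpectralData g) (v : Variation g) :
    S.linearizationL v = S.linearization v := rfl

theorem contDiff_unitSpeed : ContDiff ℂ ∞ (unitSpeed (g := g)) :=
  ((contDiff_sym 1).sub (contDiff_sym 0)).mul ((smoothCoeffs_a 0).mul (smoothCoeffs_a (2 * g)))

theorem contDiff_linearizationL : ContDiff ℂ ∞ (linearizationL (g := g)) := by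
  rw [contDiff_clm_apply_iff]
  intro v
  have hw : SmoothCoeffs fun S => S.wronski v :=
    ((smoothCoeffs_const _).mul (smoothCoeffs_b 1)).sub
      ((smoothCoeffs_const _).mul (smoothCoeffs_b 0))
  refine ContDiff.prodMk ?_ (ContDiff.prodMk ?_ (ContDiff.prodMk ?_ contDiff_const))
  · refine contDiff_pi.2 fun i => contDiff_pi.2 fun k => ?_
    exact ((((smoothCoeffs_const _).mul (smoothCoeffs_a.mul (smoothCoeffs_const _))).sub
      ((smoothCoeffs_b i).mul (smoothCoeffs_const _))).sub ((smoothCoeffs_const _).mul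
        (smoothCoeffs_a.mul (smoothCoeffs_const _)))).add
        ((smoothCoeffs_a.add smoothCoeffs_a.X_mul_derivative).mul (smoothCoeffs_const _)) k
  · refine contDiff_pi.2 fun i => contDiff_pi.2 fun j => ?_
    exact ((smoothCoeffs_const _).eval (fun _ => le_rfl) (contDiff_sym j)).add
      (((smoothCoeffs_b i).eval (fun S => S.b_natDegree_le i) (contDiff_sym j)).mul contDiff_const)
  · exact ((hw _).mul (((contDiff_sym 0).mul (contDiff_sym 1)).mul (smoothCoeffs_a 0))).add
      ((hw _).mul (smoothCoeffs_a _))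

/-- The normalized infinitesimal deformation. -/
def unitVar (S : SpectralData g) : Variation g :=
  S.linearizationL.inverse (0, 0, (S.unitSpeed, 0, 0))

theorem exists_equiv_of_bijective {S : SpectralData g} (h : Function.Bijective S.linearization) :
    ∃ e : Variation g ≃L[ℂ] VariationTarget g, (e : Variation g →L[ℂ] VariationTarget g) =
      S.linearizationL :=
  ⟨(LinearEquiv.ofBijective S.linearization h).toContinuousLinearEquiv, rfl⟩

theorem isUnitVariation_unitVar {S : SpectralData g} (h : Function.Bijective S.linearization) :
    S.IsUnitVariation S.unitVar := by
  obtain ⟨e, he⟩ := exists_equiv_of_bijective h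
  rw [IsUnitVariation, ← linearizationL_apply, unitVar, ← he, ContinuousLinearMap.inverse_equiv]
  simp

theorem eq_unitVar {S : SpectralData g} (h : Function.Bijective S.linearization) {v : Variation g}
    (hv : S.IsUnitVariation v) : v = S.unitVar :=
  h.1 (Eq.trans hv (Eq.symm (isUnitVariation_unitVar h)))

theorem eventually_bijective {S : SpectralData g} (h : Function.Bijective S.linearization) :
    ∀ᶠ T in nhds S, Function.Bijective T.linearization := by
  obtain ⟨e, he⟩ := exists_equiv_of_bijective h
  have := (contDiff_linearizationL (g := g)).continuous.continuousAt (x := S)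
  have h2 := e.nhds
  rw [he] at h2
  filter_upwards [this h2] with T hT
  obtain ⟨e', he'⟩ := hT
  have : (T.linearization : Variation g → VariationTarget g) = e' := by
    funext v; rw [← linearizationL_apply, ← he']; rfl
  rw [this]
  exact e'.bijective

theorem contDiffAt_unitVar {S : SpectralData g} (h : Function.Bijective S.linearization) :
    ContDiffAt ℝ ∞ unitVar S := by
  obtain ⟨e, he⟩ := exists_equiv_of_bijective h
  have h1 : ContDiffAt ℂ ∞ (fun T : SpectralData g => T.linearizationL.inverse) S := by
    have := contDiffAt_map_inverse (𝕜 := ℂ) (n := ∞) e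
    rw [he] at this
    exact ContDiffAt.comp S this contDiff_linearizationL.contDiffAt
  have h2 : ContDiffAt ℂ ∞ (unitVar (g := g)) S := by
    refine h1.clm_apply ?_
    exact (contDiff_const.prodMk (contDiff_const.prodMk
      (contDiff_unitSpeed.prodMk contDiff_const))).contDiffAt
  exact h2.restrict_scalars ℝ

theorem contDiff_flip : ContDiff ℝ ∞ (flip (g := g)) := by
  have hc : ContDiff ℝ ∞ (fun z : ℂ => conj z) := Complex.conjCLE.contDiff
  refine ContDiff.prodMk (ContDiff.prodMk ?_ (ContDiff.prodMk ?_ ?_)) ?_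
  · exact contDiff_pi.2 fun k => hc.comp (by fun_prop)
  · exact contDiff_pi.2 fun i => contDiff_pi.2 fun k => hc.comp (by fun_prop)
  · exact contDiff_pi.2 fun j => (hc.comp (by fun_prop)).neg
  · exact contDiff_pi.2 fun i => contDiff_pi.2 fun k => (hc.comp (by fun_prop)).neg

theorem contDiff_velocity : ContDiff ℝ ∞ fun p : SpectralData g × Variation g => p.1.velocity p.2 := by
  unfold velocity
  refine ContDiff.prodMk (by fun_prop) (ContDiff.prodMk (by fun_prop) (contDiff_pi.2 fun j => ?_))
  exact ContDiff.mul (by fun_prop) (by fun_prop)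

/-- The vector field of the deformation: the velocity of the normalized infinitesimal deformation,
made compatible with the real structure also away from the real spectral data. -/
def field (S : SpectralData g) : SpectralData g :=
  S.velocity ((1 / 2 : ℂ) • (S.unitVar + flip S.unitVar))

theorem contDiffAt_field {S : SpectralData g} (h : Function.Bijective S.linearization) :
    ContDiffAt ℝ ∞ field S := by
  have h1 := contDiffAt_unitVar h
  have h2 : ContDiffAt ℝ ∞ (fun T : SpectralData g => flip T.unitVar) S :=
    contDiff_flip.contDiffAt.comp S h1
  have h3 : ContDiffAt ℝ ∞ (fun T : SpectralData g =>
      (T, (1 / 2 : ℂ) • (T.unitVar + flip T.unitVar))) S :=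
    contDiffAt_id.prodMk ((h1.add h2).const_smul _)
  exact ContDiffAt.comp S contDiff_velocity.contDiffAt h3

theorem IsReal.field_eq {S : SpectralData g} (hS : S.IsReal)
    (h : Function.Bijective S.linearization) : S.field = S.velocity S.unitVar := by
  rw [field, hS.flip_eq h (isUnitVariation_unitVar h), ← two_smul ℂ, smul_smul]
  norm_num

theorem revConj_eq_iff {n : ℕ} (c : Fin (n + 1) → ℂ) :
    revConj c = c ↔ conjRev n (coeffPoly c) = coeffPoly c := by
  rw [← coeffPoly_revConj]
  exact coeffPoly_injective.eq_iff.symm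

theorem isReal_iff (S : SpectralData g) : S.IsReal ↔
    revConj S.1 = S.1 ∧ (∀ i, revConj (S.2.1 i) = S.2.1 i) ∧ ∀ j, ‖S.2.2 j‖ = 1 := by
  constructor
  · rintro ⟨h1, h2, h3⟩
    exact ⟨(revConj_eq_iff _).2 h1, fun i => (revConj_eq_iff _).2 (h2 i), h3⟩
  · rintro ⟨h1, h2, h3⟩
    exact ⟨(revConj_eq_iff _).1 h1, fun i => (revConj_eq_iff _).1 (h2 i), h3⟩

theorem revConj_add {n : ℕ} (c d : Fin n → ℂ) : revConj (c + d) = revConj c + revConj d := by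
  funext k; simp [revConj]

theorem revConj_revConj {n : ℕ} (c : Fin n → ℂ) : revConj (revConj c) = c := by
  funext k; simp [revConj]

theorem hasDerivAt_revConj {n : ℕ} {c : ℝ → Fin n → ℂ} {c' : Fin n → ℂ} {t : ℝ}
    (h : HasDerivAt c c' t) : HasDerivAt (fun s => revConj (c s)) (revConj c') t := by
  rw [hasDerivAt_pi] at h ⊢
  intro k
  exact Complex.conjCLE.hasFDerivAt.comp_hasDerivAt t (h (Fin.rev k))

/-- Integral curves of the vector field stay in the real spectral data. -/
theorem isReal_of_hasDerivAt_field {D : ℝ → SpectralData g} {ε : ℝ}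
    (hD : ∀ t ∈ Set.Ioo (-ε) ε, HasDerivAt D (D t).field t) (h0 : (D 0).IsReal) :
    ∀ t ∈ Set.Ioo (-ε) ε, (D t).IsReal := by
  intro t ht
  have hε : (0 : ℝ) ∈ Set.Ioo (-ε) ε := ⟨by linarith [ht.1, ht.2], by linarith [ht.1, ht.2]⟩
  have key : ∀ {n : ℕ} (c c' : ℝ → Fin n → ℂ),
      (∀ s ∈ Set.Ioo (-ε) ε, HasDerivAt c (c' s) s) → (∀ s, revConj (c' s) = c' s) →
      revConj (c 0) = c 0 → revConj (c t) = c t := by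
    intro n c c' hc hc' h
    have hd : ∀ s ∈ Set.Ioo (-ε) ε, HasDerivAt (fun s => revConj (c s) - c s) 0 s := by
      intro s hs
      have := (hasDerivAt_revConj (hc s hs)).sub (hc s hs)
      rwa [hc', sub_self] at this
    have := isOpen_Ioo.is_const_of_deriv_eq_zero isPreconnected_Ioo
      (fun s hs => (hd s hs).differentiableAt.differentiableWithinAt)
      (fun s hs => (hd s hs).deriv) ht hε
    simp only [h, sub_self] at this
    exact sub_eq_zero.1 this
  have hsym : ∀ {n : ℕ} (c : Fin n → ℂ), revConj ((1 / 2 : ℂ) • (c + revConj c)) =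
      (1 / 2 : ℂ) • (c + revConj c) := by
    intro n c
    have : ∀ d : Fin n → ℂ, revConj ((1 / 2 : ℂ) • d) = (1 / 2 : ℂ) • revConj d := by
      intro d; funext k
      simp only [revConj, Pi.smul_apply, smul_eq_mul, map_mul, map_div₀, map_one, map_ofNat]
    rw [this, revConj_add, revConj_revConj, add_comm]
  obtain ⟨r1, r2, r3⟩ := (isReal_iff _).1 h0
  refine (isReal_iff _).2 ⟨?_, fun i => ?_, fun j => ?_⟩
  · exact key (fun s => (D s).1) _ (fun s hs => (hD s hs).fst) (fun s => hsym _) r1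
  · exact key (fun s => (D s).2.1 i) _ (fun s hs => hasDerivAt_pi.1 (hD s hs).snd.fst i)
      (fun s => hsym _) (r2 i)
  · have hd : ∀ s ∈ Set.Ioo (-ε) ε, HasDerivAt (fun s => (D s).2.2 j * conj ((D s).2.2 j)) 0 s := by
      intro s hs
      have h1 := hasDerivAt_pi.1 (hD s hs).snd.snd j
      have h2 : HasDerivAt (fun s => conj ((D s).2.2 j)) (conj ((D s).field.2.2 j)) s :=
        Complex.conjCLE.hasFDerivAt.comp_hasDerivAt s h1
      convert! h1.mul h2 using 1
      simp only [field, velocity, flip, Prod.smul_fst, Prod.smul_snd, Prod.snd_add, Prod.fst_add,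
        Pi.smul_apply, Pi.add_apply, smul_eq_mul, map_mul, map_add, map_neg, Complex.conj_conj,
        map_div₀, map_one, map_ofNat]
      ring
    have := isOpen_Ioo.is_const_of_deriv_eq_zero isPreconnected_Ioo
      (fun s hs => (hd s hs).differentiableAt.differentiableWithinAt)
      (fun s hs => (hd s hs).deriv) ht hε
    simp only [Complex.mul_conj, Complex.normSq_eq_norm_sq, r3 j] at this
    have h4 : ‖(D t).2.2 j‖ ^ 2 = 1 := by
      have h5 := Complex.ofReal_injective this
      simpa using h5
    exact (pow_eq_one_iff_of_nonneg (norm_nonneg _) two_ne_zero).1 h4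

/-- If the linearization is onto, then `a` has only simple roots: at a double root the values of the
two Whitham defects would be proportional to those of `b₁`, `b₂`. -/
theorem separable_of_surjective {S : SpectralData g} (h : Function.Surjective S.linearization) :
    S.a.Separable := by
  rw [separable_def, isCoprime_iff_aeval_ne_zero_of_isAlgClosed ℂ ℂ]
  intro z
  by_contra! hz
  simp only [coe_aeval_eq_eval] at hz
  have hW : ∀ v i, (S.whitham v i).eval z = -((S.b i).eval z * v.1.a.eval z) := by
    intro v i
    simp only [whitham, eval_add, eval_sub, eval_mul, hz.1, hz.2]
    ring
  have hex : ∀ i₀ : Fin 2, ∃ v, ∀ i, (S.whitham v i).eval z = if i = i₀ then 1 else 0 := by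
    intro i₀
    obtain ⟨v, hv⟩ := h (fun i k => (if i = i₀ then (1 : ℂ[X]) else 0).coeff k, 0, 0)
    refine ⟨v, fun i => ?_⟩
    have h1 : S.whitham v i = if i = i₀ then (1 : ℂ[X]) else 0 := by
      rw [← coeffPoly_coeff (S.whitham_natDegree_le v i),
        ← coeffPoly_coeff (n := 3 * g + 1) (p := if i = i₀ then (1 : ℂ[X]) else 0)
          (by split_ifs <;> simp)]
      exact congrArg coeffPoly (congrFun (congrArg Prod.fst hv) i)
    rw [h1]
    split_ifs <;> simp
  obtain ⟨v, hv⟩ := hex 0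
  obtain ⟨w, hw⟩ := hex 1
  have v0 := hv 0
  have v1 := hv 1
  have w1 := hw 1
  rw [hW] at v0 v1 w1
  simp only [one_ne_zero, if_true, if_false, neg_eq_zero, mul_eq_zero] at v0 v1 w1
  rcases v1 with v1 | v1
  · simp [v1] at w1
  · simp [v1] at v0

/-- If `a` and the `b_i` do not move, then the Whitham equation reads `2 λ a c' = (λ a)' c`. The
leading coefficients force `2 deg c = 2 g + 1` unless `c = 0`. -/
theorem c_eq_zero_of_velocity_eq_zero {S : SpectralData g} (hS : S.a.coeff (2 * g) ≠ 0)
    {v : Variation g} (hv : ∀ i, S.whitham v i = 0) (ha : v.1.a = 0) (hb : ∀ i, v.1.b i = 0)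
    (i : Fin 2) : v.c i = 0 := by
  by_contra hne
  have hw := hv i
  rw [whitham, ha, hb, mul_zero, mul_zero, mul_zero, sub_zero, zero_sub] at hw
  have h1 := congrArg (fun p => p.coeff (2 * g + (v.c i).natDegree)) hw
  have e1 := coeff_mul_add_eq_of_natDegree_le (df := 2 * g) (dg := (v.c i).natDegree)
    S.a_natDegree_le (natDegree_X_mul_derivative_le (p := v.c i) le_rfl)
  have e2 := coeff_mul_add_eq_of_natDegree_le (df := 2 * g) (dg := (v.c i).natDegree)
    (natDegree_add_le_of_degree_le S.a_natDegree_le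
      (natDegree_X_mul_derivative_le S.a_natDegree_le)) (le_refl (v.c i).natDegree)
  simp only [coeff_add, coeff_neg, coeff_C_mul, coeff_zero, e1, e2, coeff_X_mul_derivative] at h1
  have hl : (v.c i).coeff (v.c i).natDegree ≠ 0 := by
    rw [coeff_natDegree]; exact leadingCoeff_ne_zero.2 hne
  have h2 : (((2 * g : ℕ) : ℂ) + 1 - 2 * (v.c i).natDegree) *
      (S.a.coeff (2 * g) * (v.c i).coeff (v.c i).natDegree) = 0 := by
    linear_combination h1
  have h3 := (mul_eq_zero.1 h2).resolve_right (mul_ne_zero hS hl)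
  have h4 : ((2 * g + 1 : ℕ) : ℂ) = ((2 * (v.c i).natDegree : ℕ) : ℂ) := by
    push_cast at h3 ⊢; linear_combination h3
  have := Nat.cast_injective h4
  omega

theorem velocity_transform (r θ : ℝ) (S : SpectralData g) (v : Variation g) :
    (S.transform r θ).velocity (transformVar r θ v) = (S.velocity v).transform r θ := by
  refine Prod.ext rfl (Prod.ext rfl ?_)
  funext j
  simp only [velocity, transformVar, transform]
  ring

/-- The derivative of a family that is moved by the coordinate changes. -/
theorem hasDerivAt_transform {D : ℝ → SpectralData g} {D' : SpectralData g} {r θ : ℝ → ℝ}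
    {w y t : ℝ} (hD : HasDerivAt D D' t) (hr : HasDerivAt r (w * r t) t) (hθ : HasDerivAt θ y t) :
    HasDerivAt (fun s => (D s).transform (r s) (θ s))
      (D'.transform (r t) (θ t) + ((D t).transform (r t) (θ t)).velocity
        ((w : ℂ) • scaleVar ((D t).transform (r t) (θ t)) +
          (y : ℂ) • rotVar ((D t).transform (r t) (θ t)))) t := by
  have hr' : HasDerivAt (fun s => (r s : ℂ)) ((w * r t : ℝ) : ℂ) t := hr.ofReal_comp
  have hθ' : HasDerivAt (fun s => (θ s : ℂ)) (y : ℂ) t := hθ.ofReal_comp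
  have hE : ∀ z : ℂ, HasDerivAt (fun s => Complex.exp (z * (θ s) * Complex.I))
      (Complex.exp (z * (θ t) * Complex.I) * (z * y * Complex.I)) t := fun z =>
    ((hθ'.const_mul z).mul_const Complex.I).cexp
  refine HasDerivAt.prodMk ?_ (HasDerivAt.prodMk ?_ ?_)
  · rw [hasDerivAt_pi]
    intro k
    convert! ((hr'.pow 2).mul (hE ((g : ℂ) - (k : ℕ)))).mul (hasDerivAt_pi.1 hD.fst k) using 1
    simp only [transform, velocity, scaleVar, rotVar, Prod.fst_add, Prod.smul_fst, Pi.add_apply,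
      Pi.smul_apply, Pi.mul_apply, Pi.pow_apply, smul_eq_mul]
    push_cast
    ring
  · rw [hasDerivAt_pi]
    intro i
    rw [hasDerivAt_pi]
    intro k
    convert! (hr'.mul (hE (((g : ℂ) + 1) / 2 - (k : ℕ)))).mul
      (hasDerivAt_pi.1 (hasDerivAt_pi.1 hD.snd.fst i) k) using 1
    simp only [transform, velocity, scaleVar, rotVar, Prod.fst_add, Prod.smul_fst, Prod.snd_add,
      Prod.smul_snd, Pi.add_apply, Pi.smul_apply, Pi.mul_apply, smul_eq_mul]
    push_cast
    ring
  · rw [hasDerivAt_pi]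
    intro j
    have := (hE 1).mul (hasDerivAt_pi.1 hD.snd.snd j)
    simp only [one_mul] at this
    convert! this using 1
    simp only [transform, velocity, scaleVar, rotVar, Prod.fst_add, Prod.smul_fst, Prod.snd_add,
      Prod.smul_snd, Pi.add_apply, Pi.smul_apply, smul_eq_mul, Pi.zero_apply]
    ring

end SpectralData

end

section
open Polynomial

/-! ### Tools from analysis -/

open MeasureTheory Set Filter Topology

/-- Differentiation under the integral sign for a continuously differentiable integrand. -/
theorem hasDerivAt_intervalIntegral_of_continuousOn {𝕜 : Type*} [RCLike 𝕜] [NormedSpace 𝕜 ℂ]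
    {F F' : 𝕜 → ℝ → ℂ} {U : Set 𝕜} {x₀ : 𝕜} {a b : ℝ} (hU : U ∈ 𝓝 x₀)
    (hF : ∀ x ∈ U, ContinuousOn (F x) (uIcc a b))
    (hF' : ContinuousOn (Function.uncurry F') (U ×ˢ uIcc a b))
    (hd : ∀ x ∈ U, ∀ t ∈ uIcc a b, HasDerivAt (fun x => F x t) (F' x t) x) :
    HasDerivAt (fun x => ∫ t in a..b, F x t) (∫ t in a..b, F' x₀ t) x₀ := by
  obtain ⟨K, hK, hKU, hKc⟩ := local_compact_nhds hU
  obtain ⟨M, hM⟩ := (hKc.prod (isCompact_uIcc (a := a) (b := b))).exists_bound_of_continuousOn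
    (hF'.mono (prod_mono hKU le_rfl))
  have hx₀ : x₀ ∈ U := mem_of_mem_nhds hU
  refine (intervalIntegral.hasDerivAt_integral_of_dominated_loc_of_deriv_le (bound := fun _ => M)
    hK ?_ (hF x₀ hx₀).intervalIntegrable ?_ ?_ (by simp) ?_).2
  · filter_upwards [hU] with x hx
    exact ((hF x hx).mono uIoc_subset_uIcc).aestronglyMeasurable measurableSet_uIoc
  · have : ContinuousOn (F' x₀) (uIcc a b) :=
      hF'.comp (f := fun t => (x₀, t)) (by fun_prop) fun t ht => ⟨hx₀, ht⟩
    exact (this.mono uIoc_subset_uIcc).aestronglyMeasurable measurableSet_uIoc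
  · exact ae_of_all _ fun t ht x hx => hM (x, t) ⟨hx, uIoc_subset_uIcc ht⟩
  · exact ae_of_all _ fun t ht x hx => hd x (hKU hx) t (uIoc_subset_uIcc ht)

/-- A nowhere zero holomorphic function on a disc has a holomorphic square root. -/
theorem exists_sqrt_of_ne_zero {f : ℂ → ℂ} {c : ℂ} {r : ℝ}
    (hf : DifferentiableOn ℂ f (Metric.ball c r)) (h0 : ∀ z ∈ Metric.ball c r, f z ≠ 0) :
    ∃ ψ : ℂ → ℂ, DifferentiableOn ℂ ψ (Metric.ball c r) ∧
      ∀ z ∈ Metric.ball c r, ψ z ^ 2 = f z := by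
  rcases le_or_gt r 0 with hr | hr
  · exact ⟨f, hf, by simp [Metric.ball_eq_empty.2 hr]⟩
  have hc : c ∈ Metric.ball c r := Metric.mem_ball_self hr
  have hf' : DifferentiableOn ℂ (fun z => deriv f z / f z) (Metric.ball c r) :=
    (hf.deriv Metric.isOpen_ball).div hf h0
  obtain ⟨L, hL⟩ := hf'.isExactOn_ball
  have hconst : ∀ z ∈ Metric.ball c r, f z * Complex.exp (-L z) = f c * Complex.exp (-L c) := by
    intro z hz
    have hd : ∀ w ∈ Metric.ball c r, HasDerivAt (fun w => f w * Complex.exp (-L w)) 0 w := by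
      intro w hw
      have h1 := (hf.differentiableAt (Metric.isOpen_ball.mem_nhds hw)).hasDerivAt
      have h2 := h1.mul (hL w hw).neg.cexp
      convert! h2 using 1
      have := h0 w hw
      simp only [Pi.neg_apply]
      field_simp
      ring
    exact Metric.isOpen_ball.is_const_of_deriv_eq_zero (convex_ball c r).isPreconnected
      (fun w hw => (hd w hw).differentiableAt.differentiableWithinAt)
      (fun w hw => (hd w hw).deriv) hz hc
  obtain ⟨x, hx⟩ := IsAlgClosed.exists_pow_nat_eq (f c * Complex.exp (-L c)) two_pos
  refine ⟨fun z => x * Complex.exp (L z / 2), ?_, fun z hz => ?_⟩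
  · intro z hz
    have := (hL z hz).differentiableAt
    exact ((this.div_const 2).cexp.const_mul x).differentiableWithinAt
  · rw [mul_pow, hx, ← hconst z hz, ← Complex.exp_nat_mul, mul_assoc, ← Complex.exp_add]
    push_cast
    rw [mul_div_cancel₀ _ two_ne_zero]
    simp

/-- An entire function of polynomial growth is a polynomial. -/
theorem exists_polynomial_of_growth {f : ℂ → ℂ} (hf : Differentiable ℂ f) {n : ℕ} {M R : ℝ}
    (hM : ∀ z, R ≤ ‖z‖ → ‖f z‖ ≤ M * ‖z‖ ^ n) :
    ∃ p : ℂ[X], p.natDegree ≤ n ∧ ∀ z, f z = p.eval z := by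
  have hzero : ∀ k, n < k → iteratedDeriv k f 0 = 0 := by
    intro k hk
    have hb : ∀ᶠ r : ℝ in atTop, ‖iteratedDeriv k f 0‖ ≤ (k.factorial * M) * (r ^ (k - n))⁻¹ := by
      filter_upwards [eventually_gt_atTop 0, eventually_ge_atTop R] with r hr hrR
      refine (Complex.norm_iteratedDeriv_le_of_forall_mem_sphere_norm_le k hr
        hf.diffContOnCl (C := M * r ^ n) ?_).trans (le_of_eq ?_)
      · intro z hz
        have hz' : ‖z‖ = r := by simpa using hz
        rw [← hz']
        exact hM z (hz' ▸ hrR)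
      · have : r ^ k = r ^ n * r ^ (k - n) := by rw [← pow_add]; congr 1; omega
        rw [this]
        field_simp
    have hlim : Tendsto (fun r : ℝ => (k.factorial * M) * (r ^ (k - n))⁻¹) atTop (𝓝 0) := by
      have := (tendsto_pow_atTop (α := ℝ) (n := k - n) (by omega)).inv_tendsto_atTop
      simpa using this.const_mul (k.factorial * M)
    exact norm_le_zero_iff.1 (ge_of_tendsto hlim hb)
  refine ⟨∑ k ∈ Finset.range (n + 1), C ((k.factorial : ℂ)⁻¹ * iteratedDeriv k f 0) * X ^ k,
    ?_, fun z => ?_⟩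
  · refine natDegree_sum_le_of_forall_le _ _ fun k hk => ?_
    exact (natDegree_C_mul_X_pow_le _ _).trans (by simpa [Nat.lt_succ_iff] using hk)
  · rw [← Complex.taylorSeries_eq_of_entire' 0 z hf, tsum_eq_sum (s := Finset.range (n + 1))]
    · simp [eval_finsetSum]
    · intro k hk
      rw [hzero k (by simpa using hk)]
      simp

/-- The solution of a homogeneous linear differential equation along a segment. -/
theorem eq_mul_exp_integral {W : Set ℂ} (hW : IsOpen W) (hc : Convex ℝ W) {h f : ℂ → ℂ}
    (hh : ∀ w ∈ W, HasDerivAt h (h w * f w) w) (hf : ContinuousOn f W) {w₀ w₁ : ℂ}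
    (h₀ : w₀ ∈ W) (h₁ : w₁ ∈ W) :
    h w₁ = h w₀ * Complex.exp (∫ t in (0 : ℝ)..1, f (w₀ + t * (w₁ - w₀)) * (w₁ - w₀)) := by
  set γ : ℝ → ℂ := fun t => w₀ + t * (w₁ - w₀) with hγ
  have hγd : ∀ t, HasDerivAt γ (w₁ - w₀) t := by
    intro t
    have := ((Complex.ofRealCLM.hasDerivAt (x := t)).mul_const (w₁ - w₀)).const_add w₀
    simpa only [Complex.ofRealCLM_apply, Complex.ofReal_one, one_mul] using this
  have hγc : Continuous γ := by fun_prop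
  have hγW : ∀ t ∈ Icc (0 : ℝ) 1, γ t ∈ W := by
    intro t ht
    have := hc.add_smul_sub_mem h₀ h₁ ht
    simpa [hγ, Complex.real_smul] using this
  have hJ : IsOpen (γ ⁻¹' W) := hW.preimage hγc
  set φ : ℝ → ℂ := fun t => f (γ t) * (w₁ - w₀) with hφ
  have hφc : ContinuousOn φ (γ ⁻¹' W) :=
    (hf.comp hγc.continuousOn fun t ht => ht).mul continuousOn_const
  have hG : ∀ t ∈ Icc (0 : ℝ) 1, HasDerivAt (fun t => ∫ u in (0 : ℝ)..t, φ u) (φ t) t := by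
    intro t ht
    have hsub : uIcc 0 t ⊆ γ ⁻¹' W := by
      rw [uIcc_of_le ht.1]
      exact fun u hu => hγW u ⟨hu.1, hu.2.trans ht.2⟩
    refine intervalIntegral.integral_hasDerivAt_right (hφc.mono hsub).intervalIntegrable ?_ ?_
    · exact hφc.stronglyMeasurableAtFilter hJ t (hγW t ht)
    · exact hφc.continuousAt (hJ.mem_nhds (hγW t ht))
  have hconst : ∀ t ∈ Icc (0 : ℝ) 1,
      h (γ t) * Complex.exp (-∫ u in (0 : ℝ)..t, φ u) =
        h (γ 0) * Complex.exp (-∫ u in (0 : ℝ)..0, φ u) := by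
    have hd : ∀ t ∈ Icc (0 : ℝ) 1,
        HasDerivAt (fun t => h (γ t) * Complex.exp (-∫ u in (0 : ℝ)..t, φ u)) 0 t := by
      intro t ht
      have h1 : HasDerivAt (fun t => h (γ t)) (h (γ t) * f (γ t) * (w₁ - w₀)) t :=
        (hh _ (hγW t ht)).comp t (hγd t)
      convert! h1.mul (hG t ht).neg.cexp using 1
      simp only [hφ, Pi.neg_apply]
      ring
    exact constant_of_has_deriv_right_zero
      (fun t ht => (hd t ht).continuousAt.continuousWithinAt)
      (fun t ht => (hd t (Ico_subset_Icc_self ht)).hasDerivWithinAt)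
  have := hconst 1 (by simp)
  have e1 : γ 1 = w₁ := by simp [hγ]
  have e0 : γ 0 = w₀ := by simp [hγ]
  rw [e1, e0, intervalIntegral.integral_same, neg_zero, Complex.exp_zero, mul_one] at this
  rw [← this, mul_assoc, ← Complex.exp_add]
  simp [hφ, hγ]

/-- The integral along a segment of a function with a primitive. -/
theorem integral_segment_eq_sub {W : Set ℂ} (hc : Convex ℝ W) {P f : ℂ → ℂ}
    (hP : ∀ w ∈ W, HasDerivAt P (f w) w) (hf : ContinuousOn f W) {w₀ w₁ : ℂ}
    (h₀ : w₀ ∈ W) (h₁ : w₁ ∈ W) :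
    ∫ t in (0 : ℝ)..1, f (w₀ + t * (w₁ - w₀)) * (w₁ - w₀) = P w₁ - P w₀ := by
  have hγd : ∀ t : ℝ, HasDerivAt (fun t : ℝ => w₀ + t * (w₁ - w₀)) (w₁ - w₀) t := by
    intro t
    have := ((Complex.ofRealCLM.hasDerivAt (x := t)).mul_const (w₁ - w₀)).const_add w₀
    simpa using this
  have hγW : ∀ t ∈ Icc (0 : ℝ) 1, w₀ + t * (w₁ - w₀) ∈ W := by
    intro t ht
    have := hc.add_smul_sub_mem h₀ h₁ ht
    simpa [Complex.real_smul] using this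
  have := intervalIntegral.integral_eq_sub_of_hasDerivAt (a := 0) (b := 1)
    (f := fun t : ℝ => P (w₀ + t * (w₁ - w₀)))
    (f' := fun t : ℝ => f (w₀ + t * (w₁ - w₀)) * (w₁ - w₀)) (fun t ht => ?_) ?_
  · simpa using this
  · rw [uIcc_of_le zero_le_one] at ht
    exact (hP _ (hγW t ht)).comp t (hγd t)
  · refine ContinuousOn.intervalIntegrable ?_
    rw [uIcc_of_le zero_le_one]
    exact (hf.comp (by fun_prop) hγW).mul continuousOn_const

/-- The derivative of a moving primitive at a moving point. -/
theorem hasDerivAt_moving_primitive {P f : ℝ → ℂ → ℂ} {s₀ : ℝ} {z₀ : ℂ} {r : ℝ} (hr : 0 < r)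
    (hP : ∀ᶠ s in 𝓝 s₀, ∀ z ∈ Metric.ball z₀ r, HasDerivAt (P s) (f s z) z)
    (h0 : ∀ᶠ s in 𝓝 s₀, P s z₀ = 0) (hf : ContinuousAt (Function.uncurry f) (s₀, z₀))
    {l : ℝ → ℂ} {l' : ℂ} (hl : HasDerivAt l l' s₀) (hl0 : l s₀ = z₀) :
    HasDerivAt (fun s => P s (l s)) (f s₀ z₀ * l') s₀ := by
  have hmain : (fun s => P s (l s) - f s₀ z₀ * (l s - z₀)) =o[𝓝 s₀] fun s => s - s₀ := by
    have hO : (fun s => l s - z₀) =O[𝓝 s₀] fun s => s - s₀ := by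
      have := hl.isBigO_sub
      rwa [hl0] at this
    refine Asymptotics.IsLittleO.trans_isBigO ?_ hO
    rw [Asymptotics.isLittleO_iff]
    intro ε hε
    have h1 := Metric.continuousAt_iff'.1 hf ε hε
    rw [nhds_prod_eq, eventually_prod_iff] at h1
    obtain ⟨p, hp, q, hq, hpq⟩ := h1
    obtain ⟨ρ, hρ, hρq⟩ := Metric.eventually_nhds_iff_ball.1 hq
    have hlm : ∀ᶠ s in 𝓝 s₀, l s ∈ Metric.ball z₀ (min r ρ) := by
      refine hl.continuousAt.eventually_mem ?_
      rw [hl0]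
      exact Metric.ball_mem_nhds _ (lt_min hr hρ)
    filter_upwards [hP, h0, hp, hlm] with s hPs h0s hps hls
    have hz0 : z₀ ∈ Metric.ball z₀ (min r ρ) := Metric.mem_ball_self (lt_min hr hρ)
    have := (convex_ball z₀ (min r ρ)).norm_image_sub_le_of_norm_hasDerivWithin_le
      (f := fun z => P s z - f s₀ z₀ * z) (f' := fun z => f s z - f s₀ z₀ * 1) (C := ε)
      (fun z hz => ((hPs z (Metric.ball_subset_ball (min_le_left _ _) hz)).sub
        ((hasDerivAt_id z).const_mul _)).hasDerivWithinAt)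
      (fun z hz => by
        have := hpq hps (hρq z (Metric.ball_subset_ball (min_le_right _ _) hz))
        rw [dist_eq_norm] at this
        simpa using this.le) hz0 hls
    simp only [h0s] at this
    rwa [show P s (l s) - f s₀ z₀ * l s - (0 - f s₀ z₀ * z₀) =
      P s (l s) - f s₀ z₀ * (l s - z₀) by ring] at this
  have hl2 : HasDerivAt (fun s => f s₀ z₀ * (l s - z₀)) (f s₀ z₀ * l') s₀ :=
    (hl.sub_const z₀).const_mul _
  have h3 : HasDerivAt (fun s => P s (l s) - f s₀ z₀ * (l s - z₀)) 0 s₀ := by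
    rw [hasDerivAt_iff_isLittleO]
    have e : P s₀ (l s₀) - f s₀ z₀ * (l s₀ - z₀) = 0 := by
      rw [hl0, h0.self_of_nhds]; ring
    simpa [e] using hmain
  convert! h3.add hl2 using 1
  · funext s; simp
  · simp

/-- The derivative of a moving solution of a homogeneous linear differential equation at a moving
point. -/
theorem hasDerivAt_moving {h f : ℝ → ℂ → ℂ} {s₀ : ℝ} {z₀ : ℂ} {r : ℝ} (hr : 0 < r)
    (hh : ∀ᶠ s in 𝓝 s₀, ∀ z ∈ Metric.ball z₀ r, HasDerivAt (h s) (h s z * f s z) z)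
    (hfd : ∀ᶠ s in 𝓝 s₀, DifferentiableOn ℂ (f s) (Metric.ball z₀ r))
    (hf : ContinuousAt (Function.uncurry f) (s₀, z₀)) {m : ℂ}
    (hm : HasDerivAt (fun s => h s z₀) m s₀)
    {l : ℝ → ℂ} {l' : ℂ} (hl : HasDerivAt l l' s₀) (hl0 : l s₀ = z₀) :
    HasDerivAt (fun s => h s (l s)) (m + h s₀ z₀ * (f s₀ z₀ * l')) s₀ := by
  have hz0 : z₀ ∈ Metric.ball z₀ r := Metric.mem_ball_self hr
  have hex : ∀ s, ∃ P : ℂ → ℂ, DifferentiableOn ℂ (f s) (Metric.ball z₀ r) →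
      P z₀ = 0 ∧ ∀ z ∈ Metric.ball z₀ r, HasDerivAt P (f s z) z := by
    intro s
    by_cases hs : DifferentiableOn ℂ (f s) (Metric.ball z₀ r)
    · obtain ⟨P, hP⟩ := hs.isExactOn_ball
      exact ⟨fun z => P z - P z₀, fun _ => ⟨sub_self _, fun z hz => (hP z hz).sub_const _⟩⟩
    · exact ⟨0, fun h => absurd h hs⟩
  choose P hP using hex
  have hPl := hasDerivAt_moving_primitive (P := P) hr
    (hfd.mono fun s hs => (hP s hs).2) (hfd.mono fun s hs => (hP s hs).1) hf hl hl0
  have hlm : ∀ᶠ s in 𝓝 s₀, l s ∈ Metric.ball z₀ r := by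
    refine hl.continuousAt.eventually_mem ?_
    rw [hl0]
    exact Metric.ball_mem_nhds _ hr
  have heq : ∀ᶠ s in 𝓝 s₀, h s (l s) = h s z₀ * Complex.exp (P s (l s)) := by
    filter_upwards [hh, hfd, hlm] with s h1 h2 h3
    obtain ⟨hP0, hPd⟩ := hP s h2
    have hd : ∀ z ∈ Metric.ball z₀ r, HasDerivAt (fun z => h s z * Complex.exp (-P s z)) 0 z := by
      intro z hz
      convert! (h1 z hz).mul (hPd z hz).neg.cexp using 1
      simp only [Pi.neg_apply]
      ring
    have := Metric.isOpen_ball.is_const_of_deriv_eq_zero (convex_ball z₀ r).isPreconnected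
      (fun w hw => (hd w hw).differentiableAt.differentiableWithinAt)
      (fun w hw => (hd w hw).deriv) h3 hz0
    simp only [hP0, neg_zero, Complex.exp_zero, mul_one] at this
    rw [← this, mul_assoc, ← Complex.exp_add]
    simp
  refine HasDerivAt.congr_of_eventuallyEq ?_ heq
  convert! hm.mul hPl.cexp using 1
  simp only [hl0, (hP s₀ hfd.self_of_nhds).1]
  simp

end

section
open Polynomial Set Filter Topology
namespace SpectralData

variable {g : ℕ}

/-! ### Functions with a given logarithmic differential along curves and in families -/

theorem coeffPoly_eval {n : ℕ} (c : Fin n → ℂ) (z : ℂ) :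
    (coeffPoly c).eval z = ∑ k : Fin n, c k * z ^ (k : ℕ) := by
  simp [coeffPoly, eval_finsetSum]

theorem continuous_eval_a : Continuous fun p : SpectralData g × ℂ => p.1.a.eval p.2 := by
  simp only [a, coeffPoly_eval]
  fun_prop

theorem continuous_eval_b (i : Fin 2) :
    Continuous fun p : SpectralData g × ℂ => (p.1.b i).eval p.2 := by
  simp only [b, coeffPoly_eval]
  fun_prop

theorem hasDerivAt_eval_a {E : ℝ → SpectralData g} {E' : SpectralData g} {s : ℝ}
    (h : HasDerivAt E E' s) (z : ℂ) :
    HasDerivAt (fun s => (E s).a.eval z) (E'.a.eval z) s := by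
  simp only [a, coeffPoly_eval]
  exact HasDerivAt.fun_sum fun k _ => (hasDerivAt_pi.1 h.fst k).mul_const _

theorem hasDerivAt_eval_b {E : ℝ → SpectralData g} {E' : SpectralData g} {s : ℝ}
    (h : HasDerivAt E E' s) (i : Fin 2) (z : ℂ) :
    HasDerivAt (fun s => ((E s).b i).eval z) ((E'.b i).eval z) s := by
  simp only [b, coeffPoly_eval]
  exact HasDerivAt.fun_sum fun k _ =>
    (hasDerivAt_pi.1 (hasDerivAt_pi.1 h.snd.fst i) k).mul_const _

/-- The points of the `λ`-plane over which the curve is unbranched. -/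
def regularSet (S : SpectralData g) : Set ℂ := {z | z ≠ 0 ∧ S.a.eval z ≠ 0}

theorem isOpen_regularSet (S : SpectralData g) : IsOpen S.regularSet :=
  isOpen_ne.inter (isOpen_ne.preimage S.a.continuous)

/-- The principal branch of the square root of the quotient of the polynomials `a`. It transports
the values of `ν` from the curve of `S` to the curve of `T`. -/
def sqrtRatio (S T : SpectralData g) (z : ℂ) : ℂ :=
  Complex.exp (Complex.log (T.a.eval z / S.a.eval z) / 2)

theorem sqrtRatio_ne_zero (S T : SpectralData g) (z : ℂ) : sqrtRatio S T z ≠ 0 :=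
  Complex.exp_ne_zero _

theorem sqrtRatio_sq {S T : SpectralData g} {z : ℂ} (h : T.a.eval z / S.a.eval z ∈ Complex.slitPlane) :
    sqrtRatio S T z ^ 2 = T.a.eval z / S.a.eval z := by
  rw [sqrtRatio, ← Complex.exp_nat_mul, Nat.cast_ofNat, mul_div_cancel₀ _ two_ne_zero,
    Complex.exp_log (Complex.slitPlane_ne_zero h)]

theorem sqrtRatio_self {S : SpectralData g} {z : ℂ} (h : S.a.eval z ≠ 0) : sqrtRatio S S z = 1 := by
  simp [sqrtRatio, div_self h]

theorem ne_zero_of_mem_slitPlane {S T : SpectralData g} {z : ℂ}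
    (h : T.a.eval z / S.a.eval z ∈ Complex.slitPlane) : T.a.eval z ≠ 0 ∧ S.a.eval z ≠ 0 := by
  have := Complex.slitPlane_ne_zero h
  exact ⟨fun h0 => this (by simp [h0]), fun h0 => this (by simp [h0])⟩

theorem mem_curve_transport {S T : SpectralData g} {z n : ℂ}
    (h : T.a.eval z / S.a.eval z ∈ Complex.slitPlane) (hp : (z, n) ∈ S.curve) :
    (z, n * sqrtRatio S T z) ∈ T.curve := by
  obtain ⟨hz, hn⟩ := hp
  have h0 := (ne_zero_of_mem_slitPlane h).2
  refine ⟨hz, ?_⟩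
  simp only at hn ⊢
  rw [mul_pow, sqrtRatio_sq h, hn]
  field_simp

theorem differentiableAt_sqrtRatio {S T : SpectralData g} {z : ℂ}
    (h : T.a.eval z / S.a.eval z ∈ Complex.slitPlane) : DifferentiableAt ℂ (sqrtRatio S T) z := by
  have h0 := (ne_zero_of_mem_slitPlane h).2
  exact ((((T.a.differentiable z).div (S.a.differentiable z) h0).clog h).div_const 2).cexp

theorem hasDerivAt_sqrtRatio {S : SpectralData g} {E : ℝ → SpectralData g} {E' : SpectralData g}
    {s : ℝ} {z : ℂ} (hE : HasDerivAt E E' s)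
    (h : (E s).a.eval z / S.a.eval z ∈ Complex.slitPlane) :
    HasDerivAt (fun s => sqrtRatio S (E s) z)
      (sqrtRatio S (E s) z * (E'.a.eval z / (2 * (E s).a.eval z))) s := by
  obtain ⟨h0, h1⟩ := ne_zero_of_mem_slitPlane h
  have hd := ((((hasDerivAt_eval_a hE z).div_const (S.a.eval z)).clog_real h).div_const 2).cexp
  convert! hd using 1
  rw [sqrtRatio]
  field_simp

theorem hasDerivAt_b_div_sqrtRatio {S : SpectralData g} {E : ℝ → SpectralData g}
    {E' : SpectralData g} {s : ℝ} {z : ℂ} (i : Fin 2) (hE : HasDerivAt E E' s)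
    (h : (E s).a.eval z / S.a.eval z ∈ Complex.slitPlane) :
    HasDerivAt (fun s => ((E s).b i).eval z / sqrtRatio S (E s) z)
      (((E'.b i).eval z - ((E s).b i).eval z * E'.a.eval z / (2 * (E s).a.eval z)) /
        sqrtRatio S (E s) z) s := by
  have h2 := (hasDerivAt_eval_b hE i z).div (hasDerivAt_sqrtRatio hE h) (sqrtRatio_ne_zero S _ z)
  have h3 := sqrtRatio_ne_zero S (E s) z
  have h4 := (ne_zero_of_mem_slitPlane h).1
  convert! h2 using 1
  field_simp

theorem continuousAt_sqrtRatio {S T : SpectralData g} {z : ℂ}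
    (h : T.a.eval z / S.a.eval z ∈ Complex.slitPlane) :
    ContinuousAt (fun p : SpectralData g × ℂ => sqrtRatio S p.1 p.2) (T, z) := by
  have h0 := (ne_zero_of_mem_slitPlane h).2
  have h1 : ContinuousAt (fun p : SpectralData g × ℂ => p.1.a.eval p.2 / S.a.eval p.2) (T, z) :=
    continuous_eval_a.continuousAt.div (S.a.continuous.comp continuous_snd).continuousAt h0
  have h2 := ContinuousAt.comp (f := fun p : SpectralData g × ℂ => p.1.a.eval p.2 / S.a.eval p.2)
    (g := Complex.log) (x := (T, z)) (Complex.differentiableAt_log h).continuousAt h1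
  exact Complex.continuous_exp.continuousAt.comp (h2.div_const 2)

/-- The condition `HasLogDifferential` at a single point of the curve. -/
def HasLogDifferentialAt (S : SpectralData g) (i : Fin 2) (μ : ℂ × ℂ → ℂ) (p : ℂ × ℂ) : Prop :=
  μ p ≠ 0 ∧ ∃ F : ℂ × ℂ → ℂ, AnalyticAt ℂ F p ∧ (∀ᶠ q in 𝓝[S.curve] p, μ q = F q) ∧
    fderiv ℂ F p (S.tangent p) / μ p = S.logForm i p

/-- The derivative of a function with given logarithmic differential along a holomorphic curve. -/
theorem HasLogDifferentialAt.hasDerivAt_comp {S : SpectralData g} {i : Fin 2} {m : ℂ × ℂ → ℂ}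
    {γ : ℂ → ℂ × ℂ} {k w : ℂ} (h : S.HasLogDifferentialAt i m (γ w))
    (hγ : HasDerivAt γ (k • S.tangent (γ w)) w) (hc : ∀ᶠ u in 𝓝 w, γ u ∈ S.curve) :
    HasDerivAt (fun u => m (γ u)) (m (γ w) * (k * S.logForm i (γ w))) w := by
  obtain ⟨h0, F, hF, hFm, hFd⟩ := h
  have h1 : ∀ᶠ u in 𝓝 w, m (γ u) = F (γ u) := by
    have ht : Tendsto γ (𝓝 w) (𝓝[S.curve] (γ w)) :=
      tendsto_nhdsWithin_iff.2 ⟨hγ.continuousAt, hc⟩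
    exact ht.eventually hFm
  refine HasDerivAt.congr_of_eventuallyEq ?_ h1
  have h2 := hF.differentiableAt.hasFDerivAt.comp_hasDerivAt w hγ
  convert! h2 using 1
  rw [map_smul, smul_eq_mul, ← hFd]
  field_simp

/-- The velocity of a holomorphic curve on `Σ` is a multiple of the standard tangent vector. The factor
is found from the `λ`-component. -/
theorem hasDerivAt_tangent {S : SpectralData g} {l n : ℂ → ℂ} {l' n' w : ℂ}
    (hl : HasDerivAt l l' w) (hn : HasDerivAt n n' w)
    (hc : ∀ᶠ u in 𝓝 w, (l u, n u) ∈ S.curve) (h0 : n w ≠ 0) :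
    HasDerivAt (fun u => (l u, n u)) ((l' / (2 * n w)) • S.tangent (l w, n w)) w := by
  have h1 : HasDerivAt (fun u => n u ^ 2) (2 * n w * n') w := by
    simpa using hn.fun_pow 2
  have h2 : HasDerivAt (fun u => l u * S.a.eval (l u))
      ((X * S.a).derivative.eval (l w) * l') w := by
    have := ((X * S.a).hasDerivAt (l w)).comp w hl
    simpa [Function.comp_def] using this
  have h3 := (h1.congr_of_eventuallyEq (hc.mono fun u hu => hu.2.symm)).unique h2
  convert! hl.prodMk hn using 1
  refine Prod.ext ?_ ?_
  · simp only [tangent, Prod.smul_fst, smul_eq_mul]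
    field_simp
  · simp only [tangent, Prod.smul_snd, smul_eq_mul]
    field_simp
    linear_combination -h3

/-- In a holomorphic parametrization `(l, n)` of the curve away from the branch points, the
logarithmic derivative of `μ_i` is `π b_i(l) l' / (n l)`. -/
theorem HasLogDifferentialAt.hasDerivAt_param {S : SpectralData g} {i : Fin 2} {m : ℂ × ℂ → ℂ}
    {l n : ℂ → ℂ} {l' n' w : ℂ} (h : S.HasLogDifferentialAt i m (l w, n w))
    (hl : HasDerivAt l l' w) (hn : HasDerivAt n n' w)
    (hc : ∀ᶠ u in 𝓝 w, (l u, n u) ∈ S.curve) (h0 : n w ≠ 0) :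
    HasDerivAt (fun u => m (l u, n u))
      (m (l w, n w) * (Real.pi * (S.b i).eval (l w) / (n w * l w) * l')) w := by
  have h1 := HasLogDifferentialAt.hasDerivAt_comp (γ := fun u => (l u, n u)) h
    (hasDerivAt_tangent hl hn hc h0) hc
  refine h1.congr_deriv ?_
  have := hc.self_of_nhds.1
  simp only [logForm] at this ⊢
  field_simp

theorem HasLogDifferential.hasDerivAt_param {S : SpectralData g} {i : Fin 2} {m : ℂ × ℂ → ℂ}
    (h : S.HasLogDifferential i m) {l n : ℂ → ℂ} {l' n' w : ℂ}
    (hl : HasDerivAt l l' w) (hn : HasDerivAt n n' w)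
    (hc : ∀ᶠ u in 𝓝 w, (l u, n u) ∈ S.curve) (h0 : n w ≠ 0) :
    HasDerivAt (fun u => m (l u, n u))
      (m (l w, n w) * (Real.pi * (S.b i).eval (l w) / (n w * l w) * l')) w :=
  HasLogDifferentialAt.hasDerivAt_param (h _ hc.self_of_nhds) hl hn hc h0

/-- The quotient of the functions `μ` belonging to two members of a family, where the value of `ν`
is transported along the family. -/
def kappa (E : ℝ → SpectralData g) (m : ℝ → ℂ × ℂ → ℂ) (s₀ s : ℝ) (p : ℂ × ℂ) : ℂ :=
  m s (p.1, p.2 * sqrtRatio (E s₀) (E s) p.1) / m s₀ p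

/-- The velocity of the form `π b_i dλ / (ν λ)` in a parametrization `(l, n)` of the curve of `S`,
where `T` is the velocity of the spectral data. -/
def formVelocity (S T : SpectralData g) (i : Fin 2) (l n l' : ℂ) : ℂ :=
  Real.pi * ((T.b i).eval l - (S.b i).eval l * T.a.eval l / (2 * S.a.eval l)) / (n * l) * l'

/-- A holomorphic parametrization of a part of the curve without branch points. -/
structure IsParam (S : SpectralData g) (W : Set ℂ) (l n l' : ℂ → ℂ) : Prop where
  isOpen : IsOpen W
  convex : Convex ℝ W
  l_deriv : ∀ w ∈ W, HasDerivAt l (l' w) w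
  n_diff : DifferentiableOn ℂ n W
  regular : ∀ w ∈ W, l w ∈ S.regularSet
  curve : ∀ w ∈ W, n w ^ 2 = l w * S.a.eval (l w)

theorem IsParam.n_ne_zero {S : SpectralData g} {W : Set ℂ} {l n l' : ℂ → ℂ}
    (h : S.IsParam W l n l') {w : ℂ} (hw : w ∈ W) : n w ≠ 0 := by
  intro h0
  have := h.curve w hw
  rw [h0, zero_pow two_ne_zero] at this
  exact mul_ne_zero (h.regular w hw).1 (h.regular w hw).2 this.symm

theorem IsParam.l_cont {S : SpectralData g} {W : Set ℂ} {l n l' : ℂ → ℂ}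
    (h : S.IsParam W l n l') : ContinuousOn l W :=
  fun w hw => (h.l_deriv w hw).continuousAt.continuousWithinAt

theorem IsParam.l'_diff {S : SpectralData g} {W : Set ℂ} {l n l' : ℂ → ℂ}
    (h : S.IsParam W l n l') : DifferentiableOn ℂ l' W := by
  have : DifferentiableOn ℂ l W := fun w hw =>
    (h.l_deriv w hw).differentiableAt.differentiableWithinAt
  exact (this.deriv h.isOpen).congr fun w hw => ((h.l_deriv w hw).deriv).symm

theorem IsParam.formVelocity_diff {S T : SpectralData g} {W : Set ℂ} {l n l' : ℂ → ℂ}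
    (h : S.IsParam W l n l') (i : Fin 2) :
    DifferentiableOn ℂ (fun w => formVelocity S T i (l w) (n w) (l' w)) W := by
  have hl : DifferentiableOn ℂ l W := fun w hw =>
    (h.l_deriv w hw).differentiableAt.differentiableWithinAt
  have hp : ∀ p : ℂ[X], DifferentiableOn ℂ (fun w => p.eval (l w)) W := fun p =>
    p.differentiable.comp_differentiableOn hl
  unfold formVelocity
  refine (((((hp _).sub (((hp _).mul (hp _)).div ((hp _).const_mul 2) fun w hw => ?_)).const_mul
    _).div (h.n_diff.mul hl) fun w hw => ?_).mul h.l'_diff)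
  · exact mul_ne_zero two_ne_zero (h.regular w hw).2
  · exact mul_ne_zero (h.n_ne_zero hw) (h.regular w hw).1

/-- Over a compact set without branch points, the values of `ν` on nearby curves are continued by the
principal branch of the square root. -/
theorem eventually_mem_slitPlane {E : ℝ → SpectralData g} {s₀ : ℝ} (hE : ContinuousAt E s₀)
    {K : Set ℂ} (hK : IsCompact K) (hKU : K ⊆ (E s₀).regularSet) :
    ∀ᶠ s in 𝓝 s₀, ∀ z ∈ K, (E s).a.eval z / (E s₀).a.eval z ∈ Complex.slitPlane := by
  refine hK.eventually_forall_of_forall_eventually fun z hz => ?_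
  have h0 := (hKU hz).2
  have h1 : ContinuousAt (fun p : ℝ × ℂ => (E p.1).a.eval p.2 / (E s₀).a.eval p.2) (s₀, z) := by
    refine ContinuousAt.div ?_ ((E s₀).a.continuous.comp continuous_snd).continuousAt h0
    have : ContinuousAt (fun p : ℝ × ℂ => (E p.1, p.2)) (s₀, z) :=
      (ContinuousAt.comp (f := Prod.fst) (x := (s₀, z)) hE continuous_fst.continuousAt).prodMk
        continuous_snd.continuousAt
    exact ContinuousAt.comp (f := fun p : ℝ × ℂ => (E p.1, p.2)) (x := (s₀, z))
      (g := fun p : SpectralData g × ℂ => p.1.a.eval p.2) continuous_eval_a.continuousAt this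
  refine h1.eventually (Complex.isOpen_slitPlane.mem_nhds ?_)
  simp only [div_self h0]
  exact Complex.one_mem_slitPlane

/-- The quotients `kappa` change along a path with the integral of the velocity of the form
`π b_i dλ / (ν λ)`. -/
theorem hasDerivAt_kappa_div {E E' : ℝ → SpectralData g} {s₀ : ℝ} {i : Fin 2}
    {m : ℝ → ℂ × ℂ → ℂ} (hE : ∀ᶠ s in 𝓝 s₀, HasDerivAt E (E' s) s)
    (hE' : ∀ᶠ s in 𝓝 s₀, ContinuousAt E' s)
    (hm : ∀ᶠ s in 𝓝 s₀, (E s).HasLogDifferential i (m s))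
    {W : Set ℂ} {l n l' : ℂ → ℂ} (h : (E s₀).IsParam W l n l') {w₀ w₁ : ℂ} (h₀ : w₀ ∈ W)
    (h₁ : w₁ ∈ W) :
    HasDerivAt (fun s => kappa E m s₀ s (l w₁, n w₁) / kappa E m s₀ s (l w₀, n w₀))
      (∫ t in (0 : ℝ)..1, formVelocity (E s₀) (E' s₀) i (l (w₀ + t * (w₁ - w₀)))
        (n (w₀ + t * (w₁ - w₀))) (l' (w₀ + t * (w₁ - w₀))) * (w₁ - w₀)) s₀ := by
  -- a convex neighbourhood of the segment with compact closure in `W`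
  have hseg : segment ℝ w₀ w₁ ⊆ W := h.convex.segment_subset h₀ h₁
  have hsegc : IsCompact (segment ℝ w₀ w₁) := by
    rw [segment_eq_image_lineMap]
    exact isCompact_Icc.image (AffineMap.lineMap_continuous)
  obtain ⟨δ, hδ, hδW⟩ := hsegc.exists_cthickening_subset_open h.isOpen hseg
  set W' := Metric.thickening δ (segment ℝ w₀ w₁) with hW'
  have hW'o : IsOpen W' := Metric.isOpen_thickening
  have hW'c : Convex ℝ W' := (convex_segment w₀ w₁).thickening δ
  have hW'W : W' ⊆ W := (Metric.thickening_subset_cthickening _ _).trans hδW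
  have h₀' : w₀ ∈ W' := Metric.self_subset_thickening hδ _ (left_mem_segment ℝ w₀ w₁)
  have h₁' : w₁ ∈ W' := Metric.self_subset_thickening hδ _ (right_mem_segment ℝ w₀ w₁)
  have hK : IsCompact (l '' Metric.cthickening δ (segment ℝ w₀ w₁)) :=
    hsegc.cthickening.image_of_continuousOn (h.l_cont.mono hδW)
  have hslit := eventually_mem_slitPlane hE.self_of_nhds.continuousAt hK (by
    rintro _ ⟨w, hw, rfl⟩
    exact h.regular w (hδW hw))
  have hslit' : ∀ᶠ s in 𝓝 s₀, ∀ w ∈ W',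
      (E s).a.eval (l w) / (E s₀).a.eval (l w) ∈ Complex.slitPlane :=
    hslit.mono fun s hs w hw => hs _ ⟨w, Metric.thickening_subset_cthickening _ _ hw, rfl⟩
  set f : ℝ → ℂ → ℂ := fun s w => Real.pi * (((E s).b i).eval (l w) /
    sqrtRatio (E s₀) (E s) (l w)) / (n w * l w) * l' w with hf
  set f' : ℝ → ℂ → ℂ := fun s w => Real.pi * ((((E' s).b i).eval (l w) -
    ((E s).b i).eval (l w) * (E' s).a.eval (l w) / (2 * (E s).a.eval (l w))) /
      sqrtRatio (E s₀) (E s) (l w)) / (n w * l w) * l' w with hf'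
  obtain ⟨U, hU, hUo, hsU⟩ := eventually_nhds_iff.1 (hE.and (hE'.and (hm.and hslit')))
  have hγW : ∀ t ∈ uIcc (0 : ℝ) 1, w₀ + t * (w₁ - w₀) ∈ W' := by
    intro t ht
    rw [uIcc_of_le zero_le_one] at ht
    have := hW'c.add_smul_sub_mem h₀' h₁' ht
    simpa [Complex.real_smul] using this
  have hγc : Continuous fun t : ℝ => w₀ + t * (w₁ - w₀) := by fun_prop
  have hfc : ∀ s ∈ U, ContinuousOn (f s) W' := by
    intro s hs w hw
    have hlw := (h.l_deriv w (hW'W hw)).continuousAt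
    have hnw := (h.n_diff.differentiableAt (h.isOpen.mem_nhds (hW'W hw))).continuousAt
    have hl'w := (h.l'_diff.differentiableAt (h.isOpen.mem_nhds (hW'W hw))).continuousAt
    have hr := (differentiableAt_sqrtRatio ((hU s hs).2.2.2 w hw)).continuousAt.comp hlw
    have hb := (((E s).b i).continuous.continuousAt (x := l w)).comp hlw
    exact (((continuousAt_const.mul (hb.div hr (sqrtRatio_ne_zero _ _ _))).div (hnw.mul hlw)
      (mul_ne_zero (h.n_ne_zero (hW'W hw)) (h.regular w (hW'W hw)).1)).mul
      hl'w).continuousWithinAt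
  have hfc' : ContinuousOn (Function.uncurry f') (U ×ˢ W') := by
    rintro ⟨s, w⟩ ⟨hs, hw⟩
    have hlw : ContinuousAt (fun p : ℝ × ℂ => l p.2) (s, w) :=
      ContinuousAt.comp (f := Prod.snd) (x := (s, w))
        (h.l_deriv w (hW'W hw)).continuousAt continuousAt_snd
    have hnw : ContinuousAt (fun p : ℝ × ℂ => n p.2) (s, w) :=
      ContinuousAt.comp (f := Prod.snd) (x := (s, w))
        (h.n_diff.differentiableAt (h.isOpen.mem_nhds (hW'W hw))).continuousAt continuousAt_snd
    have hl'w : ContinuousAt (fun p : ℝ × ℂ => l' p.2) (s, w) :=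
      ContinuousAt.comp (f := Prod.snd) (x := (s, w))
        (h.l'_diff.differentiableAt (h.isOpen.mem_nhds (hW'W hw))).continuousAt continuousAt_snd
    have hEl : ContinuousAt (fun p : ℝ × ℂ => (E p.1, l p.2)) (s, w) :=
      (ContinuousAt.comp (f := Prod.fst) (x := (s, w)) (hU s hs).1.continuousAt
        continuousAt_fst).prodMk hlw
    have hEl' : ContinuousAt (fun p : ℝ × ℂ => (E' p.1, l p.2)) (s, w) :=
      (ContinuousAt.comp (f := Prod.fst) (x := (s, w)) (hU s hs).2.1
        continuousAt_fst).prodMk hlw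
    have ha : ContinuousAt (fun p : ℝ × ℂ => (E p.1).a.eval (l p.2)) (s, w) :=
      continuous_eval_a.continuousAt.comp hEl
    have hb : ContinuousAt (fun p : ℝ × ℂ => ((E p.1).b i).eval (l p.2)) (s, w) :=
      (continuous_eval_b i).continuousAt.comp hEl
    have ha' : ContinuousAt (fun p : ℝ × ℂ => (E' p.1).a.eval (l p.2)) (s, w) :=
      continuous_eval_a.continuousAt.comp hEl'
    have hb' : ContinuousAt (fun p : ℝ × ℂ => ((E' p.1).b i).eval (l p.2)) (s, w) :=
      (continuous_eval_b i).continuousAt.comp hEl'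
    have hr : ContinuousAt (fun p : ℝ × ℂ => sqrtRatio (E s₀) (E p.1) (l p.2)) (s, w) :=
      ContinuousAt.comp (f := fun p : ℝ × ℂ => (E p.1, l p.2)) (x := (s, w))
        (g := fun p : SpectralData g × ℂ => sqrtRatio (E s₀) p.1 p.2)
        (continuousAt_sqrtRatio ((hU s hs).2.2.2 w hw)) hEl
    have hane := (ne_zero_of_mem_slitPlane ((hU s hs).2.2.2 w hw)).1
    exact (((continuousAt_const.mul ((hb'.sub ((hb.mul ha').div (continuousAt_const.mul ha)
      (mul_ne_zero two_ne_zero hane))).div hr (sqrtRatio_ne_zero _ _ _))).div (hnw.mul hlw)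
      (mul_ne_zero (h.n_ne_zero (hW'W hw)) (h.regular w (hW'W hw)).1)).mul
      hl'w).continuousWithinAt
  have hX : HasDerivAt (fun s => ∫ t in (0 : ℝ)..1, f s (w₀ + t * (w₁ - w₀)) * (w₁ - w₀))
      (∫ t in (0 : ℝ)..1, f' s₀ (w₀ + t * (w₁ - w₀)) * (w₁ - w₀)) s₀ := by
    refine hasDerivAt_intervalIntegral_of_continuousOn
      (F' := fun s t => f' s (w₀ + t * (w₁ - w₀)) * (w₁ - w₀)) (hUo.mem_nhds hsU)
      (fun s hs => ?_) ?_ (fun s hs t ht => ?_)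
    · exact ((hfc s hs).comp hγc.continuousOn hγW).mul continuousOn_const
    · refine ContinuousOn.mul ?_ continuousOn_const
      exact hfc'.comp (f := fun p : ℝ × ℝ => (p.1, w₀ + p.2 * (w₁ - w₀)))
        (by fun_prop) fun p hp => ⟨hp.1, hγW _ hp.2⟩
    · have := hasDerivAt_b_div_sqrtRatio (S := E s₀) i (hU s hs).1
        ((hU s hs).2.2.2 _ (hγW t ht))
      exact (((this.const_mul (Real.pi : ℂ)).div_const _).mul_const _).mul_const _
  have hval : ∀ w ∈ W', ∀ s ∈ U, HasDerivAt (fun u => m s (l u, n u * sqrtRatio (E s₀) (E s) (l u)))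
      (m s (l w, n w * sqrtRatio (E s₀) (E s) (l w)) * f s w) w := by
    intro w hw s hs
    obtain ⟨-, -, hms, hsl⟩ := hU s hs
    have hl := h.l_deriv w (hW'W hw)
    have hn := (h.n_diff.differentiableAt (h.isOpen.mem_nhds (hW'W hw)))
    have hr := DifferentiableAt.comp w (differentiableAt_sqrtRatio (hsl w hw)) hl.differentiableAt
    have hev : ∀ᶠ u in 𝓝 w, (l u, n u * sqrtRatio (E s₀) (E s) (l u)) ∈ (E s).curve := by
      filter_upwards [hW'o.mem_nhds hw] with u hu
      exact mem_curve_transport (hsl u hu)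
        ⟨(h.regular u (hW'W hu)).1, h.curve u (hW'W hu)⟩
    have h3 := hms.hasDerivAt_param hl (hn.mul hr).hasDerivAt hev
      (mul_ne_zero (h.n_ne_zero (hW'W hw)) (sqrtRatio_ne_zero _ _ _))
    convert! h3 using 2
    have := sqrtRatio_ne_zero (E s₀) (E s) (l w)
    have hlne := (h.regular w (hW'W hw)).1
    have hnne := h.n_ne_zero (hW'W hw)
    simp only [hf, Pi.mul_apply, Function.comp_apply]
    field_simp
  have hexp : ∀ s ∈ U, kappa E m s₀ s (l w₁, n w₁) / kappa E m s₀ s (l w₀, n w₀) =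
      Complex.exp ((∫ t in (0 : ℝ)..1, f s (w₀ + t * (w₁ - w₀)) * (w₁ - w₀)) -
        ∫ t in (0 : ℝ)..1, f s₀ (w₀ + t * (w₁ - w₀)) * (w₁ - w₀)) := by
    intro s hs
    have e1 := eq_mul_exp_integral hW'o hW'c (fun w hw => hval w hw s hs) (hfc s hs) h₀' h₁'
    have e2 := eq_mul_exp_integral hW'o hW'c (fun w hw => hval w hw s₀ hsU) (hfc s₀ hsU) h₀' h₁'
    have r0 := sqrtRatio_self (h.regular w₀ h₀).2
    have r1 := sqrtRatio_self (h.regular w₁ h₁).2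
    rw [r0, r1, mul_one, mul_one] at e2
    have n0 : m s (l w₀, n w₀ * sqrtRatio (E s₀) (E s) (l w₀)) ≠ 0 :=
      ((hU s hs).2.2.1 _ (mem_curve_transport ((hU s hs).2.2.2 w₀ h₀')
        ⟨(h.regular w₀ h₀).1, h.curve w₀ h₀⟩)).1
    have n1 : m s₀ (l w₀, n w₀) ≠ 0 :=
      ((hU s₀ hsU).2.2.1 _ ⟨(h.regular w₀ h₀).1, h.curve w₀ h₀⟩).1
    simp only [kappa]
    rw [e1, e2, Complex.exp_sub]
    generalize (∫ t in (0 : ℝ)..1, f s₀ (w₀ + t * (w₁ - w₀)) * (w₁ - w₀)) = I₁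
    generalize (∫ t in (0 : ℝ)..1, f s (w₀ + t * (w₁ - w₀)) * (w₁ - w₀)) = I₂
    have n2 := Complex.exp_ne_zero I₁
    field_simp
  have hfin : HasDerivAt (fun s => Complex.exp
      ((∫ t in (0 : ℝ)..1, f s (w₀ + t * (w₁ - w₀)) * (w₁ - w₀)) -
        ∫ t in (0 : ℝ)..1, f s₀ (w₀ + t * (w₁ - w₀)) * (w₁ - w₀)))
      (∫ t in (0 : ℝ)..1, f' s₀ (w₀ + t * (w₁ - w₀)) * (w₁ - w₀)) s₀ := by
    have := (hX.sub_const (∫ t in (0 : ℝ)..1, f s₀ (w₀ + t * (w₁ - w₀)) * (w₁ - w₀))).cexp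
    simpa using this
  have hres := hfin.congr_of_eventuallyEq
    (f₁ := fun s => kappa E m s₀ s (l w₁, n w₁) / kappa E m s₀ s (l w₀, n w₀))
    (by filter_upwards [hUo.mem_nhds hsU] with s hs using hexp s hs)
  have e : (∫ t in (0 : ℝ)..1, formVelocity (E s₀) (E' s₀) i (l (w₀ + t * (w₁ - w₀)))
      (n (w₀ + t * (w₁ - w₀))) (l' (w₀ + t * (w₁ - w₀))) * (w₁ - w₀)) =
      ∫ t in (0 : ℝ)..1, f' s₀ (w₀ + t * (w₁ - w₀)) * (w₁ - w₀) := by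
    refine intervalIntegral.integral_congr fun t ht => ?_
    have := sqrtRatio_self (h.regular _ (hW'W (hγW t ht))).2
    simp only [hf', formVelocity, this, div_one]
  rw [e]
  exact hres

end SpectralData

end

section
open Polynomial Set Filter Topology
namespace SpectralData

variable {g : ℕ}

/-! ### The velocity of the functions `μ` in a family -/

/-- A continuously differentiable family of real spectral data near the parameter `s₀`, with
functions `m s` on the curves which have the prescribed logarithmic differential number `i` and are
compatible with the involutions. -/
structure IsLogFamily (E E' : ℝ → SpectralData g) (s₀ : ℝ) (i : Fin 2) (m : ℝ → ℂ × ℂ → ℂ) :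
    Prop where
  deriv : ∀ᶠ s in 𝓝 s₀, HasDerivAt E (E' s) s
  deriv_cont : ∀ᶠ s in 𝓝 s₀, ContinuousAt E' s
  log : ∀ᶠ s in 𝓝 s₀, (E s).HasLogDifferential i (m s)
  hyp : ∀ᶠ s in 𝓝 s₀, ∀ p ∈ (E s).curve, m s (hyp p) = (m s p)⁻¹
  eta : ∀ᶠ s in 𝓝 s₀, ∀ p ∈ (E s).curve, m s (etaInv g p) = conj (m s p)
  real : ∀ᶠ s in 𝓝 s₀, (E s).IsReal
  separable : (X * (E s₀).a).Separable

variable {E E' : ℝ → SpectralData g} {s₀ : ℝ} {i : Fin 2} {m : ℝ → ℂ × ℂ → ℂ}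

theorem hyp_mem_curve {S : SpectralData g} {p : ℂ × ℂ} (hp : p ∈ S.curve) : hyp p ∈ S.curve :=
  ⟨hp.1, by simpa [hyp] using hp.2⟩

theorem IsLogFamily.eventually_slit (h : IsLogFamily E E' s₀ i m) {z : ℂ}
    (hz : z ∈ (E s₀).regularSet) :
    ∀ᶠ s in 𝓝 s₀, (E s).a.eval z / (E s₀).a.eval z ∈ Complex.slitPlane :=
  (eventually_mem_slitPlane h.deriv.self_of_nhds.continuousAt isCompact_singleton
    (singleton_subset_iff.2 hz)).mono fun _ hs => hs z rfl

theorem IsLogFamily.kappa_self (h : IsLogFamily E E' s₀ i m) {p : ℂ × ℂ}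
    (hp : p ∈ (E s₀).curve) (hz : p.1 ∈ (E s₀).regularSet) : kappa E m s₀ s₀ p = 1 := by
  rw [kappa, sqrtRatio_self hz.2, mul_one]
  exact div_self (h.log.self_of_nhds p hp).1

theorem IsLogFamily.eventually_kappa_ne_zero (h : IsLogFamily E E' s₀ i m) {p : ℂ × ℂ}
    (hp : p ∈ (E s₀).curve) (hz : p.1 ∈ (E s₀).regularSet) :
    ∀ᶠ s in 𝓝 s₀, kappa E m s₀ s p ≠ 0 := by
  filter_upwards [h.eventually_slit hz, h.log] with s hs hl
  exact div_ne_zero (hl _ (mem_curve_transport hs hp)).1 (h.log.self_of_nhds p hp).1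

theorem IsLogFamily.eventually_kappa_hyp (h : IsLogFamily E E' s₀ i m) {p : ℂ × ℂ}
    (hp : p ∈ (E s₀).curve) (hz : p.1 ∈ (E s₀).regularSet) :
    ∀ᶠ s in 𝓝 s₀, kappa E m s₀ s (SpectralData.hyp p) = (kappa E m s₀ s p)⁻¹ := by
  filter_upwards [h.eventually_slit hz, h.hyp] with s hs hh
  have h1 := hh _ (mem_curve_transport hs hp)
  have h2 := h.hyp.self_of_nhds p hp
  simp only [kappa, SpectralData.hyp] at h1 h2 ⊢
  rw [neg_mul, h1, h2, inv_div_inv, inv_div]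

/-- The derivative of `kappa ^ 2` at the base parameter, halved: the velocity of `ln μ`. -/
def logVelocity (E : ℝ → SpectralData g) (m : ℝ → ℂ × ℂ → ℂ) (s₀ : ℝ) (p : ℂ × ℂ) : ℂ :=
  deriv (fun s => kappa E m s₀ s p ^ 2) s₀ / 2

/-- Differentiability of `kappa ^ 2` propagates along a parametrized piece of the curve: the quotient of
two values is the exponential of an integral of the difference of the logarithmic differentials. -/
theorem IsLogFamily.hasDerivAt_sq_of_param (h : IsLogFamily E E' s₀ i m) {W : Set ℂ}
    {l n l' : ℂ → ℂ} (hp : (E s₀).IsParam W l n l') {w₀ w₁ : ℂ} (h₀ : w₀ ∈ W) (h₁ : w₁ ∈ W) {k : ℂ}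
    (hk : HasDerivAt (fun s => kappa E m s₀ s (l w₀, n w₀) ^ 2) (2 * k) s₀) :
    HasDerivAt (fun s => kappa E m s₀ s (l w₁, n w₁) ^ 2)
      (2 * (k + ∫ t in (0 : ℝ)..1, formVelocity (E s₀) (E' s₀) i (l (w₀ + t * (w₁ - w₀)))
        (n (w₀ + t * (w₁ - w₀))) (l' (w₀ + t * (w₁ - w₀))) * (w₁ - w₀))) s₀ := by
  have hc : ∀ w ∈ W, (l w, n w) ∈ (E s₀).curve := fun w hw => ⟨(hp.regular w hw).1, hp.curve w hw⟩
  have h1 := hasDerivAt_kappa_div h.deriv h.deriv_cont h.log hp h₀ h₁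
  have h2 := hk.fun_mul (h1.fun_pow 2)
  have e0 := h.kappa_self (hc w₀ h₀) (hp.regular w₀ h₀)
  have e1 := h.kappa_self (hc w₁ h₁) (hp.regular w₁ h₁)
  rw [e0, e1] at h2
  refine (h2.congr_of_eventuallyEq ?_).congr_deriv (by simp; ring)
  filter_upwards [h.eventually_kappa_ne_zero (hc w₀ h₀) (hp.regular w₀ h₀)] with s hs
  field_simp

/-- The function `kappa ^ 2` is differentiable at the base parameter at all points over `z`. -/
def Conv (E : ℝ → SpectralData g) (m : ℝ → ℂ × ℂ → ℂ) (s₀ : ℝ) (z : ℂ) : Prop :=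
  ∀ n, n ^ 2 = z * (E s₀).a.eval z → DifferentiableAt ℝ (fun s => kappa E m s₀ s (z, n) ^ 2) s₀

theorem IsLogFamily.hasDerivAt_hyp (h : IsLogFamily E E' s₀ i m) {p : ℂ × ℂ}
    (hp : p ∈ (E s₀).curve) (hz : p.1 ∈ (E s₀).regularSet) {k : ℂ}
    (hk : HasDerivAt (fun s => kappa E m s₀ s p ^ 2) (2 * k) s₀) :
    HasDerivAt (fun s => kappa E m s₀ s (SpectralData.hyp p) ^ 2) (2 * -k) s₀ := by
  have e := h.kappa_self hp hz
  have h1 := hk.fun_inv (by rw [e]; simp)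
  rw [e] at h1
  refine (h1.congr_of_eventuallyEq ?_).congr_deriv (by ring)
  filter_upwards [h.eventually_kappa_hyp hp hz] with s hs
  rw [hs, inv_pow]

theorem IsLogFamily.conv_of_differentiableAt (h : IsLogFamily E E' s₀ i m) {z n : ℂ}
    (hz : z ∈ (E s₀).regularSet) (hn : n ^ 2 = z * (E s₀).a.eval z)
    (hd : DifferentiableAt ℝ (fun s => kappa E m s₀ s (z, n) ^ 2) s₀) : Conv E m s₀ z := by
  intro n' hn'
  rcases sq_eq_sq_iff_eq_or_eq_neg.1 (hn'.trans hn.symm) with rfl | rfl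
  · exact hd
  · have := hd.hasDerivAt
    rw [← mul_div_cancel₀ (_root_.deriv _ s₀) (two_ne_zero' ℂ)] at this
    exact (h.hasDerivAt_hyp ⟨hz.1, hn⟩ hz this).differentiableAt

/-- Near a regular point the curve is parametrized by `λ`. -/
theorem exists_isParam_id {S : SpectralData g} {z : ℂ} (hz : z ∈ S.regularSet) :
    ∃ r > 0, Metric.ball z r ⊆ S.regularSet ∧ ∃ ψ : ℂ → ℂ,
      S.IsParam (Metric.ball z r) (fun w => w) ψ fun _ => 1 := by
  obtain ⟨r, hr, hrU⟩ := Metric.isOpen_iff.1 S.isOpen_regularSet z hz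
  obtain ⟨ψ, hψ, hψ2⟩ := exists_sqrt_of_ne_zero (f := fun z => z * S.a.eval z) (c := z) (r := r)
    (differentiable_id.mul S.a.differentiable).differentiableOn
    (fun w hw => mul_ne_zero (hrU hw).1 (hrU hw).2)
  exact ⟨r, hr, hrU, ψ, Metric.isOpen_ball, convex_ball _ _, fun w _ => hasDerivAt_id w, hψ, hrU,
    hψ2⟩

/-- Near a branch point over a simple root `α` of `λ a(λ)`, the curve without the branch point
is parametrized by `λ = α + exp (2 u)`. -/
theorem exists_isParam_of_isolated {S : SpectralData g} (hS : (X * S.a).Separable) {α : ℂ}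
    (hα : (X * S.a).IsRoot α) {R : ℝ} (hR : 0 < R)
    (hiso : ∀ z ∈ Metric.ball α R, (X * S.a).IsRoot z → z = α) :
    ∃ ψ : ℂ → ℂ, DifferentiableOn ℂ ψ (Metric.ball α R) ∧
      (∀ z ∈ Metric.ball α R, ψ z ≠ 0 ∧ (z - α) * ψ z ^ 2 = z * S.a.eval z) ∧
      S.IsParam {u | u.re < Real.log R / 2} (fun u => α + Complex.exp (2 * u))
        (fun u => Complex.exp u * ψ (α + Complex.exp (2 * u))) fun u => 2 * Complex.exp (2 * u) := by
  obtain ⟨q, hq⟩ := dvd_iff_isRoot.2 hα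
  have hRq : ∀ z ∈ Metric.ball α R, q.eval z ≠ 0 := by
    intro z hz h0
    have h2 : (X * S.a).IsRoot z := by rw [hq, IsRoot.def]; simp [h0]
    obtain rfl := hiso z hz h2
    have h1 : (X * S.a).derivative.eval z = 0 := by
      rw [hq]; simp [h0]
    exact hS.eval₂_derivative_ne_zero (RingHom.id ℂ) hα h1
  obtain ⟨ψ, hψ, hψ2⟩ := exists_sqrt_of_ne_zero (f := fun z => q.eval z) (c := α) (r := R)
    q.differentiable.differentiableOn hRq
  have hA : ∀ z ∈ Metric.ball α R, ψ z ≠ 0 ∧ (z - α) * ψ z ^ 2 = z * S.a.eval z := by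
    intro z hz
    refine ⟨fun h0 => hRq z hz ?_, ?_⟩
    · simp only [← hψ2 z hz, h0]; simp
    · rw [hψ2 z hz]
      have := congrArg (eval z) hq
      simpa using this.symm
  have hin : ∀ u ∈ {u : ℂ | u.re < Real.log R / 2}, α + Complex.exp (2 * u) ∈ Metric.ball α R := by
    intro u hu
    simp only [mem_ofPred_eq] at hu
    rw [Metric.mem_ball, dist_eq_norm, add_sub_cancel_left, Complex.norm_exp,
      ← Real.lt_log_iff_exp_lt hR]
    simp
    linarith
  have hl : ∀ u : ℂ, HasDerivAt (fun u => α + Complex.exp (2 * u)) (2 * Complex.exp (2 * u)) u := by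
    intro u
    have := (((hasDerivAt_id u).const_mul 2).cexp).const_add α
    convert! this using 1
    simp; ring
  refine ⟨ψ, hψ, hA, isOpen_lt Complex.continuous_re continuous_const,
    convex_halfSpace_re_lt _, fun u _ => hl u, ?_, fun u hu => ?_, fun u hu => ?_⟩
  · refine Complex.differentiable_exp.differentiableOn.mul ?_
    exact hψ.comp (fun u _ => (hl u).differentiableAt.differentiableWithinAt) hin
  · obtain ⟨h1, h2⟩ := hA _ (hin u hu)
    have h3 : (α + Complex.exp (2 * u)) * S.a.eval (α + Complex.exp (2 * u)) ≠ 0 := by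
      rw [← h2, add_sub_cancel_left]
      exact mul_ne_zero (Complex.exp_ne_zero _) (pow_ne_zero 2 h1)
    exact ⟨left_ne_zero_of_mul h3, right_ne_zero_of_mul h3⟩
  · obtain ⟨h1, h2⟩ := hA _ (hin u hu)
    rw [← h2, add_sub_cancel_left, mul_pow, ← Complex.exp_nat_mul]
    simp

theorem exists_isParam_root {S : SpectralData g} (hS : (X * S.a).Separable) {α : ℂ}
    (hα : (X * S.a).IsRoot α) :
    ∃ R > 0, ∃ ψ : ℂ → ℂ, DifferentiableOn ℂ ψ (Metric.ball α R) ∧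
      (∀ z ∈ Metric.ball α R, ψ z ≠ 0 ∧ (z - α) * ψ z ^ 2 = z * S.a.eval z) ∧
      S.IsParam {u | u.re < Real.log R / 2} (fun u => α + Complex.exp (2 * u))
        (fun u => Complex.exp u * ψ (α + Complex.exp (2 * u))) fun u => 2 * Complex.exp (2 * u) := by
  have h0 : ((X * S.a).rootSet ℂ \ {α}).Finite := ((X * S.a).rootSet_finite ℂ).subset sdiff_subset
  obtain ⟨R, hR, hball⟩ := Metric.isOpen_iff.1 h0.isClosed.isOpen_compl α (by simp)
  refine ⟨R, hR, exists_isParam_of_isolated hS hα hR fun z hz hzr => ?_⟩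
  by_contra hne
  refine hball hz ⟨?_, hne⟩
  rw [mem_rootSet_of_ne hS.ne_zero]
  simpa using hzr

theorem isPreconnected_regularSet {S : SpectralData g} (hS : S.a ≠ 0) :
    IsPreconnected S.regularSet := by
  have hfin : (S.regularSetᶜ).Finite := by
    refine ((X * S.a).rootSet_finite ℂ).subset fun z hz => ?_
    rw [mem_rootSet_of_ne (mul_ne_zero X_ne_zero hS)]
    simp only [regularSet, mem_compl_iff, mem_ofPred_eq, not_and_or, not_not] at hz
    simp only [coe_aeval_eq_eval, eval_mul, eval_X]
    rcases hz with hz | hz <;> simp [hz]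
  have := hfin.countable.isPathConnected_compl_of_one_lt_rank (E := ℂ) (by simp)
  rw [compl_compl] at this
  exact this.isConnected.isPreconnected

/-- The differentiability of `kappa ^ 2`: at points near a branch point it follows by comparison
of the two points over the same `λ`, and then it propagates. -/
theorem IsLogFamily.conv (h : IsLogFamily E E' s₀ i m) {z : ℂ} (hz : z ∈ (E s₀).regularSet) :
    Conv E m s₀ z := by
  obtain ⟨R, hR, ψ, -, -, hp⟩ := exists_isParam_root h.separable (α := 0) (by simp)
  have hstart : ∃ z₀ ∈ (E s₀).regularSet, Conv E m s₀ z₀ := by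
    set u₀ : ℂ := ((Real.log R / 2 - 1 : ℝ) : ℂ) with hu₀
    set u₁ : ℂ := u₀ + Real.pi * Complex.I with hu₁
    have m₀ : u₀ ∈ {u : ℂ | u.re < Real.log R / 2} := by
      simp only [hu₀, mem_ofPred_eq, Complex.ofReal_re]; linarith
    have m₁ : u₁ ∈ {u : ℂ | u.re < Real.log R / 2} := by
      simpa [hu₁] using m₀
    have h1 := (hasDerivAt_kappa_div h.deriv h.deriv_cont h.log hp m₁ m₀).differentiableAt
    have e1 : Complex.exp (2 * u₁) = Complex.exp (2 * u₀) := by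
      rw [hu₁, mul_add, ← mul_assoc, Complex.exp_add, Complex.exp_two_pi_mul_I, mul_one]
    have e2 : Complex.exp u₁ = -Complex.exp u₀ := by
      rw [hu₁, Complex.exp_add, Complex.exp_pi_mul_I]; ring
    refine ⟨_, hp.regular u₀ m₀, h.conv_of_differentiableAt (hp.regular u₀ m₀) (hp.curve u₀ m₀) ?_⟩
    refine h1.congr_of_eventuallyEq ?_
    have hc : (0 + Complex.exp (2 * u₀), Complex.exp u₀ * ψ (0 + Complex.exp (2 * u₀))) ∈
      (E s₀).curve := ⟨(hp.regular u₀ m₀).1, hp.curve u₀ m₀⟩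
    filter_upwards [h.eventually_kappa_hyp hc (hp.regular u₀ m₀),
      h.eventually_kappa_ne_zero hc (hp.regular u₀ m₀)] with s hs hs0
    simp only [e1, e2, SpectralData.hyp, neg_mul] at hs ⊢
    rw [hs]
    field_simp
  obtain ⟨z₀, hz₀, hconv⟩ := hstart
  have hloc : ∀ x ∈ (E s₀).regularSet, ∃ r > 0, ∀ y ∈ Metric.ball x r, ∀ y' ∈ Metric.ball x r,
      Conv E m s₀ y → Conv E m s₀ y' := by
    intro x hx
    obtain ⟨r, hr, -, ψ, hψ⟩ := exists_isParam_id hx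
    refine ⟨r, hr, fun y hy y' hy' hc => ?_⟩
    have h1 := (hc (ψ y) (hψ.curve y hy)).hasDerivAt
    rw [← mul_div_cancel₀ (_root_.deriv _ s₀) (two_ne_zero' ℂ)] at h1
    have h2 := h.hasDerivAt_sq_of_param hψ hy hy' h1
    exact h.conv_of_differentiableAt (hψ.regular y' hy') (hψ.curve y' hy') h2.differentiableAt
  have ha0 : (E s₀).a ≠ 0 := by
    rintro h0
    exact hz.2 (by rw [h0]; simp)
  refine (IsPreconnected.induction₂ (isPreconnected_regularSet ha0)
    (fun x y => Conv E m s₀ x ↔ Conv E m s₀ y) ?_ ?_ ?_ hz₀ hz).1 hconv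
  · intro x hx
    obtain ⟨r, hr, h1⟩ := hloc x hx
    filter_upwards [mem_nhdsWithin_of_mem_nhds (Metric.ball_mem_nhds x hr)] with y hy
    exact ⟨h1 x (Metric.mem_ball_self hr) y hy, h1 y hy x (Metric.mem_ball_self hr)⟩
  · exact fun x y z _ _ _ h1 h2 => h1.trans h2
  · exact fun x y _ _ h1 => h1.symm

theorem IsLogFamily.hasDerivAt_kappa_sq (h : IsLogFamily E E' s₀ i m) {p : ℂ × ℂ}
    (hp : p ∈ (E s₀).curve) (hz : p.1 ∈ (E s₀).regularSet) :
    HasDerivAt (fun s => kappa E m s₀ s p ^ 2) (2 * logVelocity E m s₀ p) s₀ := by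
  have := (h.conv hz p.2 hp.2).hasDerivAt
  rwa [← mul_div_cancel₀ (_root_.deriv _ s₀) (two_ne_zero' ℂ)] at this

theorem IsLogFamily.logVelocity_hyp (h : IsLogFamily E E' s₀ i m) {p : ℂ × ℂ}
    (hp : p ∈ (E s₀).curve) (hz : p.1 ∈ (E s₀).regularSet) :
    logVelocity E m s₀ (SpectralData.hyp p) = -logVelocity E m s₀ p := by
  have := (h.hasDerivAt_kappa_sq (hyp_mem_curve hp) hz).unique
    (h.hasDerivAt_hyp hp hz (h.hasDerivAt_kappa_sq hp hz))
  exact mul_left_cancel₀ two_ne_zero this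

/-- In a holomorphic parametrization of the curve, the velocity of `ln μ` is a primitive of
the velocity of the form `d ln μ`. -/
theorem IsLogFamily.hasDerivAt_logVelocity (h : IsLogFamily E E' s₀ i m) {W : Set ℂ}
    {l n l' : ℂ → ℂ} (hp : (E s₀).IsParam W l n l') {w : ℂ} (hw : w ∈ W) :
    HasDerivAt (fun w => logVelocity E m s₀ (l w, n w))
      (formVelocity (E s₀) (E' s₀) i (l w) (n w) (l' w)) w := by
  obtain ⟨r, hr, hrW⟩ := Metric.isOpen_iff.1 hp.isOpen w hw
  have hd := hp.formVelocity_diff (T := E' s₀) i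
  obtain ⟨P, hP⟩ := (hd.mono hrW).isExactOn_ball
  have hww : w ∈ Metric.ball w r := Metric.mem_ball_self hr
  have heq : ∀ w₁ ∈ Metric.ball w r, logVelocity E m s₀ (l w₁, n w₁) =
      logVelocity E m s₀ (l w, n w) + (P w₁ - P w) := by
    intro w₁ hw₁
    have h1 := h.hasDerivAt_sq_of_param hp hw (hrW hw₁)
      (h.hasDerivAt_kappa_sq ⟨(hp.regular w hw).1, hp.curve w hw⟩ (hp.regular w hw))
    have h2 := (h.hasDerivAt_kappa_sq ⟨(hp.regular w₁ (hrW hw₁)).1, hp.curve w₁ (hrW hw₁)⟩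
      (hp.regular w₁ (hrW hw₁))).unique h1
    rw [integral_segment_eq_sub (convex_ball w r) (fun v hv => hP v hv)
      (hd.mono hrW).continuousOn hww hw₁] at h2
    exact mul_left_cancel₀ two_ne_zero h2
  have h3 := ((hP w hww).sub_const (P w)).const_add (logVelocity E m s₀ (l w, n w))
  refine h3.congr_of_eventuallyEq ?_
  filter_upwards [Metric.ball_mem_nhds w hr] with w₁ hw₁ using heq w₁ hw₁

end SpectralData

end

section
open Polynomial Set Filter Topology
namespace SpectralData

variable {g : ℕ} {E E' : ℝ → SpectralData g} {s₀ : ℝ} {i : Fin 2} {m : ℝ → ℂ × ℂ → ℂ}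

/-! ### The velocity of `ln μ` is a polynomial divided by `ν` -/

/-- A square root of `λ a(λ)`. -/
def rootA (S : SpectralData g) (z : ℂ) : ℂ := Complex.exp (Complex.log (z * S.a.eval z) / 2)

theorem rootA_sq {S : SpectralData g} {z : ℂ} (hz : z ∈ S.regularSet) :
    S.rootA z ^ 2 = z * S.a.eval z := by
  rw [rootA, ← Complex.exp_nat_mul, Nat.cast_ofNat, mul_div_cancel₀ _ two_ne_zero,
    Complex.exp_log (mul_ne_zero hz.1 hz.2)]

/-- The function `ν ∂ₜ ln μ / π`. It depends only on `λ`. -/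
def velocityNumerator (E : ℝ → SpectralData g) (m : ℝ → ℂ × ℂ → ℂ) (s₀ : ℝ) (z : ℂ) : ℂ :=
  (E s₀).rootA z * logVelocity E m s₀ (z, (E s₀).rootA z) / Real.pi

theorem IsLogFamily.velocityNumerator_eq (h : IsLogFamily E E' s₀ i m) {z n : ℂ}
    (hz : z ∈ (E s₀).regularSet) (hn : n ^ 2 = z * (E s₀).a.eval z) :
    velocityNumerator E m s₀ z = n * logVelocity E m s₀ (z, n) / Real.pi := by
  rw [velocityNumerator]
  rcases sq_eq_sq_iff_eq_or_eq_neg.1 ((rootA_sq hz).trans hn.symm) with h1 | h1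
  · rw [h1]
  · have := h.logVelocity_hyp (p := (z, n)) ⟨hz.1, hn⟩ hz
    rw [SpectralData.hyp] at this
    rw [h1, this, neg_mul_neg]

/-- The linear differential equation for `ν ∂ₜ ln μ / π`, away from the branch points. -/
theorem IsLogFamily.hasDerivAt_velocityNumerator (h : IsLogFamily E E' s₀ i m) {z : ℂ}
    (hz : z ∈ (E s₀).regularSet) :
    ∃ d, HasDerivAt (velocityNumerator E m s₀) d z ∧
      2 * ((E s₀).a.eval z * ((E' s₀).b i).eval z) - ((E s₀).b i).eval z * (E' s₀).a.eval z -
        2 * ((E s₀).a.eval z * (z * d)) +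
        ((E s₀).a.eval z + z * (derivative (E s₀).a).eval z) * velocityNumerator E m s₀ z = 0 := by
  obtain ⟨r, hr, hrU, ψ, hψ⟩ := exists_isParam_id hz
  have hzr := Metric.mem_ball_self (x := z) hr
  have hψd := (hψ.n_diff.differentiableAt (Metric.ball_mem_nhds z hr)).hasDerivAt
  have h1 := (hψd.fun_mul (h.hasDerivAt_logVelocity hψ hzr)).div_const (Real.pi : ℂ)
  have h2 : HasDerivAt (fun w => ψ w ^ 2) (2 * ψ z * _root_.deriv ψ z) z := by simpa using hψd.fun_pow 2
  have h3 := ((X * (E s₀).a).hasDerivAt z).congr_of_eventuallyEq (f₁ := fun w => ψ w ^ 2) (by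
    filter_upwards [Metric.ball_mem_nhds z hr] with w hw
    rw [hψ.curve w hw]; simp)
  have h4 := h2.unique h3
  simp only [derivative_mul, derivative_X, one_mul, eval_add, eval_mul, eval_X] at h4
  refine ⟨_, h1.congr_of_eventuallyEq ?_, ?_⟩
  · filter_upwards [Metric.ball_mem_nhds z hr] with w hw
    exact h.velocityNumerator_eq (hrU hw) (hψ.curve w hw)
  · have hcz := hψ.curve z hzr
    rw [h.velocityNumerator_eq hz hcz, ← h4, formVelocity]
    have e1 := hψ.n_ne_zero hzr
    have e2 := hz.1
    have e3 := hz.2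
    have e4 : (Real.pi : ℂ) ≠ 0 := by exact_mod_cast Real.pi_ne_zero
    field_simp
    linear_combination (2 * _root_.deriv ψ z * logVelocity E m s₀ (z, ψ z)) * hcz

/-- The singularities of `ν ∂ₜ ln μ / π` at the branch points are removable. In the coordinate
`λ = α + exp (2 u)` the derivative of `∂ₜ ln μ` is `O(exp (- Re u))`, hence `∂ₜ ln μ` itself is
`O(exp (-2 Re u)) = O(|λ - α|⁻¹)` in the strip `|Im u| ≤ π`, and the factor `ν` gains a power `1/2`. -/
theorem IsLogFamily.tendsto_velocityNumerator_mul (h : IsLogFamily E E' s₀ i m) {α : ℂ}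
    (hα : (X * (E s₀).a).IsRoot α) :
    Tendsto (fun z => velocityNumerator E m s₀ z * (z - α)) (𝓝[≠] α) (𝓝 0) := by
  obtain ⟨R, hR, ψ, hψ, hψ2, hp⟩ := exists_isParam_root h.separable hα
  have hαR := Metric.mem_ball_self (x := α) hR
  have hψc := (hψ.differentiableAt (Metric.ball_mem_nhds α hR)).continuousAt
  set ε : ℂ → ℂ := fun z => Real.pi * (2 * ((E s₀).a.eval z * ((E' s₀).b i).eval z) -
    ((E s₀).b i).eval z * (E' s₀).a.eval z) / ψ z ^ 3 with hε
  have hεc : ContinuousAt ε α := by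
    refine ContinuousAt.div ?_ (hψc.pow 3) (pow_ne_zero 3 (hψ2 α hαR).1)
    exact Continuous.continuousAt (by fun_prop)
  obtain ⟨M, hM⟩ := (hεc.norm.isBoundedUnder_le)
  obtain ⟨N, hN⟩ := (hψc.norm.isBoundedUnder_le)
  obtain ⟨R₁, hR₁, hball⟩ := Metric.eventually_nhds_iff_ball.1
    ((eventually_map.1 hM).and ((eventually_map.1 hN).and (Metric.ball_mem_nhds α hR)))
  have hM0 : 0 ≤ M := (norm_nonneg _).trans (hball α (Metric.mem_ball_self hR₁)).1
  have hN0 : 0 ≤ N := (norm_nonneg _).trans (hball α (Metric.mem_ball_self hR₁)).2.1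
  set K : ℂ → ℂ := fun u => logVelocity E m s₀ (α + Complex.exp (2 * u),
    Complex.exp u * ψ (α + Complex.exp (2 * u))) with hK
  set t₁ : ℝ := Real.log R₁ / 2 - 1 with ht₁
  have hin : ∀ u : ℂ, u.re ≤ t₁ → α + Complex.exp (2 * u) ∈ Metric.ball α R₁ := by
    intro u hu
    rw [Metric.mem_ball, dist_eq_norm, add_sub_cancel_left, Complex.norm_exp,
      ← Real.lt_log_iff_exp_lt hR₁]
    simp
    linarith
  have hinW : ∀ u : ℂ, u.re ≤ t₁ → u ∈ {u : ℂ | u.re < Real.log R / 2} := by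
    intro u hu
    have := (hball _ (hin u hu)).2.2
    rw [dist_eq_norm, add_sub_cancel_left, Complex.norm_exp, ← Real.lt_log_iff_exp_lt hR] at this
    simp at this
    simp only [mem_ofPred_eq]
    linarith
  have hKd : ∀ u : ℂ, u.re ≤ t₁ →
      HasDerivAt K (Complex.exp (-u) * ε (α + Complex.exp (2 * u))) u := by
    intro u hu
    have h1 := h.hasDerivAt_logVelocity hp (hinW u hu)
    refine h1.congr_deriv ?_
    have hreg := hp.regular u (hinW u hu)
    have hq := (hψ2 _ (hball _ (hin u hu)).2.2)
    have e0 : Complex.exp (2 * u) = Complex.exp u ^ 2 := by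
      rw [← Complex.exp_nat_mul]; simp
    simp only [formVelocity, hε, Complex.exp_neg]
    rw [add_sub_cancel_left] at hq
    generalize hl : α + Complex.exp (2 * u) = l at *
    obtain ⟨e1, e2⟩ := hq
    obtain ⟨e3, e4⟩ := hreg
    have e5 := Complex.exp_ne_zero u
    rw [e0] at e2 ⊢
    field_simp
    linear_combination (2 * ((E s₀).a.eval l * ((E' s₀).b i).eval l) -
        ((E s₀).b i).eval l * (E' s₀).a.eval l) * e2
  have hKb : ∀ u : ℂ, u.re ≤ t₁ → u.im ∈ Icc (-Real.pi) Real.pi →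
      ‖K u‖ ≤ ‖K t₁‖ + M * Real.exp (-u.re) * Real.exp (t₁ - u.re + Real.pi) := by
    intro u hu hui
    have hconv : Convex ℝ (Icc u.re t₁ ×ℂ Icc (-Real.pi) Real.pi) :=
      ((convex_Icc u.re t₁).linear_preimage Complex.reLm).inter
        ((convex_Icc (-Real.pi) Real.pi).linear_preimage Complex.imLm)
    have hpi := Real.pi_pos
    have h1 := hconv.norm_image_sub_le_of_norm_hasDerivWithin_le (f := K)
      (f' := fun v => Complex.exp (-v) * ε (α + Complex.exp (2 * v))) (C := Real.exp (-u.re) * M)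
      (x := (t₁ : ℂ)) (y := u) (fun v hv => (hKd v hv.1.2).hasDerivWithinAt) (fun v hv => by
        rw [norm_mul, Complex.norm_exp, Complex.neg_re]
        exact mul_le_mul (Real.exp_le_exp.2 (neg_le_neg hv.1.1)) (hball _ (hin v hv.1.2)).1
          (norm_nonneg _) (Real.exp_nonneg _))
      ⟨⟨by simpa using hu, by simp⟩, by simp [hpi.le]⟩ ⟨⟨le_rfl, hu⟩, hui⟩
    have h2 : ‖u - t₁‖ ≤ Real.exp (t₁ - u.re + Real.pi) := by
      have := Complex.norm_le_abs_re_add_abs_im (u - t₁)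
      simp only [Complex.sub_re, Complex.ofReal_re, Complex.sub_im, Complex.ofReal_im,
        sub_zero] at this
      rw [abs_of_nonpos (by linarith : u.re - t₁ ≤ 0)] at this
      have h3 : |u.im| ≤ Real.pi := abs_le.2 hui
      have h4 := Real.add_one_le_exp (t₁ - u.re + Real.pi)
      linarith
    have h3 : ‖K u‖ ≤ ‖K t₁‖ + ‖K u - K t₁‖ := by
      have := norm_add_le (K t₁) (K u - K t₁)
      rwa [add_sub_cancel] at this
    have h5 : Real.exp (-u.re) * M * ‖u - t₁‖ ≤
        Real.exp (-u.re) * M * Real.exp (t₁ - u.re + Real.pi) := by gcongr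
    linarith
  -- the bound in terms of the square root of the distance to the root
  have hbound : ∀ᶠ z in 𝓝[≠] α, ‖velocityNumerator E m s₀ z * (z - α)‖ ≤
      N / Real.pi * (‖K t₁‖ * Real.sqrt ‖z - α‖ ^ 3 +
        M * Real.exp (t₁ + Real.pi) * Real.sqrt ‖z - α‖) := by
    have hmem : Metric.ball α (Real.exp (2 * t₁)) ∈ 𝓝[≠] α :=
      mem_nhdsWithin_of_mem_nhds (Metric.ball_mem_nhds α (Real.exp_pos _))
    filter_upwards [hmem, self_mem_nhdsWithin] with z hz hzα
    have hz0 : z - α ≠ 0 := sub_ne_zero.2 hzα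
    set u : ℂ := Complex.log (z - α) / 2 with hu
    have hure : u.re = Real.log ‖z - α‖ / 2 := by
      rw [hu, show (2 : ℂ) = ((2 : ℝ) : ℂ) by simp, Complex.div_ofReal_re, Complex.log_re]
    have huim : u.im = (z - α).arg / 2 := by
      rw [hu, show (2 : ℂ) = ((2 : ℝ) : ℂ) by simp, Complex.div_ofReal_im, Complex.log_im]
    have hexp : Complex.exp (2 * u) = z - α := by
      rw [hu, mul_div_cancel₀ _ two_ne_zero, Complex.exp_log hz0]
    have hsqrt : Real.exp u.re = Real.sqrt ‖z - α‖ := by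
      rw [hure, Real.exp_half, Real.exp_log (norm_pos_iff.2 hz0)]
    have hut : u.re ≤ t₁ := by
      rw [Metric.mem_ball, dist_eq_norm, ← Real.log_lt_iff_lt_exp (norm_pos_iff.2 hz0)] at hz
      rw [hure]; linarith
    have hui : u.im ∈ Icc (-Real.pi) Real.pi := by
      have h1 := Complex.neg_pi_lt_arg (z - α)
      have h2 := Complex.arg_le_pi (z - α)
      have h3 := Real.pi_pos
      rw [huim]; constructor <;> linarith
    have e1 := h.velocityNumerator_eq (hp.regular u (hinW u hut)) (hp.curve u (hinW u hut))
    have hz' : α + Complex.exp (2 * u) = z := by rw [hexp]; ring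
    have e2 := hKb u hut hui
    have e3 := (hball _ (hin u hut)).2.1
    simp only [hK, hz'] at e1 e2 e3
    rw [e1, norm_mul, norm_div, norm_mul, norm_mul, Complex.norm_exp, Complex.norm_real,
      Real.norm_eq_abs, abs_of_pos Real.pi_pos, ← hsqrt]
    have e4 : ‖z - α‖ = Real.exp u.re ^ 2 := by rw [hsqrt, Real.sq_sqrt (norm_nonneg _)]
    rw [e4]
    have e5 : M * Real.exp (-u.re) * Real.exp (t₁ - u.re + Real.pi) =
        M * Real.exp (t₁ + Real.pi) / Real.exp u.re ^ 2 := by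
      rw [show t₁ - u.re + Real.pi = (t₁ + Real.pi) + -u.re by ring, Real.exp_add, Real.exp_neg]
      field_simp
    rw [e5] at e2
    have hpi := Real.pi_pos
    have hx := Real.exp_pos u.re
    calc Real.exp u.re * ‖ψ z‖ * ‖logVelocity E m s₀ (z, Complex.exp u * ψ z)‖ / Real.pi *
          Real.exp u.re ^ 2
        ≤ Real.exp u.re * N * (‖K t₁‖ + M * Real.exp (t₁ + Real.pi) / Real.exp u.re ^ 2) /
          Real.pi * Real.exp u.re ^ 2 := by gcongr
      _ = _ := by field_simp
  refine squeeze_zero_norm' hbound ?_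
  have hlim : Tendsto (fun z : ℂ => N / Real.pi * (‖K t₁‖ * Real.sqrt ‖z - α‖ ^ 3 +
        M * Real.exp (t₁ + Real.pi) * Real.sqrt ‖z - α‖)) (𝓝 α) (𝓝 0) := by
    have : Continuous (fun z : ℂ => N / Real.pi * (‖K t₁‖ * Real.sqrt ‖z - α‖ ^ 3 +
        M * Real.exp (t₁ + Real.pi) * Real.sqrt ‖z - α‖)) := by fun_prop
    have h2 := this.tendsto α
    simpa using h2
  exact hlim.mono_left nhdsWithin_le_nhds

theorem not_mem_regularSet_iff {S : SpectralData g} {z : ℂ} :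
    z ∉ S.regularSet ↔ (X * S.a).IsRoot z := by
  simp only [regularSet, mem_ofPred_eq, not_and_or, not_not, IsRoot.def, eval_mul, eval_X,
    mul_eq_zero, ne_eq]

/-- The function `ν ∂ₜ ln μ / π` extends to an entire function. -/
theorem IsLogFamily.exists_entire (h : IsLogFamily E E' s₀ i m) :
    ∃ f : ℂ → ℂ, Differentiable ℂ f ∧ ∀ z ∈ (E s₀).regularSet, f z = velocityNumerator E m s₀ z := by
  classical
  set F := velocityNumerator E m s₀ with hF
  refine ⟨fun z => if z ∈ (E s₀).regularSet then F z else limUnder (𝓝[≠] z) F, ?_,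
    fun z hz => if_pos hz⟩
  intro z
  by_cases hz : z ∈ (E s₀).regularSet
  · obtain ⟨d, hd, -⟩ := h.hasDerivAt_velocityNumerator hz
    refine (hd.congr_of_eventuallyEq ?_).differentiableAt
    filter_upwards [(E s₀).isOpen_regularSet.mem_nhds hz] with w hw using if_pos hw
  · have hroot := not_mem_regularSet_iff.1 hz
    obtain ⟨R, hR, ψ, -, hψ, -⟩ := exists_isParam_root h.separable hroot
    have hreg : ∀ w ∈ Metric.ball z R \ {z}, w ∈ (E s₀).regularSet := by
      rintro w ⟨hw, hwz⟩
      by_contra h0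
      obtain ⟨h1, h2⟩ := hψ w hw
      have h3 := not_mem_regularSet_iff.1 h0
      simp only [IsRoot.def, eval_mul, eval_X] at h3
      rw [h3] at h2
      exact mul_ne_zero (sub_ne_zero.2 hwz) (pow_ne_zero 2 h1) h2
    have hd : DifferentiableOn ℂ F (Metric.ball z R \ {z}) := by
      intro w hw
      obtain ⟨d, hd, -⟩ := h.hasDerivAt_velocityNumerator (hreg w hw)
      exact hd.differentiableAt.differentiableWithinAt
    have ho : (fun w => F w - F z) =o[𝓝[≠] z] fun w => (w - z)⁻¹ := by
      rw [Asymptotics.isLittleO_iff_tendsto']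
      · have h1 := h.tendsto_velocityNumerator_mul hroot
        have h2 : Tendsto (fun w => F z * (w - z)) (𝓝[≠] z) (𝓝 0) := by
          have : Continuous fun w => F z * (w - z) := by fun_prop
          simpa using (this.tendsto z).mono_left nhdsWithin_le_nhds
        have h3 := h1.sub h2
        simp only [sub_zero] at h3
        refine h3.congr fun w => ?_
        rw [div_inv_eq_mul, sub_mul]
      · filter_upwards [self_mem_nhdsWithin] with w hw h0
        exact absurd h0 (inv_ne_zero (sub_ne_zero.2 hw))
    have := (Complex.differentiableOn_update_limUnder_of_isLittleO (Metric.ball_mem_nhds z hR)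
      hd ho).differentiableAt (Metric.ball_mem_nhds z hR)
    refine this.congr_of_eventuallyEq ?_
    filter_upwards [Metric.ball_mem_nhds z hR] with w hw
    by_cases hwz : w = z
    · subst hwz
      rw [if_neg hz, Function.update_self]
    · rw [if_pos (hreg w ⟨hw, hwz⟩), Function.update_of_ne hwz]

end SpectralData

end

section
open Polynomial Set Filter Topology
namespace SpectralData

variable {g : ℕ}

/-! ### Families of spectral curves satisfy the linearized Whitham equations -/

theorem IsReal.eval_a {S : SpectralData g} (hS : S.IsReal) {z : ℂ} (hz : z ≠ 0) :
    S.a.eval (conj z)⁻¹ = ((conj z)⁻¹) ^ (2 * g) * conj (S.a.eval z) :=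
  ((conjRev_eq_self_iff S.a_natDegree_le).1 hS.a z hz).symm

theorem IsReal.eval_b {S : SpectralData g} (hS : S.IsReal) (i : Fin 2) {z : ℂ} (hz : z ≠ 0) :
    (S.b i).eval (conj z)⁻¹ = ((conj z)⁻¹) ^ (g + 1) * conj ((S.b i).eval z) :=
  ((conjRev_eq_self_iff (S.b_natDegree_le i)).1 (hS.b i) z hz).symm

theorem inv_conj_ne_zero {z : ℂ} (hz : z ≠ 0) : (conj z)⁻¹ ≠ 0 := by simpa using hz

theorem IsReal.inv_conj_mem_regularSet {S : SpectralData g} (hS : S.IsReal) {z : ℂ}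
    (hz : z ∈ S.regularSet) : (conj z)⁻¹ ∈ S.regularSet := by
  refine ⟨inv_conj_ne_zero hz.1, ?_⟩
  rw [hS.eval_a hz.1]
  exact mul_ne_zero (pow_ne_zero _ (inv_conj_ne_zero hz.1)) (by simpa using hz.2)

theorem IsReal.etaInv_mem_curve {S : SpectralData g} (hS : S.IsReal) {p : ℂ × ℂ}
    (hp : p ∈ S.curve) : etaInv g p ∈ S.curve := by
  obtain ⟨h0, h1⟩ := hp
  refine ⟨inv_conj_ne_zero h0, ?_⟩
  simp only [etaInv]
  rw [hS.eval_a h0, neg_sq, mul_pow, ← map_pow, h1, map_mul]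
  have h2 := inv_conj_ne_zero h0
  rw [← inv_inv (conj p.1), inv_inv (conj p.1)⁻¹]
  generalize (conj p.1)⁻¹ = w at *
  field_simp
  ring

theorem IsReal.ratio_inv_conj {S T : SpectralData g} (hS : S.IsReal) (hT : T.IsReal) {z : ℂ}
    (hz : z ≠ 0) : T.a.eval (conj z)⁻¹ / S.a.eval (conj z)⁻¹ =
      conj (T.a.eval z / S.a.eval z) := by
  rw [hS.eval_a hz, hT.eval_a hz, map_div₀,
    mul_div_mul_left _ _ (pow_ne_zero _ (inv_conj_ne_zero hz))]

theorem IsReal.sqrtRatio_inv_conj {S T : SpectralData g} (hS : S.IsReal) (hT : T.IsReal) {z : ℂ}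
    (hz : z ≠ 0) (h : T.a.eval z / S.a.eval z ∈ Complex.slitPlane) :
    sqrtRatio S T (conj z)⁻¹ = conj (sqrtRatio S T z) := by
  rw [sqrtRatio, sqrtRatio, hS.ratio_inv_conj hT hz,
    Complex.log_conj _ (Complex.mem_slitPlane_iff_arg.1 h).1, ← Complex.exp_conj, map_div₀, map_ofNat]

variable {E E' : ℝ → SpectralData g} {s₀ : ℝ} {i : Fin 2} {m : ℝ → ℂ × ℂ → ℂ}

/-- The compatibility of `μ` with `η` is inherited by its velocity. -/
theorem IsLogFamily.logVelocity_eta (h : IsLogFamily E E' s₀ i m) {p : ℂ × ℂ}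
    (hp : p ∈ (E s₀).curve) (hz : p.1 ∈ (E s₀).regularSet) :
    logVelocity E m s₀ (etaInv g p) = conj (logVelocity E m s₀ p) := by
  have hS := h.real.self_of_nhds
  have h1 := h.hasDerivAt_kappa_sq (hS.etaInv_mem_curve hp) (hS.inv_conj_mem_regularSet hz)
  have h2 := (h.hasDerivAt_kappa_sq hp hz).star
  have heq : (fun s => kappa E m s₀ s (etaInv g p) ^ 2) =ᶠ[𝓝 s₀]
      fun s => star (kappa E m s₀ s p ^ 2) := by
    filter_upwards [h.eventually_slit hz, h.real, h.eta] with s hs hr he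
    have e1 := he _ (mem_curve_transport hs hp)
    have e2 := h.eta.self_of_nhds p hp
    have e3 := hS.sqrtRatio_inv_conj hr hz.1 hs
    have e4 : ((etaInv g p).1, (etaInv g p).2 * sqrtRatio (E s₀) (E s) (etaInv g p).1) =
        etaInv g (p.1, p.2 * sqrtRatio (E s₀) (E s) p.1) := by
      simp only [etaInv, e3, map_mul]
      refine Prod.ext rfl ?_
      simp only
      ring
    rw [kappa, e4, e1, e2, kappa, star_pow, ← map_div₀]
    rfl
  have h3 := h1.unique (h2.congr_of_eventuallyEq heq)
  simp only [star_mul, star_ofNat] at h3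
  rw [mul_comm _ (2 : ℂ)] at h3
  exact mul_left_cancel₀ two_ne_zero h3

/-- The symmetry under `η` turns the behaviour of `ν ∂ₜ ln μ / π` at `λ = 0` into a bound for the growth
at infinity. -/
theorem IsLogFamily.velocityNumerator_inv_conj (h : IsLogFamily E E' s₀ i m) {z : ℂ}
    (hz : z ∈ (E s₀).regularSet) :
    velocityNumerator E m s₀ (conj z)⁻¹ =
      -(((conj z)⁻¹) ^ (g + 1) * conj (velocityNumerator E m s₀ z)) := by
  have hS := h.real.self_of_nhds
  have hn := rootA_sq hz
  have hp : (z, (E s₀).rootA z) ∈ (E s₀).curve := ⟨hz.1, hn⟩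
  have h1 := hS.etaInv_mem_curve hp
  have h2 := h.velocityNumerator_eq (hS.inv_conj_mem_regularSet hz) h1.2
  have h3 := h.logVelocity_eta hp hz
  simp only [etaInv] at h2 h3
  rw [h2, h3, velocityNumerator, map_div₀, map_mul, Complex.conj_ofReal]
  ring

/-- The function `ν ∂ₜ ln μ / π` is a polynomial of degree at most `g + 1` in `λ`: it is entire,
and by the symmetry with respect to `η` it has polynomial growth. -/
theorem IsLogFamily.exists_polynomial (h : IsLogFamily E E' s₀ i m) :
    ∃ c : ℂ[X], c.natDegree ≤ g + 1 ∧
      ∀ z ∈ (E s₀).regularSet, velocityNumerator E m s₀ z = c.eval z := by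
  obtain ⟨f, hf, hfe⟩ := h.exists_entire
  have hS := h.real.self_of_nhds
  have ha0 : (E s₀).a.eval 0 ≠ 0 := by
    have := h.separable.eval₂_derivative_ne_zero (RingHom.id ℂ) (x := 0) (by simp)
    simpa [coeff_zero_eq_eval_zero] using this
  have hev : ∀ᶠ z in 𝓝 (0 : ℂ), ‖f z‖ < ‖f 0‖ + 1 ∧ (E s₀).a.eval z ≠ 0 :=
    ((hf.continuous.norm.continuousAt (x := 0)).eventually_lt continuousAt_const
      (by simp)).and ((E s₀).a.continuous.continuousAt.eventually_ne ha0)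
  obtain ⟨r, hr, hball⟩ := Metric.eventually_nhds_iff_ball.1 hev
  have hgrow : ∀ z : ℂ, r⁻¹ + 1 ≤ ‖z‖ → ‖f z‖ ≤ (‖f 0‖ + 1) * ‖z‖ ^ (g + 1) := by
    intro z hz
    have hri := inv_pos.2 hr
    have hz0 : z ≠ 0 := norm_pos_iff.1 (by linarith)
    have hw : (conj z)⁻¹ ∈ Metric.ball (0 : ℂ) r := by
      rw [mem_ball_zero_iff, norm_inv, RCLike.norm_conj]
      exact inv_lt_of_inv_lt₀ hr (by linarith)
    obtain ⟨h1, h2⟩ := hball _ hw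
    have hwU : (conj z)⁻¹ ∈ (E s₀).regularSet := ⟨inv_conj_ne_zero hz0, h2⟩
    have hzU : z ∈ (E s₀).regularSet := by
      have := hS.inv_conj_mem_regularSet hwU
      simpa using this
    have h3 := h.velocityNumerator_inv_conj hwU
    rw [← hfe _ hwU] at h3
    simp only [map_inv₀, Complex.conj_conj, inv_inv] at h3
    rw [hfe z hzU, h3, norm_neg, norm_mul, norm_pow, RCLike.norm_conj, mul_comm]
    gcongr
  obtain ⟨c, hc, hfc⟩ := exists_polynomial_of_growth hf hgrow
  exact ⟨c, hc, fun z hz => by rw [← hfe z hz, hfc]⟩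

/-- The velocity of `ln μ` at a sym point is determined by the closing condition. -/
theorem IsLogFamily.closing (h : IsLogFamily E E' s₀ i m) {j : Fin 2}
    (hsym : (E s₀).sym j ∈ (E s₀).regularSet)
    (hcl : ∀ᶠ s in 𝓝 s₀, ∀ p ∈ (E s).curve, p.1 = (E s).sym j → m s p ^ 2 = 1) :
    velocityNumerator E m s₀ ((E s₀).sym j) + ((E s₀).b i).eval ((E s₀).sym j) *
      ((E' s₀).sym j / (E s₀).sym j) = 0 := by
  set z₀ := (E s₀).sym j with hz₀
  obtain ⟨r, hr, hrU, ψ, hψ⟩ := exists_isParam_id hsym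
  have hzr := Metric.mem_ball_self (x := z₀) hr
  have hr2 : 0 < r / 2 := by linarith
  have hsub : Metric.closedBall z₀ (r / 2) ⊆ Metric.ball z₀ r :=
    Metric.closedBall_subset_ball (by linarith)
  have hslit := eventually_mem_slitPlane h.deriv.self_of_nhds.continuousAt
    (isCompact_closedBall z₀ (r / 2)) (hsub.trans hrU)
  have hsub2 : Metric.ball z₀ (r / 2) ⊆ Metric.ball z₀ r := Metric.ball_subset_ball (by linarith)
  have hl : HasDerivAt (fun s => (E s).sym j) ((E' s₀).sym j) s₀ :=
    hasDerivAt_pi.1 h.deriv.self_of_nhds.snd.snd j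
  set f : ℝ → ℂ → ℂ := fun s z => 2 * (Real.pi * ((E s).b i).eval z /
    (ψ z * sqrtRatio (E s₀) (E s) z * z)) with hf
  have hψz := hψ.n_ne_zero hzr
  have hmain := hasDerivAt_moving (h := fun s z => m s (z, ψ z * sqrtRatio (E s₀) (E s) z) ^ 2)
    (f := f) (s₀ := s₀) (z₀ := z₀) (m := 2 * logVelocity E m s₀ (z₀, ψ z₀)) hr2 ?_ ?_ ?_ ?_ hl
    hz₀.symm
  · have hone : (fun s => m s ((E s).sym j, ψ ((E s).sym j) *
        sqrtRatio (E s₀) (E s) ((E s).sym j)) ^ 2) =ᶠ[𝓝 s₀] fun _ => 1 := by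
      have hlm : ∀ᶠ s in 𝓝 s₀, (E s).sym j ∈ Metric.ball z₀ (r / 2) :=
        hl.continuousAt.eventually_mem (Metric.ball_mem_nhds _ hr2)
      filter_upwards [hcl, hslit, hlm] with s h1 h2 h3
      exact h1 _ (mem_curve_transport (h2 _ (Metric.ball_subset_closedBall h3))
        ⟨(hψ.regular _ (hsub2 h3)).1, hψ.curve _ (hsub2 h3)⟩) rfl
    have hzero := hmain.unique ((hasDerivAt_const s₀ (1 : ℂ)).congr_of_eventuallyEq hone)
    have hm1 := hone.self_of_nhds
    simp only [← hz₀] at hm1 hzero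
    rw [hm1] at hzero
    simp only [hf, sqrtRatio_self hsym.2, mul_one, one_mul] at hzero
    rw [h.velocityNumerator_eq hsym (hψ.curve z₀ hzr)]
    have e1 : (Real.pi : ℂ) ≠ 0 := by exact_mod_cast Real.pi_ne_zero
    have e2 := hsym.1
    field_simp at hzero ⊢
    linear_combination (1 / 2 : ℂ) * hzero
  · filter_upwards [hslit, h.log] with s hs hlog z hz
    have hz' := hsub2 hz
    have hd := hψ.n_diff.differentiableAt (hψ.isOpen.mem_nhds hz')
    have hr' := differentiableAt_sqrtRatio (hs z (Metric.ball_subset_closedBall hz))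
    have hev : ∀ᶠ u in 𝓝 z, (u, ψ u * sqrtRatio (E s₀) (E s) u) ∈ (E s).curve := by
      filter_upwards [Metric.isOpen_ball.mem_nhds hz] with u hu
      exact mem_curve_transport (hs u (Metric.ball_subset_closedBall hu))
        ⟨(hψ.regular u (hsub2 hu)).1, hψ.curve u (hsub2 hu)⟩
    have h3 := (hlog.hasDerivAt_param (hasDerivAt_id z) (hd.mul hr').hasDerivAt hev
      (mul_ne_zero (hψ.n_ne_zero hz') (sqrtRatio_ne_zero _ _ _))).fun_pow 2
    convert! h3 using 1
    simp only [hf, id, Pi.mul_apply]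
    push_cast
    ring
  · filter_upwards [hslit] with s hs z hz
    have hz' := hsub2 hz
    have hd := hψ.n_diff.differentiableAt (hψ.isOpen.mem_nhds hz')
    have hr' := differentiableAt_sqrtRatio (hs z (Metric.ball_subset_closedBall hz))
    exact ((((((E s).b i).differentiable z).const_mul _).div ((hd.mul hr').mul differentiableAt_id)
      (mul_ne_zero (mul_ne_zero (hψ.n_ne_zero hz') (sqrtRatio_ne_zero _ _ _))
        (hψ.regular z hz').1)).const_mul _).differentiableWithinAt
  · have hEc : ContinuousAt (fun p : ℝ × ℂ => (E p.1, p.2)) (s₀, z₀) :=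
      (ContinuousAt.comp (f := Prod.fst) (x := (s₀, z₀)) h.deriv.self_of_nhds.continuousAt
        continuousAt_fst).prodMk continuousAt_snd
    have hψc : ContinuousAt (fun p : ℝ × ℂ => ψ p.2) (s₀, z₀) :=
      ContinuousAt.comp (f := Prod.snd) (x := (s₀, z₀))
        (hψ.n_diff.differentiableAt (hψ.isOpen.mem_nhds hzr)).continuousAt continuousAt_snd
    have hb : ContinuousAt (fun p : ℝ × ℂ => ((E p.1).b i).eval p.2) (s₀, z₀) :=
      (continuous_eval_b i).continuousAt.comp hEc
    have hrc : ContinuousAt (fun p : ℝ × ℂ => sqrtRatio (E s₀) (E p.1) p.2) (s₀, z₀) :=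
      ContinuousAt.comp (f := fun p : ℝ × ℂ => (E p.1, p.2)) (x := (s₀, z₀))
        (g := fun p : SpectralData g × ℂ => sqrtRatio (E s₀) p.1 p.2)
        (continuousAt_sqrtRatio (hslit.self_of_nhds z₀ (Metric.mem_closedBall_self hr2.le))) hEc
    exact continuousAt_const.mul ((continuousAt_const.mul hb).div ((hψc.mul hrc).mul
      continuousAt_snd) (mul_ne_zero (mul_ne_zero hψz (sqrtRatio_ne_zero _ _ _)) hsym.1))
  · have h1 := h.hasDerivAt_kappa_sq (p := (z₀, ψ z₀)) ⟨hsym.1, hψ.curve z₀ hzr⟩ hsym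
    refine h1.congr_of_eventuallyEq (Eventually.of_forall fun s => ?_)
    have hone := hcl.self_of_nhds (z₀, ψ z₀) ⟨hsym.1, hψ.curve z₀ hzr⟩ rfl
    simp only [kappa, div_pow, hone, div_one]

/-- The velocity of a family of spectral data comes from an infinitesimal deformation. -/
theorem exists_variation {m : ℝ → Fin 2 → ℂ × ℂ → ℂ} (h : ∀ i, IsLogFamily E E' s₀ i fun s => m s i)
    (hsym : ∀ j, (E s₀).sym j ∈ (E s₀).regularSet)
    (hcl : ∀ i j, ∀ᶠ s in 𝓝 s₀, ∀ p ∈ (E s).curve, p.1 = (E s).sym j → m s i p ^ 2 = 1) :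
    ∃ v : Variation g, (E s₀).velocity v = E' s₀ ∧ (E s₀).IsInfinitesimal v := by
  choose c hc hce using fun i => (h i).exists_polynomial
  have hvc : ∀ i, coeffPoly (fun k : Fin (g + 2) => (c i).coeff k) = c i := fun i =>
    coeffPoly_coeff (hc i)
  refine ⟨(((E' s₀).1, (E' s₀).2.1, fun j => (E' s₀).2.2 j / (E s₀).2.2 j),
    fun i k => (c i).coeff k), ?_, fun i => ?_, fun i j => ?_⟩
  · refine Prod.ext rfl (Prod.ext rfl ?_)
    funext j
    exact div_mul_cancel₀ _ (hsym j).1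
  · refine eq_of_infinite_eval_eq _ _ (Set.Infinite.mono (s := (E s₀).regularSet) ?_ ?_)
    · intro z hz
      obtain ⟨d, hd, hode⟩ := (h i).hasDerivAt_velocityNumerator hz
      have hd2 := ((c i).hasDerivAt z).congr_of_eventuallyEq
        (f₁ := velocityNumerator E (fun s => m s i) s₀) (by
          filter_upwards [(E s₀).isOpen_regularSet.mem_nhds hz] with w hw using hce i w hw)
      rw [hd.unique hd2, hce i z hz] at hode
      simp only [mem_ofPred_eq, whitham, Variation.c, hvc, eval_add, eval_sub, eval_mul, eval_C,
        eval_X, eval_zero]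
      exact hode
    · exact infinite_of_mem_nhds _ ((E s₀).isOpen_regularSet.mem_nhds (hsym 0))
  · have := (h i).closing (hsym j) (hcl i j)
    rw [hce i _ (hsym j)] at this
    simp only [closingDefect, Variation.c, hvc]
    exact this

end SpectralData

end

section
open Polynomial Set Filter Topology
namespace SpectralData

variable {g : ℕ}

/-! ### Spectral data of cmc tori -/

theorem IsSpectral.isReal {S : SpectralData g} {μ : Fin 2 → ℂ × ℂ → ℂ} (hS : S.IsSpectral μ) :
    S.IsReal :=
  ⟨(conjRev_eq_self_iff S.a_natDegree_le).2 hS.a_real,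
    fun i => (conjRev_eq_self_iff (S.b_natDegree_le i)).2 (hS.b_real i), hS.sym_norm⟩

theorem IsReal.coeff_zero_ne_zero {S : SpectralData g} (hS : S.IsReal)
    (h : S.a.coeff (2 * g) ≠ 0) : S.a.coeff 0 ≠ 0 := by
  rw [← hS.coeff_a (Nat.zero_le _), Nat.sub_zero]
  simpa using h

theorem separable_X_mul {p : ℂ[X]} (hp : p.Separable) (h0 : p.coeff 0 ≠ 0) :
    (X * p).Separable := by
  refine separable_X.mul hp ?_
  rwa [irreducible_X.coprime_iff_not_dvd, X_dvd_iff]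

/-- Since the roots of `a` are simple and `λ⁻ᵍ a(λ)` does not change sign on the unit circle, there
are no roots on the unit circle. -/
theorem IsSpectral.eval_a_ne_zero {S : SpectralData g} {μ : Fin 2 → ℂ × ℂ → ℂ}
    (hS : S.IsSpectral μ) {z : ℂ} (hz : ‖z‖ = 1) : S.a.eval z ≠ 0 := by
  intro h0
  have hz0 : z ≠ 0 := norm_pos_iff.1 (by rw [hz]; exact one_pos)
  have hcirc : ∀ θ : ℝ, ‖z * Complex.exp (θ * Complex.I)‖ = 1 := fun θ => by
    rw [norm_mul, hz, Complex.norm_exp_ofReal_mul_I, one_mul]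
  choose x hx0 hx using fun θ : ℝ => hS.a_nonneg _ (hcirc θ)
  have hd : HasDerivAt (fun θ : ℝ => z * Complex.exp (θ * Complex.I)) (z * Complex.I) 0 := by
    have := (((Complex.ofRealCLM.hasDerivAt (x := 0)).mul_const Complex.I).cexp).const_mul z
    simpa using this
  have e0 : z * Complex.exp ((0 : ℝ) * Complex.I) = z := by simp
  have h1 : HasDerivAt (fun θ : ℝ => (z * Complex.exp (θ * Complex.I))⁻¹ ^ g *
      S.a.eval (z * Complex.exp (θ * Complex.I)))
      (z⁻¹ ^ g * ((derivative S.a).eval z * (z * Complex.I))) 0 := by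
    have ha := (S.a.hasDerivAt (z * Complex.exp ((0 : ℝ) * Complex.I))).comp (0 : ℝ) hd
    have hi := (hd.fun_inv (by rw [e0]; exact hz0)).fun_pow g
    have := hi.fun_mul ha
    simp only [Function.comp_apply, e0, h0, mul_zero, zero_add] at this
    exact this
  simp only [hx] at h1
  have hre : HasDerivAt x (z⁻¹ ^ g * ((derivative S.a).eval z * (z * Complex.I))).re 0 := by
    have := Complex.reCLM.hasFDerivAt.comp_hasDerivAt (0 : ℝ) h1
    simpa [Function.comp_def] using this
  have him : HasDerivAt (fun _ : ℝ => (0 : ℝ))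
      (z⁻¹ ^ g * ((derivative S.a).eval z * (z * Complex.I))).im 0 := by
    have := Complex.imCLM.hasFDerivAt.comp_hasDerivAt (0 : ℝ) h1
    simpa [Function.comp_def] using this
  have hx00 : x 0 = 0 := by
    have := hx 0
    rw [e0, h0, mul_zero] at this
    exact_mod_cast this.symm
  have hmin : IsLocalMin x 0 := Eventually.of_forall fun θ => by rw [hx00]; exact hx0 θ
  have k1 := hmin.hasDerivAt_eq_zero hre
  have k2 := him.unique (hasDerivAt_const 0 (0 : ℝ))
  have k3 : z⁻¹ ^ g * ((derivative S.a).eval z * (z * Complex.I)) = 0 := Complex.ext k1 k2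
  have k4 : (derivative S.a).eval z = 0 := by
    simpa [hz0] using k3
  exact hS.a_simple.eval₂_derivative_ne_zero (RingHom.id ℂ) h0 k4

theorem IsSpectral.sym_mem_regularSet {S : SpectralData g} {μ : Fin 2 → ℂ × ℂ → ℂ}
    (hS : S.IsSpectral μ) (j : Fin 2) : S.sym j ∈ S.regularSet :=
  ⟨hS.isReal.sym_ne_zero j, hS.eval_a_ne_zero (hS.sym_norm j)⟩

/-- The middle coefficient of `a` is the mean of `λ⁻ᵍ a(λ)` over the roots of unity of order
`2 g + 1`. -/
theorem sum_primitiveRoot {S : SpectralData g} {ζ : ℂ} (hζ : IsPrimitiveRoot ζ (2 * g + 1)) :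
    ∑ k ∈ Finset.range (2 * g + 1), ((ζ ^ k)⁻¹) ^ g * S.a.eval (ζ ^ k) =
      (2 * g + 1 : ℕ) * S.a.coeff g := by
  have hζ0 : ζ ≠ 0 := hζ.ne_zero (by omega)
  have h1 : ∀ k, ((ζ ^ k)⁻¹) ^ g * S.a.eval (ζ ^ k) =
      ∑ j ∈ Finset.range (2 * g + 1), S.a.coeff j * (ζ ^ j * (ζ ^ g)⁻¹) ^ k := by
    intro k
    rw [eval_eq_sum_range' (Nat.lt_succ_of_le S.a_natDegree_le), Finset.mul_sum]
    refine Finset.sum_congr rfl fun j _ => ?_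
    rw [mul_pow, inv_pow, inv_pow, ← pow_mul, ← pow_mul, ← pow_mul, ← pow_mul, mul_comm k g,
      mul_comm k j]
    ring
  simp only [h1]
  rw [Finset.sum_comm, Finset.sum_eq_single g]
  · rw [mul_inv_cancel₀ (pow_ne_zero _ hζ0)]
    simp [mul_comm]
  · intro j hj hjg
    rw [← Finset.mul_sum]
    have hne : ζ ^ j * (ζ ^ g)⁻¹ ≠ 1 := by
      intro h
      rw [mul_inv_eq_one₀ (pow_ne_zero _ hζ0)] at h
      exact hjg (hζ.pow_inj (Finset.mem_range.1 hj) (by omega) h)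
    have hpow : (ζ ^ j * (ζ ^ g)⁻¹) ^ (2 * g + 1) = 1 := by
      rw [mul_pow, inv_pow, ← pow_mul, ← pow_mul, mul_comm j, mul_comm g, pow_mul, pow_mul ζ,
        hζ.pow_eq_one]
      simp
    rw [geom_sum_eq hne, hpow, sub_self, zero_div, mul_zero]
  · intro h
    exact absurd (Finset.mem_range.2 (by omega)) h

/-- The middle coefficient of `a` is positive, as a mean of positive values on the unit circle.
Therefore it can be used to normalize the rescalings of `ν`. -/
theorem IsSpectral.exists_pos_mid {S : SpectralData g} {μ : Fin 2 → ℂ × ℂ → ℂ}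
    (hS : S.IsSpectral μ) : ∃ x : ℝ, 0 < x ∧ S.a.coeff g = x := by
  have hζ := Complex.isPrimitiveRoot_exp (2 * g + 1) (by omega)
  set ζ := Complex.exp (2 * Real.pi * Complex.I / (2 * g + 1 : ℕ)) with hζd
  have hn : ∀ k : ℕ, ‖ζ ^ k‖ = 1 := fun k => by
    rw [norm_pow, hζ.norm'_eq_one (by omega), one_pow]
  choose x hx0 hx using fun k : ℕ => hS.a_nonneg _ (hn k)
  have hpos : ∀ k, 0 < x k := by
    intro k
    refine lt_of_le_of_ne (hx0 k) fun h => ?_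
    have h1 := hx k
    rw [← h, Complex.ofReal_zero, mul_eq_zero] at h1
    have h2 : ζ ^ k ≠ 0 := norm_pos_iff.1 (by rw [hn]; exact one_pos)
    rcases h1 with h1 | h1
    · exact pow_ne_zero _ (inv_ne_zero h2) h1
    · exact hS.eval_a_ne_zero (hn k) h1
  have hsum := sum_primitiveRoot (S := S) hζ
  simp only [hx] at hsum
  refine ⟨(∑ k ∈ Finset.range (2 * g + 1), x k) / (2 * g + 1 : ℕ), ?_, ?_⟩
  · refine div_pos (Finset.sum_pos (fun k _ => hpos k) ⟨0, by simp⟩) (by positivity)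
  · rw [Complex.ofReal_div, Complex.ofReal_sum, hsum]
    have : ((2 * g + 1 : ℕ) : ℂ) ≠ 0 := by exact_mod_cast (2 * g).succ_ne_zero
    rw [Complex.ofReal_natCast, mul_div_cancel_left₀ _ this]

/-- The spectral data of a cmc torus for which `d ln μ₁` and `d ln μ₂` have no common roots satisfy the
algebraic conditions under which the linearized system is bijective. -/
theorem IsSpectral.regular {S : SpectralData g} {μ : Fin 2 → ℂ × ℂ → ℂ}
    (hS : S.IsSpectral μ) (h : S.NoCommonRoots) : S.Regular where
  lead := hS.a_degree
  const := hS.isReal.coeff_zero_ne_zero hS.a_degree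
  mid := by
    obtain ⟨x, hx, he⟩ := hS.exists_pos_mid
    rw [he]
    exact_mod_cast hx.ne'
  separable := hS.a_simple
  a_sym j := hS.eval_a_ne_zero (hS.sym_norm j)
  sym_ne := hS.sym_ne
  sym_ne_zero := hS.isReal.sym_ne_zero
  b_lead i := hS.indep_minus.ne_zero i
  coprime := by
    rw [isCoprime_iff_aeval_ne_zero_of_isAlgClosed ℂ ℂ]
    intro z
    simp only [coe_aeval_eq_eval]
    by_cases hz : z = 0
    · left
      rw [hz, ← coeff_zero_eq_eval_zero]
      exact hS.indep_plus.ne_zero 0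
    · by_contra! h0
      obtain ⟨n, hn⟩ := IsAlgClosed.exists_pow_nat_eq (z * S.a.eval z) two_pos
      exact h (z, n) ⟨hz, hn⟩ ⟨by simp [logForm, h0.1], by simp [logForm, h0.2]⟩

/-- The velocity of a smooth family of spectral data of cmc tori comes from an infinitesimal
deformation. -/
theorem _root_.IsSmoothSpectralFamily.exists_variation {δ : ℝ} {E : ℝ → SpectralData g}
    (hE : IsSmoothSpectralFamily δ E) {s₀ : ℝ} (hs₀ : s₀ ∈ Ioo (-δ) δ) :
    ∃ v : Variation g, (E s₀).velocity v = deriv E s₀ ∧ (E s₀).IsInfinitesimal v := by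
  obtain ⟨-, hc, hsp⟩ := hE
  have hex : ∀ s, ∃ μ : Fin 2 → ℂ × ℂ → ℂ, s ∈ Ioo (-δ) δ → (E s).IsSpectral μ := by
    intro s
    by_cases hs : s ∈ Ioo (-δ) δ
    · obtain ⟨μ, hμ⟩ := hsp s hs
      exact ⟨μ, fun _ => hμ⟩
    · exact ⟨fun _ _ => 0, fun h => absurd h hs⟩
  choose m hm using hex
  have hnhds := isOpen_Ioo.mem_nhds hs₀
  have hmem : ∀ᶠ s in 𝓝 s₀, s ∈ Ioo (-δ) δ := hnhds
  refine SpectralData.exists_variation (E' := deriv E) (m := m) (fun i => ?_)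
    (hm s₀ hs₀).sym_mem_regularSet fun i j => ?_
  · refine ⟨?_, ?_, ?_, ?_, ?_, ?_, ?_⟩
    · filter_upwards [hmem] with s hs
      exact ((hc.contDiffAt (isOpen_Ioo.mem_nhds hs)).differentiableAt (by simp)).hasDerivAt
    · filter_upwards [hmem] with s hs
      exact (hc.continuousOn_deriv_of_isOpen isOpen_Ioo (by simp)).continuousAt
        (isOpen_Ioo.mem_nhds hs)
    · exact hmem.mono fun s hs => (hm s hs).mu_log i
    · exact hmem.mono fun s hs => (hm s hs).mu_hyp i
    · exact hmem.mono fun s hs => (hm s hs).mu_eta i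
    · exact hmem.mono fun s hs => (hm s hs).isReal
    · exact separable_X_mul (hm s₀ hs₀).a_simple
        ((hm s₀ hs₀).isReal.coeff_zero_ne_zero (hm s₀ hs₀).a_degree)
  · filter_upwards [hmem] with s hs p hp hps
    rcases (hm s hs).closing i j p hp hps with h | h <;> rw [h] <;> norm_num

end SpectralData

end

section
open Polynomial Set Filter Topology
namespace SpectralData

variable {g : ℕ}

/-! ### The integral curve -/

theorem eventually_Ioo_of_nhds {p : ℝ → Prop} (h : ∀ᶠ s in 𝓝 (0 : ℝ), p s) {δ : ℝ} (hδ : 0 < δ) :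
    ∃ δ' : ℝ, 0 < δ' ∧ δ' ≤ δ ∧ ∀ s ∈ Ioo (-δ') δ', p s := by
  obtain ⟨r, hr, h1⟩ := Metric.eventually_nhds_iff_ball.1 h
  refine ⟨min r δ, lt_min hr hδ, min_le_right _ _, fun s hs => h1 s ?_⟩
  rw [Real.ball_eq_Ioo]
  constructor <;> [have := hs.1; have := hs.2] <;> have := min_le_left r δ <;> linarith

/-- A curve with velocity the normalized infinitesimal deformation, near given spectral data. -/
theorem exists_integralCurve {S : SpectralData g} (hb : Function.Bijective S.linearization)
    (hS : S.IsReal) {P : SpectralData g → Prop} (hP : ∀ᶠ T in 𝓝 S, P T) :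
    ∃ ε > 0, ∃ D : ℝ → SpectralData g, D 0 = S ∧ ContDiffOn ℝ ∞ D (Ioo (-ε) ε) ∧
      ∀ t ∈ Ioo (-ε) ε, P (D t) ∧ Function.Bijective (D t).linearization ∧ (D t).IsReal ∧
        HasDerivAt D ((D t).velocity (D t).unitVar) t := by
  obtain ⟨D, hD0, ε₀, hε₀, hD⟩ :=
    ((contDiffAt_field hb).of_le (by exact_mod_cast le_top)
      ).exists_forall_mem_closedBall_exists_eq_forall_mem_Ioo_hasDerivAt₀ 0
  rw [zero_sub, zero_add] at hD
  have hc : ContinuousAt D 0 := (hD 0 ⟨by linarith, hε₀⟩).continuousAt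
  have hev : ∀ᶠ t in 𝓝 (0 : ℝ), P (D t) ∧ Function.Bijective (D t).linearization := by
    have := (hP.and (eventually_bijective hb))
    rw [← hD0] at this
    exact hc.eventually this
  obtain ⟨ε, hε, hε', h1⟩ := eventually_Ioo_of_nhds hev hε₀
  have hD' : ∀ t ∈ Ioo (-ε) ε, HasDerivAt D (D t).field t := fun t ht =>
    hD t ⟨by linarith [ht.1], by linarith [ht.2]⟩
  have hreal := isReal_of_hasDerivAt_field hD' (hD0.symm ▸ hS)
  refine ⟨ε, hε, D, hD0, ?_, fun t ht => ⟨(h1 t ht).1, (h1 t ht).2, hreal t ht, ?_⟩⟩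
  · rw [contDiffOn_infty]
    intro n
    induction n with
    | zero =>
      exact contDiffOn_zero.2 fun t ht => (hD' t ht).continuousAt.continuousWithinAt
    | succ n ih =>
      rw [Nat.cast_succ, contDiffOn_succ_iff_deriv_of_isOpen isOpen_Ioo]
      refine ⟨fun t ht => (hD' t ht).differentiableAt.differentiableWithinAt,
        fun h => absurd h (by simp), ?_⟩
      have : ContDiffOn ℝ n (fun t => (D t).field) (Ioo (-ε) ε) := fun t ht =>
        ContDiffAt.comp_contDiffWithinAt t
          ((contDiffAt_field (h1 t ht).2).of_le (by exact_mod_cast le_top)) (ih t ht)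
      exact this.congr fun t ht => (hD' t ht).deriv
  · rw [← (hreal t ht).field_eq (h1 t ht).2]
    exact hD' t ht

theorem transform_one_zero (S : SpectralData g) : S.transform 1 0 = S := by
  simp [transform]

theorem deriv_transform_orbit (S : SpectralData g) (x y : ℝ) :
    deriv (fun s : ℝ => S.transform (Real.exp (x * s)) (y * s)) 0 =
      S.velocity ((x : ℂ) • S.scaleVar + (y : ℂ) • S.rotVar) := by
  have hr : HasDerivAt (fun s : ℝ => Real.exp (x * s)) (x * Real.exp (x * 0)) 0 := by
    have := ((hasDerivAt_id (0 : ℝ)).const_mul x).exp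
    convert! this using 1
    simp
  have hθ : HasDerivAt (fun s : ℝ => y * s) y 0 := by
    simpa using (hasDerivAt_id (0 : ℝ)).const_mul y
  have h := (hasDerivAt_transform (hasDerivAt_const (0 : ℝ) S) hr hθ).deriv
  rw [h, mul_zero, mul_zero, Real.exp_zero, transform_one_zero, transform_one_zero, zero_add]

theorem eq_zero_of_velocity_eq {S : SpectralData g} (hs : ∀ j, S.sym j ≠ 0) {v w : Variation g}
    (h : S.velocity v = S.velocity w) : v.1 = w.1 := by
  have h1 := congrArg (fun T : SpectralData g => T.1) h
  have h2 := congrArg (fun T : SpectralData g => T.2.1) h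
  refine Prod.ext h1 (Prod.ext h2 ?_)
  funext j
  have h3 := congrArg (fun T : SpectralData g => T.2.2 j) h
  exact mul_right_cancel₀ (hs j) h3

/-- The normalized infinitesimal deformation changes the spectral data. -/
theorem unitVar_data_ne_zero {S : SpectralData g} (hb : Function.Bijective S.linearization)
    (hlead : S.a.coeff (2 * g) ≠ 0) (hu : S.unitSpeed ≠ 0) : S.unitVar.1 ≠ 0 := by
  intro h0
  obtain ⟨h1, h2, -, -⟩ := (S.isUnitVariation_iff _).1 (isUnitVariation_unitVar hb)
  have ha : S.unitVar.1.a = 0 := by rw [h0]; exact coeffPoly_zero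
  have hbz : ∀ i, S.unitVar.1.b i = 0 := by intro i; rw [h0]; exact coeffPoly_zero
  have hc := c_eq_zero_of_velocity_eq_zero hlead h1.1 ha hbz
  refine hu ?_
  rw [← h2, speed, wronski, hc, hc]
  simp

/-- The normalized infinitesimal deformation is not tangent to the orbit of the coordinate
changes. -/
theorem velocity_unitVar_ne {S : SpectralData g} (hb : Function.Bijective S.linearization)
    (hlead : S.a.coeff (2 * g) ≠ 0) (hmid : S.a.coeff g ≠ 0) (hu : S.unitSpeed ≠ 0)
    (hs : ∀ j, S.sym j ≠ 0) (x y : ℝ) :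
    S.velocity S.unitVar ≠ deriv (fun s : ℝ => S.transform (Real.exp (x * s)) (y * s)) 0 := by
  rw [deriv_transform_orbit]
  intro h
  have h1 := eq_zero_of_velocity_eq hs h
  obtain ⟨-, -, h2, h3⟩ := (S.isUnitVariation_iff _).1 (isUnitVariation_unitVar hb)
  rw [h1] at h2 h3
  have hy : (y : ℂ) = 0 := by
    have : ((x : ℂ) • S.scaleVar + (y : ℂ) • S.rotVar).1.sym 0 = (y : ℂ) * Complex.I := by
      simp [rotVar, scaleVar, sym]
    rw [this] at h2
    simpa using h2
  have hx : (x : ℂ) = 0 := by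
    rw [hy, zero_smul, add_zero] at h3
    have : ((x : ℂ) • S.scaleVar).1.a.coeff g = x * (2 * S.a.coeff g) := by
      rw [Prod.smul_fst, a_smul, coeff_C_mul, scaleVar_a, coeff_C_mul]
    rw [this] at h3
    simpa [hmid] using h3
  rw [hx, hy, zero_smul, zero_smul, add_zero] at h1
  exact unitVar_data_ne_zero hb hlead hu h1

end SpectralData

end

section
open Polynomial Set Filter Topology
namespace SpectralData

variable {g : ℕ}

/-! ### Uniqueness of the family up to coordinate changes -/

/-- The velocity of spectral data with the velocities of the sym points replaced by their
logarithmic derivatives. -/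
def logData (S T : SpectralData g) : SpectralData g := (T.1, T.2.1, fun j => T.2.2 j / S.2.2 j)

/-- The real structure on the data parts of the variations. -/
def dataFlip (d : SpectralData g) : SpectralData g := (flip (d, 0)).1

theorem dataFlip_add (d e : SpectralData g) : dataFlip (d + e) = dataFlip d + dataFlip e := by
  refine Prod.ext ?_ (Prod.ext ?_ ?_) <;> funext i
  · simp [dataFlip, flip, revConj]
  · funext k; simp [dataFlip, flip, revConj]
  · simp [dataFlip, flip, add_comm]

theorem dataFlip_smul (z : ℂ) (d : SpectralData g) : dataFlip (z • d) = conj z • dataFlip d := by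
  refine Prod.ext ?_ (Prod.ext ?_ ?_) <;> funext i
  · simp [dataFlip, flip, revConj]
  · funext k; simp [dataFlip, flip, revConj]
  · simp [dataFlip, flip]

theorem IsReal.dataFlip_scaleVar {S : SpectralData g} (hS : S.IsReal) :
    dataFlip S.scaleVar.1 = S.scaleVar.1 := by
  obtain ⟨h1, h2, -⟩ := (isReal_iff S).1 hS
  refine Prod.ext ?_ (Prod.ext ?_ ?_) <;> funext i
  · have := congrFun h1 i
    simp only [revConj] at this
    simp only [dataFlip, flip, revConj, scaleVar, map_mul, map_ofNat, this]
  · exact h2 i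
  · simp [dataFlip, flip, scaleVar]

theorem IsReal.dataFlip_rotVar {S : SpectralData g} (hS : S.IsReal) :
    dataFlip S.rotVar.1 = S.rotVar.1 := by
  obtain ⟨h1, h2, -⟩ := (isReal_iff S).1 hS
  refine Prod.ext ?_ (Prod.ext ?_ ?_) <;> funext i
  · have := congrFun h1 i
    simp only [revConj] at this
    have hk : (Fin.rev i : ℕ) + i = 2 * g := by have := i.2; rw [Fin.val_rev]; omega
    have hk' : ((Fin.rev i : ℕ) : ℂ) = 2 * g - (i : ℕ) := by
      rw [eq_sub_iff_add_eq]; exact_mod_cast hk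
    simp only [dataFlip, flip, revConj, rotVar, map_mul, map_sub, map_ofNat, Complex.conj_I,
      Complex.conj_natCast, this, hk']
    ring
  · funext k
    have := congrFun (h2 i) k
    simp only [revConj] at this
    have hk : (Fin.rev k : ℕ) + k = g + 1 := by have := k.2; rw [Fin.val_rev]; omega
    have hk' : ((Fin.rev k : ℕ) : ℂ) = g + 1 - (k : ℕ) := by
      rw [eq_sub_iff_add_eq]; exact_mod_cast hk
    simp only [dataFlip, flip, revConj, rotVar, map_mul, map_sub, map_div₀, map_add, map_one,
      map_ofNat, Complex.conj_I, Complex.conj_natCast, this, hk']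
    ring
  · simp [dataFlip, flip, rotVar]

/-- The velocity of a family of real spectral data is real. -/
theorem dataFlip_logData {E : ℝ → SpectralData g} {E' : SpectralData g} {s : ℝ}
    (hE : HasDerivAt E E' s) (hreal : ∀ᶠ s in 𝓝 s, (E s).IsReal) :
    dataFlip (logData (E s) E') = logData (E s) E' := by
  have key : ∀ {n : ℕ} {c : ℝ → Fin n → ℂ} {c' : Fin n → ℂ}, HasDerivAt c c' s →
      (∀ᶠ s in 𝓝 s, revConj (c s) = c s) → revConj c' = c' := fun hc h =>
    ((hasDerivAt_revConj hc).congr_of_eventuallyEq (h.mono fun _ hs => hs.symm)).unique hc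
  refine Prod.ext ?_ (Prod.ext ?_ ?_)
  · exact key hE.fst (hreal.mono fun s hs => ((isReal_iff _).1 hs).1)
  · funext i
    exact key (hasDerivAt_pi.1 hE.snd.fst i) (hreal.mono fun s hs => ((isReal_iff _).1 hs).2.1 i)
  · funext j
    have h1 := hasDerivAt_pi.1 hE.snd.snd j
    have h2 : HasDerivAt (fun s => conj ((E s).2.2 j)) (conj (E'.2.2 j)) s :=
      Complex.conjCLE.hasFDerivAt.comp_hasDerivAt s h1
    have h3 : (fun s => (E s).2.2 j * conj ((E s).2.2 j)) =ᶠ[𝓝 s] fun _ => 1 := by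
      filter_upwards [hreal] with s hs
      rw [Complex.mul_conj, Complex.normSq_eq_norm_sq, ((isReal_iff _).1 hs).2.2 j]
      simp
    have h4 := (h1.fun_mul h2).unique ((hasDerivAt_const s (1 : ℂ)).congr_of_eventuallyEq h3)
    have h5 : (E s).2.2 j ≠ 0 := hreal.self_of_nhds.sym_ne_zero j
    have h6 : conj ((E s).2.2 j) ≠ 0 := by simpa using h5
    simp only [dataFlip, flip, logData, map_div₀]
    field_simp
    linear_combination -h4

/-- The velocity of the angle of the first sym point. -/
def rotSpeed (S T : SpectralData g) : ℝ := (T.2.2 0 / S.2.2 0).im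

/-- The logarithmic velocity of the middle coefficient of `a`, halved. -/
def scaleSpeed (S T : SpectralData g) : ℝ := (T.a.coeff g / (2 * S.a.coeff g)).re

/-- The velocity of a family, from which a rotation and a rescaling are subtracted. -/
def reducedData (S T : SpectralData g) : SpectralData g :=
  logData S T - ((scaleSpeed S T : ℂ) • S.scaleVar.1 + (rotSpeed S T : ℂ) • S.rotVar.1)

theorem dataFlip_eq_mul {d : SpectralData g} {x : ℂ} (h0 : d ≠ 0)
    (hd : dataFlip d = d) (h : dataFlip (x • d) = x • d) : (x.re : ℂ) = x := by
  rw [dataFlip_smul, hd] at h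
  exact Complex.conj_eq_iff_re.1 (smul_left_injective ℂ h0 h)

/-- The reduced velocity is a real multiple of the normalized infinitesimal deformation. -/
theorem exists_reducedData_eq {E : ℝ → SpectralData g} {E' : SpectralData g} {s : ℝ}
    (hE : HasDerivAt E E' s) (hreal : ∀ᶠ s in 𝓝 s, (E s).IsReal)
    (hb : Function.Bijective (E s).linearization) (hlead : (E s).a.coeff (2 * g) ≠ 0)
    (hmid : (E s).a.coeff g ≠ 0) (hu : (E s).unitSpeed ≠ 0)
    (hv : ∃ v : Variation g, (E s).velocity v = E' ∧ (E s).IsInfinitesimal v) :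
    ∃ x : ℝ, reducedData (E s) E' = (x : ℂ) • (E s).unitVar.1 := by
  obtain ⟨v, hvE, hvi⟩ := hv
  have hr := hreal.self_of_nhds
  have hlog := dataFlip_logData hE hreal
  have hv1 : v.1 = logData (E s) E' := by
    refine eq_zero_of_velocity_eq (v := v) (w := (logData (E s) E', 0)) hr.sym_ne_zero ?_
    rw [hvE]
    refine Prod.ext rfl (Prod.ext rfl ?_)
    funext j
    exact (div_mul_cancel₀ _ (hr.sym_ne_zero j)).symm
  set w := scaleSpeed (E s) E' with hw
  set y := rotSpeed (E s) E' with hy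
  have hy0 : (logData (E s) E').sym 0 = y * Complex.I := by
    have h1 := congrArg (fun d : SpectralData g => d.2.2 0) hlog
    simp only [dataFlip, flip] at h1
    change (logData (E s) E').2.2 0 = _
    have h2 : ((logData (E s) E').2.2 0).re = 0 := by
      have := congrArg Complex.re h1
      simp only [Complex.neg_re, Complex.conj_re] at this
      linarith
    refine Complex.ext ?_ ?_
    · simp [h2]
    · simp [hy, rotSpeed, logData]
  have hw0 : E'.a.coeff g = w * (2 * (E s).a.coeff g) := by
    have ha : conj (E'.a.coeff g) = E'.a.coeff g := by
      have h1 := congrArg (fun d : SpectralData g => d.a.coeff g) hlog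
      have h2 : (dataFlip (logData (E s) E')).a = conjRev (2 * g) E'.a := coeffPoly_revConj _
      simp only [h2] at h1
      rw [coeff_conjRev_of_le _ (by omega), show 2 * g - g = g by omega] at h1
      exact h1
    have hc : conj ((E s).a.coeff g) = (E s).a.coeff g := by
      have := hr.coeff_a (k := g) (by omega)
      rwa [show 2 * g - g = g by omega] at this
    have h3 : (w : ℂ) = E'.a.coeff g / (2 * (E s).a.coeff g) := by
      rw [hw, scaleSpeed]
      refine Complex.conj_eq_iff_re.1 ?_
      rw [map_div₀, map_mul, ha, hc, map_ofNat]
    rw [h3]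
    field_simp
  set u : Variation g := v - ((w : ℂ) • (E s).scaleVar + (y : ℂ) • (E s).rotVar) with hu'
  have hu1 : u.1 = reducedData (E s) E' := by
    rw [hu', reducedData, Prod.fst_sub, hv1]; rfl
  have hlin : ∀ d, (E s).IsInfinitesimal d → (E s).linearization d =
      (0, 0, (speed (E s) d, d.1.sym 0, d.1.a.coeff g)) := fun d hd =>
    (linearization_eq_iff _ _ _ _ _).2 ⟨hd, rfl, rfl, rfl⟩
  have hLu : ∃ z : ℂ, (E s).linearization u = (0, 0, (z, 0, 0)) := by
    rw [hu', map_sub, map_add, map_smul, map_smul, hlin v hvi, hlin _ (isInfinitesimal_scaleVar _),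
      hlin _ (isInfinitesimal_rotVar _), hv1]
    have e1 : (logData (E s) E').a.coeff g = E'.a.coeff g := rfl
    have e2 : (E s).rotVar.1.a.coeff g = 0 := by
      rw [rotVar_a, coeff_C_mul, coeff_sub, coeff_C_mul, coeff_X_mul_derivative]
      ring
    have e3 : (E s).scaleVar.1.a.coeff g = 2 * (E s).a.coeff g := by
      rw [scaleVar_a, coeff_C_mul]
    have e4 : (E s).rotVar.1.sym 0 = Complex.I := rfl
    have e5 : (E s).scaleVar.1.sym 0 = 0 := rfl
    rw [hy0, e1, hw0, e2, e3, e4, e5]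
    refine ⟨speed (E s) v - (w * speed (E s) (E s).scaleVar + y * speed (E s) (E s).rotVar),
      Prod.ext ?_ (Prod.ext ?_ (Prod.ext ?_ (Prod.ext ?_ ?_)))⟩
    · simp
    · simp
    · rfl
    · simp
    · simp
  obtain ⟨z, hz⟩ := hLu
  have hunit : (E s).linearization (E s).unitVar = _ := isUnitVariation_unitVar hb
  have hux : u = (z / (E s).unitSpeed) • (E s).unitVar := by
    refine hb.1 ?_
    rw [hz, map_smul, hunit]
    simp [hu]
  have hne := unitVar_data_ne_zero hb hlead hu
  have hflip : dataFlip (E s).unitVar.1 = (E s).unitVar.1 := by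
    have := congrArg Prod.fst (hr.flip_eq hb (isUnitVariation_unitVar hb))
    exact this
  have hu1' : u.1 = (z / (E s).unitSpeed) • (E s).unitVar.1 := by rw [hux]; rfl
  refine ⟨(z / (E s).unitSpeed).re, ?_⟩
  rw [dataFlip_eq_mul hne hflip ?_, ← hu1', hu1]
  rw [← hu1', hu1, reducedData, sub_eq_add_neg, ← neg_one_smul ℂ, dataFlip_add, dataFlip_smul,
    dataFlip_add, dataFlip_smul, dataFlip_smul, hlog, hr.dataFlip_scaleVar, hr.dataFlip_rotVar]
  simp

end SpectralData

end

section
open Polynomial Set Filter Topology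
namespace SpectralData

variable {g : ℕ}

/-! ### The reparametrization -/

theorem exists_smooth_primitive {f : ℝ → ℝ} {δ : ℝ} (hf : ContDiffOn ℝ ∞ f (Ioo (-δ) δ)) :
    ∃ F : ℝ → ℝ, F 0 = 0 ∧ ContDiffOn ℝ ∞ F (Ioo (-δ) δ) ∧
      ∀ s ∈ Ioo (-δ) δ, HasDerivAt F (f s) s := by
  have hd : ∀ s ∈ Ioo (-δ) δ, HasDerivAt (fun s => ∫ u in (0 : ℝ)..s, f u) (f s) s := by
    intro s hs
    have h0 : (0 : ℝ) ∈ Ioo (-δ) δ := ⟨by linarith [hs.1, hs.2], by linarith [hs.1, hs.2]⟩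
    have hsub : uIcc 0 s ⊆ Ioo (-δ) δ := by
      intro u hu
      rw [mem_uIcc] at hu
      rcases hu with hu | hu
      · exact ⟨by linarith [hu.1, h0.1], by linarith [hu.2, hs.2]⟩
      · exact ⟨by linarith [hu.1, hs.1], by linarith [hu.2, h0.2]⟩
    exact intervalIntegral.integral_hasDerivAt_right
      (hf.continuousOn.mono hsub).intervalIntegrable
      (hf.continuousOn.stronglyMeasurableAtFilter isOpen_Ioo s hs)
      (hf.continuousOn.continuousAt (isOpen_Ioo.mem_nhds hs))
  refine ⟨fun s => ∫ u in (0 : ℝ)..s, f u, intervalIntegral.integral_same, ?_, hd⟩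
  rw [contDiffOn_infty_iff_deriv_of_isOpen isOpen_Ioo]
  exact ⟨fun s hs => (hd s hs).differentiableAt.differentiableWithinAt,
    hf.congr fun s hs => (hd s hs).deriv⟩

theorem contDiff_scaleVar : ContDiff ℝ ∞ (scaleVar (g := g)) := by
  unfold scaleVar; fun_prop

theorem contDiff_rotVar : ContDiff ℝ ∞ (rotVar (g := g)) := by
  unfold rotVar; fun_prop

theorem contDiff_ofReal : ContDiff ℝ ∞ (fun x : ℝ => (x : ℂ)) := Complex.ofRealCLM.contDiff

theorem contDiffAt_rotSpeed {E F : ℝ → SpectralData g} {s : ℝ} (hE : ContDiffAt ℝ ∞ E s)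
    (hF : ContDiffAt ℝ ∞ F s) (h0 : (E s).sym 0 ≠ 0) :
    ContDiffAt ℝ ∞ (fun s => rotSpeed (E s) (F s)) s := by
  have hsym := (contDiff_sym (g := g) 0).restrict_scalars ℝ
  have h1 := ContDiffAt.comp s hsym.contDiffAt hE
  have h2 := ContDiffAt.comp s hsym.contDiffAt hF
  have h3 := h2.mul (h1.inv h0)
  exact Complex.imCLM.contDiff.contDiffAt.comp s h3

theorem contDiffAt_scaleSpeed {E F : ℝ → SpectralData g} {s : ℝ} (hE : ContDiffAt ℝ ∞ E s)
    (hF : ContDiffAt ℝ ∞ F s) (h0 : (E s).a.coeff g ≠ 0) :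
    ContDiffAt ℝ ∞ (fun s => scaleSpeed (E s) (F s)) s := by
  have ha := (smoothCoeffs_a (g := g) g).restrict_scalars ℝ
  have h1 := ContDiffAt.comp s ha.contDiffAt hE
  have h2 := ContDiffAt.comp s ha.contDiffAt hF
  have h3 := h2.mul ((contDiffAt_const.mul h1).inv (mul_ne_zero (two_ne_zero' ℂ) h0))
  exact Complex.reCLM.contDiff.contDiffAt.comp s h3

theorem contDiffAt_reducedData {E F : ℝ → SpectralData g} {s : ℝ} (hE : ContDiffAt ℝ ∞ E s)
    (hF : ContDiffAt ℝ ∞ F s) (h0 : (E s).a.coeff g ≠ 0) (h1 : ∀ j, (E s).sym j ≠ 0) :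
    ContDiffAt ℝ ∞ (fun s => reducedData (E s) (F s)) s := by
  have hlog : ContDiffAt ℝ ∞ (fun s => logData (E s) (F s)) s := by
    refine ContDiffAt.prodMk hF.fst (ContDiffAt.prodMk hF.snd.fst (contDiffAt_pi.2 fun j => ?_))
    have e1 := contDiffAt_pi.1 hE.snd.snd j
    have e2 := contDiffAt_pi.1 hF.snd.snd j
    exact e2.mul (e1.inv (h1 j))
  have hw := contDiff_ofReal.contDiffAt.comp s (contDiffAt_scaleSpeed hE hF h0)
  have hy := contDiff_ofReal.contDiffAt.comp s (contDiffAt_rotSpeed hE hF (h1 0))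
  have hs := ContDiffAt.comp s (contDiff_scaleVar (g := g)).contDiffAt hE
  have hr := ContDiffAt.comp s (contDiff_rotVar (g := g)).contDiffAt hE
  exact hlog.sub ((hw.smul hs.fst).add (hy.smul hr.fst))

theorem velocity_add (S : SpectralData g) (v w : Variation g) :
    S.velocity (v + w) = S.velocity v + S.velocity w := by
  refine Prod.ext rfl (Prod.ext rfl ?_)
  funext j
  exact add_mul _ _ _

theorem velocity_smul (S : SpectralData g) (z : ℂ) (v : Variation g) :
    S.velocity (z • v) = z • S.velocity v := by
  refine Prod.ext rfl (Prod.ext rfl ?_)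
  funext j
  exact mul_assoc _ _ _

theorem velocity_congr (S : SpectralData g) {v w : Variation g} (h : v.1 = w.1) :
    S.velocity v = S.velocity w := by
  rw [velocity, velocity, h]

theorem transform_real_smul (r θ x : ℝ) (T : SpectralData g) :
    (x • T).transform r θ = (x : ℂ) • T.transform r θ := by
  refine Prod.ext ?_ (Prod.ext ?_ ?_) <;> funext i
  · simp only [transform, Prod.smul_fst, Pi.smul_apply, Complex.real_smul, smul_eq_mul]
    ring
  · funext k
    simp only [transform, Prod.smul_fst, Prod.smul_snd, Pi.smul_apply, Complex.real_smul,
      smul_eq_mul]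
    ring
  · simp only [transform, Prod.smul_snd, Pi.smul_apply, Complex.real_smul, smul_eq_mul]
    ring

theorem continuousAt_transform {D : ℝ → SpectralData g} {r θ : ℝ → ℝ} {s : ℝ}
    (hD : ContinuousAt D s) (hr : ContinuousAt r s) (hθ : ContinuousAt θ s) :
    ContinuousAt (fun s => (D s).transform (r s) (θ s)) s := by
  have hr' : ContinuousAt (fun s => (r s : ℂ)) s := Complex.continuous_ofReal.continuousAt.comp hr
  have hθ' : ContinuousAt (fun s => (θ s : ℂ)) s := Complex.continuous_ofReal.continuousAt.comp hθ
  have he : ∀ z : ℂ, ContinuousAt (fun s => Complex.exp (z * θ s * Complex.I)) s := fun z =>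
    ((continuousAt_const.mul hθ').mul continuousAt_const).cexp
  refine ContinuousAt.prodMk (continuousAt_pi.2 fun k => ?_) (ContinuousAt.prodMk
    (continuousAt_pi.2 fun i => continuousAt_pi.2 fun k => ?_) (continuousAt_pi.2 fun j => ?_))
  · exact ((hr'.pow 2).mul (he _)).mul (continuousAt_pi.1 hD.fst k)
  · exact (hr'.mul (he _)).mul (continuousAt_pi.1 (continuousAt_pi.1 hD.snd.fst i) k)
  · have := (he 1).mul (continuousAt_pi.1 hD.snd.snd j)
    simp only [one_mul] at this
    exact this

theorem contDiffAt_velocity_comp {F : Type*} [NormedAddCommGroup F] [NormedSpace ℝ F]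
    {f : F → SpectralData g} {v : F → Variation g} {p : F} (hf : ContDiffAt ℝ ∞ f p)
    (hv : ContDiffAt ℝ ∞ v p) : ContDiffAt ℝ ∞ (fun p => (f p).velocity (v p)) p := by
  refine ContDiffAt.prodMk hv.fst.fst (ContDiffAt.prodMk hv.fst.snd.fst
    (contDiffAt_pi.2 fun j => ?_))
  exact (contDiffAt_pi.1 hv.fst.snd.snd j).mul (contDiffAt_pi.1 hf.snd.snd j)

/-- The velocity composed of the normalized infinitesimal deformation, the rescalings and the
rotations with the given speeds. -/
def drift (x W Y : ℝ → ℝ) (s : ℝ) (Z : SpectralData g) : SpectralData g :=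
  Z.velocity ((x s : ℂ) • Z.unitVar + ((W s : ℂ) • Z.scaleVar + (Y s : ℂ) • Z.rotVar))

theorem contDiffAt_drift_aux {F : Type*} [NormedAddCommGroup F] [NormedSpace ℝ F]
    {f : F → SpectralData g} {x W Y : F → ℂ} {p : F}
    (hb : Function.Bijective (f p).linearization) (hf : ContDiffAt ℝ ∞ f p)
    (hx : ContDiffAt ℝ ∞ x p) (hW : ContDiffAt ℝ ∞ W p) (hY : ContDiffAt ℝ ∞ Y p) :
    ContDiffAt ℝ ∞ (fun p => (f p).velocity
      (x p • (f p).unitVar + (W p • (f p).scaleVar + Y p • (f p).rotVar))) p := by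
  have h1 := ContDiffAt.comp p (contDiffAt_unitVar hb) hf
  have h2 := ContDiffAt.comp p (contDiff_scaleVar (g := g)).contDiffAt hf
  have h3 := ContDiffAt.comp p (contDiff_rotVar (g := g)).contDiffAt hf
  have k1 := hx.smul h1
  have k2 := hW.smul h2
  have k3 := hY.smul h3
  exact contDiffAt_velocity_comp hf (k1.add (k2.add k3))

theorem contDiffAt_drift {S : SpectralData g} (hb : Function.Bijective S.linearization)
    {x W Y : ℝ → ℝ} {s : ℝ} (hx : ContDiffAt ℝ ∞ x s) (hW : ContDiffAt ℝ ∞ W s)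
    (hY : ContDiffAt ℝ ∞ Y s) :
    ContDiffAt ℝ ∞ (fun p : ℝ × SpectralData g => drift x W Y p.1 p.2) (s, S) := by
  have hc : ∀ f : ℝ → ℝ, ContDiffAt ℝ ∞ f s →
      ContDiffAt ℝ ∞ (fun p : ℝ × SpectralData g => (f p.1 : ℂ)) (s, S) := fun f hf =>
    contDiff_ofReal.contDiffAt.comp (s, S) (hf.fst'')
  exact contDiffAt_drift_aux (p := (s, S)) hb contDiffAt_snd (hc x hx) (hc W hW) (hc Y hY)

/-- A function of two variables that is Lipschitz on a set is so in the second variable. -/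
theorem lipschitzOnWith_section {F : Type*} [PseudoEMetricSpace F] {G : ℝ → F → F} {K : NNReal}
    {V : Set (ℝ × F)} (h : LipschitzOnWith K (fun p : ℝ × F => G p.1 p.2) V) {s : ℝ} {Q : Set F}
    (hQ : ∀ Z ∈ Q, (s, Z) ∈ V) : LipschitzOnWith K (G s) Q := by
  intro Z hZ Z' hZ'
  have := h (hQ Z hZ) (hQ Z' hZ')
  simpa [Prod.edist_eq] using this

/-- Families of real spectral data whose velocities come from infinitesimal deformations are
obtained from an integral curve of the normalized infinitesimal deformation by a reparametrization
and coordinate changes, since both sides satisfy the same differential equation. -/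
theorem exists_reparametrization {S : SpectralData g} (hb : Function.Bijective S.linearization)
    (hlead : S.a.coeff (2 * g) ≠ 0) (hmid : S.a.coeff g ≠ 0)
    (hu : S.unitSpeed ≠ 0) {ε : ℝ} (hε : 0 < ε) {D : ℝ → SpectralData g} (hD0 : D 0 = S)
    (hD : ∀ t ∈ Ioo (-ε) ε, Function.Bijective (D t).linearization ∧
      HasDerivAt D ((D t).velocity (D t).unitVar) t)
    {δ : ℝ} (hδ : 0 < δ) {E : ℝ → SpectralData g} (hE : ContDiffOn ℝ ∞ E (Ioo (-δ) δ))
    (hE0 : E 0 = S) (hreal : ∀ s ∈ Ioo (-δ) δ, (E s).IsReal)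
    (hvar : ∀ s ∈ Ioo (-δ) δ, ∃ v : Variation g, (E s).velocity v = deriv E s ∧
      (E s).IsInfinitesimal v) :
    ∃ δ' : ℝ, 0 < δ' ∧ δ' ≤ δ ∧ ∃ τ r θ : ℝ → ℝ,
      ContDiffOn ℝ ∞ τ (Ioo (-δ') δ') ∧ ContDiffOn ℝ ∞ r (Ioo (-δ') δ') ∧
      ContDiffOn ℝ ∞ θ (Ioo (-δ') δ') ∧ τ 0 = 0 ∧ r 0 = 1 ∧ θ 0 = 0 ∧
      ∀ s ∈ Ioo (-δ') δ', τ s ∈ Ioo (-ε) ε ∧ 0 < r s ∧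
        E s = (D (τ s)).transform (r s) (θ s) := by
  -- a linear functional that detects the normalized infinitesimal deformation
  have hne := unitVar_data_ne_zero hb hlead hu
  obtain ⟨ℓ, -, hℓ⟩ := exists_dual_vector ℂ S.unitVar.1 (norm_ne_zero_iff.2 hne)
  have hℓ0 : ℓ S.unitVar.1 ≠ 0 := by
    rw [hℓ]; simpa using hne
  have hcoef : ∀ k, Continuous fun T : SpectralData g => T.a.coeff k := fun k =>
    (smoothCoeffs_a (g := g) k).continuous
  have hℓc : ContinuousAt (fun T : SpectralData g => ℓ T.unitVar.1) S :=
    ℓ.continuous.continuousAt.comp (contDiffAt_unitVar hb).continuousAt.fst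
  have hopen : ∀ᶠ T in 𝓝 S, Function.Bijective T.linearization ∧ T.a.coeff (2 * g) ≠ 0 ∧
      T.a.coeff g ≠ 0 ∧ T.unitSpeed ≠ 0 ∧ ℓ T.unitVar.1 ≠ 0 :=
    (eventually_bijective hb).and (((hcoef _).continuousAt.eventually_ne hlead).and
      (((hcoef _).continuousAt.eventually_ne hmid).and
      ((contDiff_unitSpeed.continuous.continuousAt.eventually_ne hu).and
      (hℓc.eventually_ne hℓ0))))
  have h0δ : (0 : ℝ) ∈ Ioo (-δ) δ := ⟨by linarith, hδ⟩
  have hEc : ContinuousAt E 0 := hE.continuousOn.continuousAt (isOpen_Ioo.mem_nhds h0δ)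
  obtain ⟨δ₁, hδ₁, hδ₁δ, hQ⟩ := eventually_Ioo_of_nhds
    (hEc.eventually (by rw [hE0]; exact hopen)) hδ
  have hsub₁ : Ioo (-δ₁) δ₁ ⊆ Ioo (-δ) δ := Ioo_subset_Ioo (by linarith) hδ₁δ
  have h0δ₁ : (0 : ℝ) ∈ Ioo (-δ₁) δ₁ := ⟨by linarith, hδ₁⟩
  have hEs : ∀ s ∈ Ioo (-δ) δ, ContDiffAt ℝ ∞ E s := fun s hs =>
    hE.contDiffAt (isOpen_Ioo.mem_nhds hs)
  have hE's : ∀ s ∈ Ioo (-δ) δ, ContDiffAt ℝ ∞ (deriv E) s := fun s hs =>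
    ((contDiffOn_infty_iff_deriv_of_isOpen isOpen_Ioo).1 hE).2.contDiffAt (isOpen_Ioo.mem_nhds hs)
  have hEd : ∀ s ∈ Ioo (-δ) δ, HasDerivAt E (deriv E s) s := fun s hs =>
    ((hEs s hs).differentiableAt (by simp)).hasDerivAt
  -- the speeds
  set W : ℝ → ℝ := fun s => scaleSpeed (E s) (deriv E s) with hW
  set Y : ℝ → ℝ := fun s => rotSpeed (E s) (deriv E s) with hY
  set x : ℝ → ℝ := fun s => (ℓ (reducedData (E s) (deriv E s)) * (ℓ (E s).unitVar.1)⁻¹).re with hx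
  have hWs : ContDiffOn ℝ ∞ W (Ioo (-δ₁) δ₁) := fun s hs =>
    (contDiffAt_scaleSpeed (hEs s (hsub₁ hs)) (hE's s (hsub₁ hs)) (hQ s hs).2.2.1).contDiffWithinAt
  have hYs : ContDiffOn ℝ ∞ Y (Ioo (-δ₁) δ₁) := fun s hs =>
    (contDiffAt_rotSpeed (hEs s (hsub₁ hs)) (hE's s (hsub₁ hs))
      ((hreal s (hsub₁ hs)).sym_ne_zero 0)).contDiffWithinAt
  have hℓs : ContDiff ℝ ∞ ℓ := (ℓ.contDiff (n := ∞)).restrict_scalars ℝ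
  have hxs : ContDiffOn ℝ ∞ x (Ioo (-δ₁) δ₁) := by
    intro s hs
    have h1 := contDiffAt_reducedData (hEs s (hsub₁ hs)) (hE's s (hsub₁ hs)) (hQ s hs).2.2.1
      (hreal s (hsub₁ hs)).sym_ne_zero
    have h2 := hℓs.contDiffAt.comp s h1
    have h3 := ContDiffAt.comp s (contDiffAt_unitVar (hQ s hs).1) (hEs s (hsub₁ hs))
    have h4 := hℓs.contDiffAt.comp s h3.fst
    exact (Complex.reCLM.contDiff.contDiffAt.comp s
      (h2.mul (h4.inv (hQ s hs).2.2.2.2))).contDiffWithinAt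
  have hdec : ∀ s ∈ Ioo (-δ₁) δ₁, reducedData (E s) (deriv E s) = (x s : ℂ) • (E s).unitVar.1 := by
    intro s hs
    obtain ⟨z, hz⟩ := exists_reducedData_eq (hEd s (hsub₁ hs))
      (by filter_upwards [isOpen_Ioo.mem_nhds (hsub₁ hs)] with u hu using hreal u hu)
      (hQ s hs).1 (hQ s hs).2.1 (hQ s hs).2.2.1 (hQ s hs).2.2.2.1 (hvar s (hsub₁ hs))
    have : x s = z := by
      simp only [hx]
      rw [hz, map_smul, smul_eq_mul, mul_assoc, mul_inv_cancel₀ (hQ s hs).2.2.2.2, mul_one,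
        Complex.ofReal_re]
    rw [this, hz]
  obtain ⟨τ, hτ0, hτs, hτd⟩ := exists_smooth_primitive hxs
  obtain ⟨θ, hθ0, hθs, hθd⟩ := exists_smooth_primitive hYs
  obtain ⟨ρ, hρ0, hρs, hρd⟩ := exists_smooth_primitive hWs
  -- the common differential equation
  set G : ℝ → SpectralData g → SpectralData g := drift x W Y with hG
  have hGs : ContDiffAt ℝ 1 (fun p : ℝ × SpectralData g => G p.1 p.2) (0, S) :=
    (contDiffAt_drift hb (hxs.contDiffAt (isOpen_Ioo.mem_nhds h0δ₁))
      (hWs.contDiffAt (isOpen_Ioo.mem_nhds h0δ₁))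
      (hYs.contDiffAt (isOpen_Ioo.mem_nhds h0δ₁))).of_le (by exact_mod_cast le_top)
  obtain ⟨K, V, hV, hLip⟩ := hGs.exists_lipschitzOnWith
  rw [nhds_prod_eq] at hV
  obtain ⟨p, hp, q, hq, hpq⟩ := Filter.mem_prod_iff.1 hV
  set Φ : ℝ → SpectralData g := fun s => (D (τ s)).transform (Real.exp (ρ s)) (θ s) with hΦ
  have h0ε : (0 : ℝ) ∈ Ioo (-ε) ε := ⟨by linarith, hε⟩
  have hτc : ContinuousAt τ 0 := (hτd 0 h0δ₁).continuousAt
  have hΦ0 : Φ 0 = S := by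
    simp only [hΦ, hτ0, hρ0, hθ0, hD0, Real.exp_zero, transform_one_zero]
  have hΦc : ContinuousAt Φ 0 := by
    have h1 : ContinuousAt (fun s => D (τ s)) 0 := by
      refine ContinuousAt.comp (g := D) ?_ hτc
      rw [hτ0]; exact (hD 0 h0ε).2.continuousAt
    exact continuousAt_transform h1 (hρd 0 h0δ₁).continuousAt.rexp (hθd 0 h0δ₁).continuousAt
  have hev : ∀ᶠ s in 𝓝 (0 : ℝ), s ∈ p ∧ E s ∈ q ∧ (Φ s ∈ q ∧ Function.Bijective (Φ s).linearization) ∧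
      τ s ∈ Ioo (-ε) ε := by
    have e1 : ∀ᶠ s in 𝓝 (0 : ℝ), E s ∈ q := hEc.eventually (by rw [hE0]; exact hq)
    have e2 : ∀ᶠ s in 𝓝 (0 : ℝ), Φ s ∈ q ∧ Function.Bijective (Φ s).linearization :=
      hΦc.eventually (by rw [hΦ0]; exact (Filter.Eventually.and hq (eventually_bijective hb)))
    have e3 : ∀ᶠ s in 𝓝 (0 : ℝ), τ s ∈ Ioo (-ε) ε :=
      hτc.eventually_mem (by rw [hτ0]; exact isOpen_Ioo.mem_nhds h0ε)
    exact Filter.Eventually.and hp (e1.and (e2.and e3))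
  obtain ⟨δ', hδ', hδ'₁, hfin⟩ := eventually_Ioo_of_nhds hev hδ₁
  have hsub : Ioo (-δ') δ' ⊆ Ioo (-δ₁) δ₁ := Ioo_subset_Ioo (by linarith) hδ'₁
  have heq : EqOn E Φ (Ioo (-δ') δ') := by
    refine ODE_solution_unique_of_mem_Ioo (v := G) (s := fun _ => q) (K := K) (t₀ := 0)
      (fun s hs => ?_) ⟨by linarith, hδ'⟩ (fun s hs => ⟨?_, (hfin s hs).2.1⟩)
      (fun s hs => ⟨?_, (hfin s hs).2.2.1.1⟩) (by rw [hE0, hΦ0])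
    · exact lipschitzOnWith_section hLip fun Z hZ => hpq ⟨(hfin s hs).1, hZ⟩
    · have h1 := hEd s (hsub₁ (hsub hs))
      refine h1.congr_deriv ?_
      have hr := hreal s (hsub₁ (hsub hs))
      have h2 := hdec s (hsub hs)
      rw [reducedData, sub_eq_iff_eq_add] at h2
      have h3 : (E s).velocity (logData (E s) (deriv E s), 0) = deriv E s := by
        refine Prod.ext rfl (Prod.ext rfl ?_)
        funext j
        exact div_mul_cancel₀ _ (hr.sym_ne_zero j)
      rw [← h3]
      exact velocity_congr _ h2
    · have hτε := (hfin s hs).2.2.2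
      have h1 := HasDerivAt.scomp s (hD (τ s) hτε).2 (hτd s (hsub hs))
      have hr' : HasDerivAt (fun s => Real.exp (ρ s)) (W s * Real.exp (ρ s)) s := by
        rw [mul_comm]; exact (hρd s (hsub hs)).exp
      have h2 := hasDerivAt_transform h1 hr' (hθd s (hsub hs))
      refine h2.congr_deriv ?_
      simp only [hG, drift, Function.comp_apply]
      rw [transform_real_smul, ← velocity_transform]
      have h3 := eq_unitVar (hfin s hs).2.2.1.2
        ((isUnitVariation_unitVar (hD (τ s) hτε).1).transform (Real.exp (ρ s)) (θ s))
      rw [h3]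
      exact ((velocity_add (Φ s) _ _).trans (by rw [velocity_smul])).symm
  exact ⟨δ', hδ', hδ'₁.trans hδ₁δ, τ, fun s => Real.exp (ρ s), θ, hτs.mono hsub,
    (hρs.mono hsub).exp, hθs.mono hsub, hτ0, by simp [hρ0], hθ0,
    fun s hs => ⟨(hfin s hs).2.2.2, Real.exp_pos _, heq hs⟩⟩

end SpectralData

end

section
open Polynomial Set Filter Topology
namespace SpectralData

variable {g : ℕ}

/-! ### Extension of a logarithmic primitive over discs around the branch points -/

theorem HasLogDifferentialAt.congr {S : SpectralData g} {i : Fin 2} {m m' : ℂ × ℂ → ℂ} {p : ℂ × ℂ}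
    (h : S.HasLogDifferentialAt i m p) (hp : p ∈ S.curve)
    (he : ∀ᶠ q in 𝓝[S.curve] p, m' q = m q) : S.HasLogDifferentialAt i m' p := by
  obtain ⟨h0, F, hF, hFm, hFd⟩ := h
  have hep : m' p = m p := he.self_of_nhdsWithin hp
  refine ⟨hep ▸ h0, F, hF, ?_, hep ▸ hFd⟩
  filter_upwards [he, hFm] with q h1 h2
  rw [h1, h2]

theorem HasLogDifferentialAt.const_mul {S : SpectralData g} {i : Fin 2} {m : ℂ × ℂ → ℂ}
    {p : ℂ × ℂ} (h : S.HasLogDifferentialAt i m p) {C : ℂ} (hC : C ≠ 0) :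
    S.HasLogDifferentialAt i (fun q => C * m q) p := by
  obtain ⟨h0, F, hF, hFm, hFd⟩ := h
  refine ⟨mul_ne_zero hC h0, fun q => C * F q, analyticAt_const.mul hF, ?_, ?_⟩
  · filter_upwards [hFm] with q h1
    rw [h1]
  · rw [fderiv_const_mul hF.differentiableAt, ← hFd]
    simp only [_root_.smul_apply, smul_eq_mul]
    field_simp

/-- Over a regular point, the logarithmic differential can be checked in the local coordinate
`λ`. -/
theorem IsParam.hasLogDifferentialAt {S : SpectralData g} {i : Fin 2} {m : ℂ × ℂ → ℂ} {z₀ : ℂ}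
    {r : ℝ} {ψ : ℂ → ℂ} (hr : 0 < r) (hψ : S.IsParam (Metric.ball z₀ r) (fun w => w) ψ fun _ => 1)
    (h0 : m (z₀, ψ z₀) ≠ 0)
    (hm : ∀ z ∈ Metric.ball z₀ r, HasDerivAt (fun z => m (z, ψ z))
      (m (z, ψ z) * (Real.pi * (S.b i).eval z / (ψ z * z))) z) :
    S.HasLogDifferentialAt i m (z₀, ψ z₀) := by
  have hz₀ : z₀ ∈ Metric.ball z₀ r := Metric.mem_ball_self hr
  have hd : DifferentiableOn ℂ (fun z => m (z, ψ z)) (Metric.ball z₀ r) := fun z hz =>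
    (hm z hz).differentiableAt.differentiableWithinAt
  have ha := hd.analyticAt (Metric.ball_mem_nhds z₀ hr)
  refine ⟨h0, fun q => m (q.1, ψ q.1), ?_, ?_, ?_⟩
  · exact AnalyticAt.fun_comp (g := fun z => m (z, ψ z)) (f := Prod.fst) (x := (z₀, ψ z₀)) ha
      analyticAt_fst
  · have hψc : ContinuousAt ψ z₀ :=
      (hψ.n_diff.differentiableAt (Metric.ball_mem_nhds z₀ hr)).continuousAt
    have hc : ContinuousAt (fun q : ℂ × ℂ => q.2 + ψ q.1) (z₀, ψ z₀) :=
      continuousAt_snd.add (ContinuousAt.comp (f := Prod.fst) (x := (z₀, ψ z₀)) hψc continuousAt_fst)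
    have hne : ∀ᶠ q : ℂ × ℂ in 𝓝 (z₀, ψ z₀), q.2 + ψ q.1 ≠ 0 := by
      refine hc.eventually_ne ?_
      simpa [← two_mul] using hψ.n_ne_zero hz₀
    have hb : ∀ᶠ q : ℂ × ℂ in 𝓝 (z₀, ψ z₀), q.1 ∈ Metric.ball z₀ r :=
      continuousAt_fst.eventually_mem (Metric.ball_mem_nhds z₀ hr)
    filter_upwards [mem_nhdsWithin_of_mem_nhds hne, mem_nhdsWithin_of_mem_nhds hb,
      self_mem_nhdsWithin] with q h1 h2 h3
    have h4 : q.2 = ψ q.1 := by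
      refine (sq_eq_sq_iff_eq_or_eq_neg.1 (h3.2.trans (hψ.curve _ h2).symm)).resolve_right ?_
      intro h5
      exact h1 (by rw [h5]; ring)
    rw [← h4]
  · have h1 := HasDerivAt.comp_hasFDerivAt (f := Prod.fst) (z₀, ψ z₀) (hm z₀ hz₀)
      (hasFDerivAt_fst (𝕜 := ℂ) (E := ℂ) (F := ℂ))
    have h2 : fderiv ℂ (fun q : ℂ × ℂ => m (q.1, ψ q.1)) (z₀, ψ z₀) = _ := h1.fderiv
    have := hψ.n_ne_zero hz₀
    have := (hψ.regular z₀ hz₀).1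
    rw [h2]
    simp only [_root_.smul_apply, ContinuousLinearMap.coe_fst', tangent, logForm,
      smul_eq_mul]
    field_simp

/-- The solution of the linear differential equation `g + 2 (z - c) g' = f` which is regular at
the singular point `c`. -/
theorem exists_regular_solution {f : ℂ → ℂ} {c : ℂ} {R : ℝ}
    (hf : DifferentiableOn ℂ f (Metric.ball c R)) :
    ∃ G : ℂ → ℂ, ∀ z ∈ Metric.ball c R, ∃ d, HasDerivAt G d z ∧ G z + 2 * (z - c) * d = f z := by
  have hin : ∀ z ∈ Metric.ball c R, ∀ s ∈ uIcc (0 : ℝ) 1,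
      c + (s : ℂ) ^ 2 * (z - c) ∈ Metric.ball c R := by
    intro z hz s hs
    rw [uIcc_of_le zero_le_one] at hs
    rw [Metric.mem_ball, dist_eq_norm] at hz ⊢
    rw [add_sub_cancel_left, norm_mul, norm_pow, Complex.norm_real, Real.norm_of_nonneg hs.1]
    refine lt_of_le_of_lt ?_ hz
    exact mul_le_of_le_one_left (norm_nonneg _) (pow_le_one₀ hs.1 hs.2)
  have hfd : ∀ w ∈ Metric.ball c R, HasDerivAt f (deriv f w) w := fun w hw =>
    (hf.differentiableAt (Metric.isOpen_ball.mem_nhds hw)).hasDerivAt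
  have hf'c : ContinuousOn (deriv f) (Metric.ball c R) :=
    (hf.deriv Metric.isOpen_ball).continuousOn
  refine ⟨fun z => ∫ s in (0 : ℝ)..1, f (c + (s : ℂ) ^ 2 * (z - c)), fun z hz =>
    ⟨∫ s in (0 : ℝ)..1, deriv f (c + (s : ℂ) ^ 2 * (z - c)) * (s : ℂ) ^ 2, ?_, ?_⟩⟩
  · refine hasDerivAt_intervalIntegral_of_continuousOn
      (F' := fun z s => deriv f (c + (s : ℂ) ^ 2 * (z - c)) * (s : ℂ) ^ 2)
      (Metric.isOpen_ball.mem_nhds hz) (fun x hx => ?_) ?_ fun x hx s hs => ?_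
    · exact hf.continuousOn.comp (by fun_prop) fun s hs => hin x hx s hs
    · refine ContinuousOn.mul ?_ (by fun_prop)
      exact hf'c.comp (f := fun q : ℂ × ℝ => c + (q.2 : ℂ) ^ 2 * (q.1 - c)) (by fun_prop)
        fun q hq => hin _ hq.1 _ hq.2
    · have h1 : HasDerivAt (fun x => c + (s : ℂ) ^ 2 * (x - c)) ((s : ℂ) ^ 2) x := by
        simpa using (((hasDerivAt_id x).sub_const c).const_mul ((s : ℂ) ^ 2)).const_add c
      exact (hfd _ (hin x hx s hs)).comp x h1
  · have hcf : ContinuousOn (fun s : ℝ => f (c + (s : ℂ) ^ 2 * (z - c))) (uIcc 0 1) :=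
      hf.continuousOn.comp (by fun_prop) fun s hs => hin z hz s hs
    have hcf' : ContinuousOn (fun s : ℝ => deriv f (c + (s : ℂ) ^ 2 * (z - c)) * (s : ℂ) ^ 2)
        (uIcc 0 1) :=
      ((hf'c.comp (by fun_prop) fun s hs => hin z hz s hs)).mul (by fun_prop)
    -- the integrand is the derivative of `s f (c + s² (z - c))`
    have hd : ∀ s ∈ uIcc (0 : ℝ) 1, HasDerivAt (fun s : ℝ => (s : ℂ) * f (c + (s : ℂ) ^ 2 * (z - c)))
        (f (c + (s : ℂ) ^ 2 * (z - c)) +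
          2 * (z - c) * (deriv f (c + (s : ℂ) ^ 2 * (z - c)) * (s : ℂ) ^ 2)) s := by
      intro s hs
      have h0 : HasDerivAt (fun s : ℝ => (s : ℂ)) 1 s := Complex.ofRealCLM.hasDerivAt
      have h1 := ((h0.fun_pow 2).mul_const (z - c)).const_add c
      have h2 := h0.fun_mul ((hfd _ (hin z hz s hs)).comp s h1)
      convert! h2 using 1
      simp only [Function.comp_apply]
      push_cast
      ring
    have hint := intervalIntegral.integral_eq_sub_of_hasDerivAt hd
      (hcf.add (continuousOn_const.mul hcf')
      : ContinuousOn (fun s : ℝ => f (c + (s : ℂ) ^ 2 * (z - c)) +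
          2 * (z - c) * (deriv f (c + (s : ℂ) ^ 2 * (z - c)) * (s : ℂ) ^ 2)) (uIcc 0 1)
      ).intervalIntegrable
    have hcf'' : ContinuousOn (fun s : ℝ => 2 * (z - c) *
        (deriv f (c + (s : ℂ) ^ 2 * (z - c)) * (s : ℂ) ^ 2)) (uIcc 0 1) :=
      continuousOn_const.mul hcf'
    rw [intervalIntegral.integral_add hcf.intervalIntegrable hcf''.intervalIntegrable,
      intervalIntegral.integral_const_mul] at hint
    simp only [hint]
    simp

/-- Near a branch point, there is a function with the given logarithmic differential of the form
`exp (ν G(λ))`. -/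
theorem exists_log_primitive {S : SpectralData g} (hS : (X * S.a).Separable) (i : Fin 2) {α : ℂ}
    (hα : (X * S.a).IsRoot α) (hα0 : α ≠ 0) {R : ℝ} (hR : 0 < R)
    (hiso : ∀ z ∈ Metric.ball α R, (X * S.a).IsRoot z → z = α) :
    ∃ G : ℂ → ℂ, ∀ p ∈ S.curve, p.1 ∈ Metric.ball α R →
      S.HasLogDifferentialAt i (fun q => Complex.exp (q.2 * G q.1)) p := by
  obtain ⟨ψ, hψ, hA, -⟩ := exists_isParam_of_isolated hS hα hR hiso
  have h0 : ∀ z ∈ Metric.ball α R, z ≠ 0 := by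
    rintro z hz rfl
    exact hα0 (hiso 0 hz (by simp)).symm
  have hf : DifferentiableOn ℂ (fun z => 2 * Real.pi * (S.b i).eval z / (ψ z * z))
      (Metric.ball α R) :=
    ((S.b i).differentiable.differentiableOn.const_mul _).div (hψ.mul differentiableOn_id)
      fun z hz => mul_ne_zero (hA z hz).1 (h0 z hz)
  obtain ⟨K, hK⟩ := exists_regular_solution hf
  have hG : DifferentiableOn ℂ (fun z => K z / ψ z) (Metric.ball α R) := by
    refine DifferentiableOn.div (fun z hz => ?_) hψ fun z hz => (hA z hz).1
    obtain ⟨d, hd, -⟩ := hK z hz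
    exact hd.differentiableAt.differentiableWithinAt
  refine ⟨fun z => K z / ψ z, fun p hp hpR => ⟨Complex.exp_ne_zero _, _, ?_,
    Eventually.of_forall fun q => rfl, ?_⟩⟩
  · have h1 := AnalyticAt.fun_comp (f := Prod.fst) (x := p)
      (hG.analyticAt (Metric.isOpen_ball.mem_nhds hpR)) analyticAt_fst
    exact (analyticAt_snd.mul h1).cexp
  · obtain ⟨d, hd, hKd⟩ := hK p.1 hpR
    have hψp := (hψ.differentiableAt (Metric.isOpen_ball.mem_nhds hpR)).hasDerivAt
    have hne := (hA p.1 hpR).1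
    have hzp := h0 _ hpR
    have hAd : (X * S.a).derivative.eval p.1 =
        ψ p.1 ^ 2 + (p.1 - α) * (2 * ψ p.1 * deriv ψ p.1) := by
      have h2 := (((hasDerivAt_id p.1).sub_const α).fun_mul (hψp.fun_pow 2))
      have h3 := (X * S.a).hasDerivAt p.1
      refine h3.unique ((h2.congr_of_eventuallyEq ?_).congr_deriv (by simp))
      filter_upwards [Metric.isOpen_ball.mem_nhds hpR] with z hz
      rw [eval_mul, eval_X, ← (hA z hz).2]
      rfl
    have hGd := (hd.fun_div hψp hne).comp_hasFDerivAt (f := Prod.fst) p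
      (hasFDerivAt_fst (𝕜 := ℂ) (E := ℂ) (F := ℂ))
    have hF := ((hasFDerivAt_snd (𝕜 := ℂ) (p := p)).fun_mul hGd).cexp
    have hF' : fderiv ℂ (fun q : ℂ × ℂ => Complex.exp (q.2 * (K q.1 / ψ q.1))) p = _ := hF.fderiv
    rw [hF']
    have hcurve : p.2 ^ 2 = (p.1 - α) * ψ p.1 ^ 2 := hp.2.trans (hA p.1 hpR).2.symm
    simp only [Function.comp_apply, _root_.smul_apply, _root_.add_apply,
      ContinuousLinearMap.coe_fst', ContinuousLinearMap.coe_snd', tangent, logForm, smul_eq_mul,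
      hAd]
    rw [mul_div_cancel_left₀ _ (Complex.exp_ne_zero _)]
    have hval : 2 * Real.pi * (S.b i).eval p.1 / p.1 = ψ p.1 * (K p.1 + 2 * (p.1 - α) * d) := by
      rw [hKd]; field_simp
    rw [hval]
    field_simp
    linear_combination (2 * (d * ψ p.1 - K p.1 * deriv ψ p.1)) * hcurve

end SpectralData

end

section
open Polynomial Set Filter Topology
namespace SpectralData

variable {g : ℕ}

/-! ### Gluing over the discs around the branch points -/

/-- Over an annulus around a branch point, two functions with the same logarithmic differential
which the hyperelliptic involution inverts are equal up to the sign. -/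
theorem exists_sign_on_annulus {S : SpectralData g} (hS : (X * S.a).Separable) {i : Fin 2} {α : ℂ}
    (hα : (X * S.a).IsRoot α) {ρ R : ℝ} (hρ : 0 < ρ) (hρR : ρ < R)
    (hiso : ∀ z ∈ Metric.ball α R, (X * S.a).IsRoot z → z = α) {m m' : ℂ × ℂ → ℂ}
    (hm : ∀ p ∈ S.curve, ρ < dist p.1 α → dist p.1 α < R → S.HasLogDifferentialAt i m p)
    (hm' : ∀ p ∈ S.curve, ρ < dist p.1 α → dist p.1 α < R → S.HasLogDifferentialAt i m' p)
    (hh : ∀ p ∈ S.curve, ρ < dist p.1 α → dist p.1 α < R → m (hyp p) = (m p)⁻¹)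
    (hh' : ∀ p ∈ S.curve, ρ < dist p.1 α → dist p.1 α < R → m' (hyp p) = (m' p)⁻¹) :
    ∃ C : ℂ, C ^ 2 = 1 ∧ ∀ p ∈ S.curve, ρ < dist p.1 α → dist p.1 α < R → m p = C * m' p := by
  have hR : 0 < R := hρ.trans hρR
  obtain ⟨ψ, -, hA, hp⟩ := exists_isParam_of_isolated hS hα hR hiso
  set l : ℂ → ℂ := fun u => α + Complex.exp (2 * u) with hl
  set n : ℂ → ℂ := fun u => Complex.exp u * ψ (α + Complex.exp (2 * u)) with hn
  set W : Set ℂ := {u | Real.log ρ / 2 < u.re} ∩ {u | u.re < Real.log R / 2} with hW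
  have hWo : IsOpen W := (isOpen_lt continuous_const Complex.continuous_re).inter hp.isOpen
  have hWc : Convex ℝ W := (convex_halfSpace_re_gt _).inter hp.convex
  have hdist : ∀ u : ℂ, dist (l u) α = Real.exp (2 * u.re) := by
    intro u
    rw [dist_eq_norm, hl]
    simp [Complex.norm_exp]
  have hWd : ∀ u, u ∈ W ↔ ρ < dist (l u) α ∧ dist (l u) α < R := by
    intro u
    rw [hdist, ← Real.log_lt_iff_lt_exp hρ, ← Real.lt_log_iff_exp_lt hR, hW, mem_inter_iff,
      mem_ofPred_eq, mem_ofPred_eq, div_lt_iff₀ two_pos, lt_div_iff₀ two_pos, mul_comm 2]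
  have hc : ∀ u ∈ W, (l u, n u) ∈ S.curve := fun u hu => ⟨(hp.regular u hu.2).1, hp.curve u hu.2⟩
  have hq : ∀ u ∈ W, m' (l u, n u) ≠ 0 := fun u hu =>
    (hm' _ (hc u hu) ((hWd u).1 hu).1 ((hWd u).1 hu).2).1
  have hd : ∀ u ∈ W, HasDerivAt (fun u => m (l u, n u) / m' (l u, n u)) 0 u := by
    intro u hu
    have hev : ∀ᶠ v in 𝓝 u, (l v, n v) ∈ S.curve := (hWo.eventually_mem hu).mono hc
    have hnd := (hp.n_diff.differentiableAt (hp.isOpen.mem_nhds hu.2)).hasDerivAt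
    have h1 := (hm _ (hc u hu) ((hWd u).1 hu).1 ((hWd u).1 hu).2).hasDerivAt_param
      (hp.l_deriv u hu.2) hnd hev (hp.n_ne_zero hu.2)
    have h2 := (hm' _ (hc u hu) ((hWd u).1 hu).1 ((hWd u).1 hu).2).hasDerivAt_param
      (hp.l_deriv u hu.2) hnd hev (hp.n_ne_zero hu.2)
    refine (h1.fun_div h2 (hq u hu)).congr_deriv ?_
    ring
  have hconst : ∀ u ∈ W, ∀ v ∈ W, m (l u, n u) / m' (l u, n u) = m (l v, n v) / m' (l v, n v) :=
    fun u hu v hv => hWo.is_const_of_deriv_eq_zero hWc.isPreconnected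
      (fun w hw => (hd w hw).differentiableAt.differentiableWithinAt)
      (fun w hw => (hd w hw).deriv) hu hv
  -- translation by `π i` realizes the hyperelliptic involution in the strip
  have hlπ : ∀ u, l (u + Real.pi * Complex.I) = l u := by
    intro u
    simp only [hl]
    rw [mul_add, ← mul_assoc, Complex.exp_add, Complex.exp_two_pi_mul_I, mul_one]
  have hnπ : ∀ u, n (u + Real.pi * Complex.I) = -n u := by
    intro u
    have h1 := hlπ u
    simp only [hl] at h1
    simp only [hn]
    rw [h1, Complex.exp_add, Complex.exp_pi_mul_I]
    ring
  have hWπ : ∀ u ∈ W, u + Real.pi * Complex.I ∈ W := by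
    intro u hu
    rw [hWd, hlπ, ← hWd]
    exact hu
  set u₀ : ℂ := (((Real.log ρ / 2 + Real.log R / 2) / 2 : ℝ) : ℂ) with hu₀
  have hlog := Real.log_lt_log hρ hρR
  have hu₀W : u₀ ∈ W := by
    simp only [hW, hu₀, mem_inter_iff, mem_ofPred_eq, Complex.ofReal_re]
    constructor <;> linarith
  have hne : ∀ u ∈ W, m (l u, n u) ≠ 0 := fun u hu =>
    (hm _ (hc u hu) ((hWd u).1 hu).1 ((hWd u).1 hu).2).1
  refine ⟨m (l u₀, n u₀) / m' (l u₀, n u₀), ?_, fun p hpc h1 h2 => ?_⟩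
  · have h1 := hconst _ hu₀W _ (hWπ _ hu₀W)
    have e1 := hh _ (hc _ hu₀W) ((hWd u₀).1 hu₀W).1 ((hWd u₀).1 hu₀W).2
    have e2 := hh' _ (hc _ hu₀W) ((hWd u₀).1 hu₀W).1 ((hWd u₀).1 hu₀W).2
    rw [hyp] at e1 e2
    rw [hlπ, hnπ, e1, e2] at h1
    have h3 := hne _ hu₀W
    have h4 := hq _ hu₀W
    rw [sq]
    nth_rewrite 2 [h1]
    field_simp
  · have hpα : p.1 - α ≠ 0 := by
      rw [← norm_ne_zero_iff, ← dist_eq_norm]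
      exact (hρ.trans h1).ne'
    have hlu : l (Complex.log (p.1 - α) / 2) = p.1 := by
      simp only [hl]
      rw [mul_div_cancel₀ _ two_ne_zero, Complex.exp_log hpα]
      ring
    have huW : Complex.log (p.1 - α) / 2 ∈ W := by
      rw [hWd, hlu]; exact ⟨h1, h2⟩
    have key : ∀ u ∈ W, (l u, n u) = p → m p = m (l u₀, n u₀) / m' (l u₀, n u₀) * m' p := by
      rintro u hu rfl
      rw [hconst _ hu₀W _ hu, div_mul_cancel₀ _ (hq u hu)]
    have h3 := (hc _ huW).2
    simp only [hlu] at h3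
    rcases sq_eq_sq_iff_eq_or_eq_neg.1 (hpc.2.trans h3.symm) with h4 | h4
    · exact key _ huW (Prod.ext hlu h4.symm)
    · refine key _ (hWπ _ huW) (Prod.ext ?_ ?_)
      · rw [hlπ, hlu]
      · rw [hnπ, h4]

/-- A function with the given logarithmic differential on the part of the curve outside small discs
around the branch points extends to the whole curve. Every local primitive near a branch point is
up to the sign a continuation of it. -/
theorem exists_glue {T : SpectralData g} (hT : (X * T.a).Separable) (i : Fin 2) {ρ R : ℝ}
    (hρ : 0 < ρ) (hρR : ρ < R) (hR0 : ∀ β, T.a.IsRoot β → R ≤ ‖β‖)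
    (hsep : ∀ β β', T.a.IsRoot β → T.a.IsRoot β' → β ≠ β' → 2 * R ≤ dist β β') {O : ℂ × ℂ → ℂ}
    (hO : ∀ p ∈ T.curve, (∀ β, T.a.IsRoot β → ρ < dist p.1 β) → T.HasLogDifferentialAt i O p)
    (hh : ∀ p ∈ T.curve, (∀ β, T.a.IsRoot β → ρ < dist p.1 β) → O (hyp p) = (O p)⁻¹) :
    ∃ M : ℂ × ℂ → ℂ, T.HasLogDifferential i M ∧ (∀ p ∈ T.curve, M (hyp p) = (M p)⁻¹) ∧
      ∀ p, (∀ β, T.a.IsRoot β → ρ < dist p.1 β) → M p = O p := by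
  classical
  have hR : 0 < R := hρ.trans hρR
  have hroot : ∀ β, T.a.IsRoot β → (X * T.a).IsRoot β := fun β hβ => by
    rw [IsRoot.def] at hβ ⊢
    simp [hβ]
  have hiso : ∀ β, T.a.IsRoot β → ∀ z ∈ Metric.ball β R, (X * T.a).IsRoot z → z = β := by
    intro β hβ z hz hzr
    by_contra hne
    rw [Metric.mem_ball] at hz
    rw [IsRoot.def, eval_mul, eval_X, mul_eq_zero] at hzr
    rcases hzr with rfl | hzr
    · rw [dist_zero_left] at hz
      exact absurd hz (not_lt.2 (hR0 β hβ))
    · have := hsep z β hzr hβ hne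
      linarith
  have hfar : ∀ β, T.a.IsRoot β → ∀ z, dist z β < R → ρ < dist z β →
      ∀ β', T.a.IsRoot β' → ρ < dist z β' := by
    intro β hβ z h1 h2 β' hβ'
    by_cases hne : β = β'
    · rwa [← hne]
    · have h3 := hsep β β' hβ hβ' hne
      have h4 := dist_triangle_left β β' z
      linarith
  have hex : ∀ β, ∃ K : ℂ × ℂ → ℂ, T.a.IsRoot β →
      (∀ p ∈ T.curve, dist p.1 β < R → T.HasLogDifferentialAt i K p ∧ K (hyp p) = (K p)⁻¹) ∧
      ∀ p ∈ T.curve, ρ < dist p.1 β → dist p.1 β < R → O p = K p := by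
    intro β
    by_cases hβ : T.a.IsRoot β
    · have hβ0 : β ≠ 0 := norm_pos_iff.1 (hR.trans_le (hR0 β hβ))
      obtain ⟨G, hG⟩ := exists_log_primitive hT i (hroot β hβ) hβ0 hR (hiso β hβ)
      have hGh : ∀ p : ℂ × ℂ, Complex.exp ((hyp p).2 * G (hyp p).1) =
          (Complex.exp (p.2 * G p.1))⁻¹ := fun p => by
        rw [← Complex.exp_neg]; simp [hyp]
      obtain ⟨C, hC, hCO⟩ := exists_sign_on_annulus hT (hroot β hβ) hρ hρR (hiso β hβ)
        (fun p hp h1 h2 => hO p hp (hfar β hβ p.1 h2 h1)) (fun p hp _ h2 => hG p hp h2)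
        (fun p hp h1 h2 => hh p hp (hfar β hβ p.1 h2 h1)) fun p _ _ _ => hGh p
      have hC0 : C ≠ 0 := by
        rintro rfl
        simp at hC
      refine ⟨fun q => C * Complex.exp (q.2 * G q.1), fun _ =>
        ⟨fun p hp h2 => ⟨(hG p hp h2).const_mul hC0, ?_⟩, hCO⟩⟩
      simp only [hGh]
      rw [mul_inv, ← eq_inv_of_mul_eq_one_left ((sq C).symm.trans hC)]
    · exact ⟨0, fun h => absurd h hβ⟩
  choose K hK using hex
  set M : ℂ × ℂ → ℂ := fun p => if h : ∃ β, T.a.IsRoot β ∧ dist p.1 β ≤ ρ then K h.choose p else O p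
    with hM
  have hMO : ∀ p, (∀ β, T.a.IsRoot β → ρ < dist p.1 β) → M p = O p := by
    intro p hp
    rw [hM]
    refine dif_neg ?_
    rintro ⟨β, h1, h2⟩
    exact absurd (hp β h1) (not_lt.2 h2)
  have hMK : ∀ β, T.a.IsRoot β → ∀ p ∈ T.curve, dist p.1 β < R → M p = K β p := by
    intro β hβ p hp h1
    by_cases h : ∃ β, T.a.IsRoot β ∧ dist p.1 β ≤ ρ
    · have hspec := h.choose_spec
      have : h.choose = β := by
        by_contra hne
        have h3 := hsep _ _ hspec.1 hβ hne
        have h4 := dist_triangle_left h.choose β p.1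
        linarith
      rw [hM]
      simp only [dif_pos h]
      rw [this]
    · push Not at h
      rw [hMO p h]
      exact (hK β hβ).2 p hp (h β hβ) h1
  refine ⟨M, fun p hp => ?_, fun p hp => ?_, hMO⟩
  · by_cases h : ∃ β, T.a.IsRoot β ∧ dist p.1 β < R
    · obtain ⟨β, hβ, h1⟩ := h
      refine HasLogDifferentialAt.congr ((hK β hβ).1 p hp h1).1 hp ?_
      have h2 : ∀ᶠ q : ℂ × ℂ in 𝓝[T.curve] p, dist q.1 β < R := mem_nhdsWithin_of_mem_nhds
        ((isOpen_lt (continuous_fst.dist continuous_const) continuous_const).mem_nhds h1)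
      filter_upwards [h2, self_mem_nhdsWithin] with q h3 h4 using hMK β hβ q h4 h3
    · push Not at h
      have hfin : {β | T.a.IsRoot β}.Finite := finite_setOfPred_isRoot
        (right_ne_zero_of_mul hT.ne_zero)
      refine HasLogDifferentialAt.congr (hO p hp fun β hβ => hρR.trans_le (h β hβ)) hp ?_
      have h2 : ∀ᶠ q : ℂ × ℂ in 𝓝 p, ∀ β ∈ {β | T.a.IsRoot β}, ρ < dist q.1 β := by
        rw [Filter.eventually_all_finite hfin]
        exact fun β hβ => (isOpen_lt continuous_const (continuous_fst.dist continuous_const)).mem_nhds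
          (hρR.trans_le (h β hβ))
      filter_upwards [mem_nhdsWithin_of_mem_nhds h2] with q h3 using hMO q h3
  · by_cases h : ∃ β, T.a.IsRoot β ∧ dist p.1 β < R
    · obtain ⟨β, hβ, h1⟩ := h
      rw [hMK β hβ p hp h1, hMK β hβ (hyp p) (hyp_mem_curve hp) h1]
      exact ((hK β hβ).1 p hp h1).2
    · push Not at h
      have h2 := fun β hβ => hρR.trans_le (h β hβ)
      rw [hMO p h2, hMO (hyp p) h2]
      exact hh p hp h2

end SpectralData

end

section
open Polynomial Set Filter Topology
namespace SpectralData

variable {g : ℕ}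

/-! ### The anti-holomorphic involution -/

theorem etaInv_hyp (p : ℂ × ℂ) : etaInv g (hyp p) = hyp (etaInv g p) := by
  simp [etaInv, hyp]

theorem HasLogDifferentialAt.continuousWithinAt {S : SpectralData g} {i : Fin 2} {m : ℂ × ℂ → ℂ}
    {p : ℂ × ℂ} (h : S.HasLogDifferentialAt i m p) (hp : p ∈ S.curve) :
    ContinuousWithinAt m S.curve p := by
  obtain ⟨-, F, hF, hFm, -⟩ := h
  exact hF.continuousAt.continuousWithinAt.congr_of_eventuallyEq hFm (hFm.self_of_nhdsWithin hp)

/-- Where the curve is real, the functions `μ` and `conj ∘ μ ∘ η` have the same logarithmic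
differential. -/
theorem IsReal.hasDerivAt_conj_etaInv {T : SpectralData g} (hT : T.IsReal) {i : Fin 2}
    {m : ℂ × ℂ → ℂ} (hm : T.HasLogDifferential i m) {z₀ : ℂ} {r : ℝ} {ψ : ℂ → ℂ}
    (hψ : T.IsParam (Metric.ball z₀ r) (fun w => w) ψ fun _ => 1) {z : ℂ}
    (hz : z ∈ Metric.ball z₀ r) :
    HasDerivAt (fun z => conj (m (etaInv g (z, ψ z))))
      (conj (m (etaInv g (z, ψ z))) * (Real.pi * (T.b i).eval z / (ψ z * z))) z := by
  have hz0 : z ≠ 0 := (hψ.regular z hz).1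
  have hψ0 : ψ z ≠ 0 := hψ.n_ne_zero hz
  have hψd := (hψ.n_diff.differentiableAt (Metric.isOpen_ball.mem_nhds hz)).hasDerivAt
  set l : ℂ → ℂ := fun v => v⁻¹ with hl
  set n : ℂ → ℂ := fun v => -((conj ∘ ψ ∘ conj) v * v⁻¹ ^ (g + 1)) with hn
  have hcz0 : conj z ≠ 0 := by simpa using hz0
  have hld : HasDerivAt l (-((conj z) ^ 2)⁻¹) (conj z) := hasDerivAt_inv hcz0
  have hnd : DifferentiableAt ℂ n (conj z) := by
    have h1 : DifferentiableAt ℂ (conj ∘ ψ ∘ conj) (conj z) := by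
      have := HasDerivAt.conj_conj hψd
      exact this.differentiableAt
    exact (h1.mul ((differentiableAt_inv hcz0).pow (g + 1))).neg
  have heta : ∀ v, (l v, n v) = etaInv g (conj v, ψ (conj v)) := by
    intro v
    simp [hl, hn, etaInv]
  have hcurve : ∀ᶠ v in 𝓝 (conj z), (l v, n v) ∈ T.curve := by
    have hc : ContinuousAt (fun v : ℂ => conj v) (conj z) := Complex.continuous_conj.continuousAt
    have hb : ∀ᶠ v in 𝓝 (conj z), conj v ∈ Metric.ball z₀ r :=
      hc.eventually_mem (by simpa using Metric.isOpen_ball.mem_nhds hz)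
    filter_upwards [hb] with v hv
    rw [heta]
    exact hT.etaInv_mem_curve ⟨(hψ.regular _ hv).1, hψ.curve _ hv⟩
  have hn0 : n (conj z) ≠ 0 := by
    simp only [hn, Function.comp_apply, Complex.conj_conj]
    exact neg_ne_zero.2 (mul_ne_zero (by simpa using hψ0) (pow_ne_zero _ (inv_ne_zero hcz0)))
  have h1 := hm.hasDerivAt_param hld hnd.hasDerivAt hcurve hn0
  have h2 := HasDerivAt.conj_conj h1
  rw [Complex.conj_conj] at h2
  have hfun : (fun z => conj (m (etaInv g (z, ψ z)))) =
      conj ∘ (fun u => m (l u, n u)) ∘ conj := by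
    funext v
    simp only [Function.comp_apply, heta, Complex.conj_conj]
  rw [hfun]
  refine h2.congr_deriv ?_
  have hb := hT.eval_b i hz0
  have hlb : (T.b i).eval (l (conj z)) = ((conj z)⁻¹) ^ (g + 1) * conj ((T.b i).eval z) := hb
  rw [hlb, heta, Complex.conj_conj, map_mul]
  congr 1
  simp only [hl, hn, Function.comp_apply, Complex.conj_conj, map_mul, map_div₀, map_neg, map_pow,
    map_inv₀, Complex.conj_ofReal]
  field_simp

/-- A function on a real curve with the given logarithmic differential, which the hyperelliptic
involution inverts, is compatible with `η` once it is `1` or `-1` over one point of the unit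
circle. -/
theorem IsReal.conj_etaInv {T : SpectralData g} (hT : T.IsReal) {i : Fin 2} {m : ℂ × ℂ → ℂ}
    (hm : T.HasLogDifferential i m) (hh : ∀ p ∈ T.curve, m (hyp p) = (m p)⁻¹) {z₁ : ℂ}
    (hz₁ : ‖z₁‖ = 1) (hreg : z₁ ∈ T.regularSet)
    (hval : ∀ p ∈ T.curve, p.1 = z₁ → m p = 1 ∨ m p = -1) {p : ℂ × ℂ} (hp : p ∈ T.curve) :
    m (etaInv g p) = conj (m p) := by
  set Q : ℂ → Prop := fun z => ∀ n, n ^ 2 = z * T.a.eval z →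
    conj (m (etaInv g (z, n))) = m (z, n) with hQ
  have hm0 : ∀ p ∈ T.curve, m p ≠ 0 := fun p hp => (hm p hp).1
  have hQ1 : ∀ z ∈ T.regularSet, ∀ n, n ^ 2 = z * T.a.eval z →
      conj (m (etaInv g (z, n))) = m (z, n) → Q z := by
    intro z hz n hn he n' hn'
    have hc : (z, n) ∈ T.curve := ⟨hz.1, hn⟩
    rcases sq_eq_sq_iff_eq_or_eq_neg.1 (hn'.trans hn.symm) with rfl | rfl
    · exact he
    · have e1 := hh _ (hT.etaInv_mem_curve hc)
      have e2 := hh _ hc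
      rw [← etaInv_hyp] at e1
      rw [hyp] at e1 e2
      simp only at e1 e2
      rw [e1, e2, map_inv₀, he]
  have hstart : Q z₁ := by
    intro n hn
    have hc : (z₁, n) ∈ T.curve := ⟨hreg.1, hn⟩
    have hc' := hT.etaInv_mem_curve hc
    have he1 : (etaInv g (z₁, n)).1 = z₁ := inv_conj_of_norm_eq_one hz₁
    rcases sq_eq_sq_iff_eq_or_eq_neg.1 (hc'.2.trans (by rw [he1]; exact hn.symm)) with h | h
    · rw [show etaInv g (z₁, n) = (z₁, n) from Prod.ext he1 h]
      rcases hval _ hc rfl with h1 | h1 <;> simp [h1]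
    · rw [show etaInv g (z₁, n) = hyp (z₁, n) from Prod.ext he1 h, hh _ hc]
      rcases hval _ hc rfl with h1 | h1 <;> simp [h1]
  have hloc : ∀ x ∈ T.regularSet, ∃ r > 0, ∀ y ∈ Metric.ball x r, ∀ y' ∈ Metric.ball x r,
      Q y → Q y' := by
    intro x hx
    obtain ⟨r, hr, -, ψ, hψ⟩ := exists_isParam_id hx
    refine ⟨r, hr, fun y hy y' hy' hc => ?_⟩
    have hcur : ∀ w ∈ Metric.ball x r, (w, ψ w) ∈ T.curve := fun w hw =>
      ⟨(hψ.regular w hw).1, hψ.curve w hw⟩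
    have hd : ∀ w ∈ Metric.ball x r,
        HasDerivAt (fun w => conj (m (etaInv g (w, ψ w))) / m (w, ψ w)) 0 w := by
      intro w hw
      have h1 := hT.hasDerivAt_conj_etaInv hm hψ hw
      have h2 := hm.hasDerivAt_param (hψ.l_deriv w hw)
        (hψ.n_diff.differentiableAt (Metric.isOpen_ball.mem_nhds hw)).hasDerivAt
        ((Metric.isOpen_ball.eventually_mem hw).mono hcur) (hψ.n_ne_zero hw)
      refine (h1.fun_div h2 (hm0 _ (hcur w hw))).congr_deriv ?_
      ring
    have hconst := Metric.isOpen_ball.is_const_of_deriv_eq_zero (convex_ball x r).isPreconnected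
      (fun w hw => (hd w hw).differentiableAt.differentiableWithinAt)
      (fun w hw => (hd w hw).deriv) hy' hy
    refine hQ1 y' (hψ.regular y' hy') (ψ y') (hψ.curve y' hy') ?_
    have h0 := hm0 _ (hcur y' hy')
    rw [hc (ψ y) (hψ.curve y hy), div_self (hm0 _ (hcur y hy)), div_eq_one_iff_eq h0] at hconst
    exact hconst
  have ha0 : T.a ≠ 0 := by
    rintro h0
    exact hreg.2 (by rw [h0]; simp)
  have hall : ∀ z ∈ T.regularSet, Q z := by
    intro z hz
    refine (IsPreconnected.induction₂ (isPreconnected_regularSet ha0)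
      (fun x y => Q x ↔ Q y) ?_ ?_ ?_ hreg hz).1 hstart
    · intro x hx
      obtain ⟨r, hr, h1⟩ := hloc x hx
      filter_upwards [mem_nhdsWithin_of_mem_nhds (Metric.ball_mem_nhds x hr)] with y hy
      exact ⟨h1 x (Metric.mem_ball_self hr) y hy, h1 y hy x (Metric.mem_ball_self hr)⟩
    · exact fun x y z _ _ _ h1 h2 => h1.trans h2
    · exact fun x y _ _ h1 => h1.symm
  suffices h : conj (m (etaInv g p)) = m p by rw [← h, Complex.conj_conj]
  by_cases hz : p.1 ∈ T.regularSet
  · exact hall _ hz p.2 hp.2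
  -- at a branch point, both sides are continuous
  have hp0 : p.1 ≠ 0 := hp.1
  have ha : p.1 * T.a.eval p.1 = 0 := by
    have := not_mem_regularSet_iff.1 hz
    rwa [IsRoot.def, eval_mul, eval_X] at this
  have hp2 : p.2 = 0 := by
    have := hp.2
    rw [ha] at this
    exact pow_eq_zero_iff two_ne_zero |>.1 this
  have hreg' : ∀ᶠ w in 𝓝[≠] p.1, w ∈ T.regularSet := by
    have hfin : {w | (X * T.a).IsRoot w}.Finite :=
      finite_setOfPred_isRoot (mul_ne_zero X_ne_zero ha0)
    filter_upwards [nhdsNE_le_cofinite _ hfin.compl_mem_cofinite] with w hw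
    by_contra h
    exact hw (not_mem_regularSet_iff.1 h)
  have hroot : Tendsto (fun w => T.rootA w) (𝓝[≠] p.1) (𝓝 0) := by
    have h1 : Tendsto (fun w => w * T.a.eval w) (𝓝[≠] p.1) (𝓝 0) := by
      have : Tendsto (fun w => w * T.a.eval w) (𝓝 p.1) (𝓝 (p.1 * T.a.eval p.1)) :=
        (continuous_id.mul T.a.continuous).tendsto p.1
      rw [ha] at this
      exact this.mono_left nhdsWithin_le_nhds
    have h2 : Tendsto (fun w => T.rootA w ^ 2) (𝓝[≠] p.1) (𝓝 0) :=
      h1.congr' (hreg'.mono fun w hw => (rootA_sq hw).symm)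
    rw [tendsto_zero_iff_norm_tendsto_zero] at h2 ⊢
    have h3 := (Real.continuous_sqrt.tendsto 0).comp h2
    rw [Real.sqrt_zero] at h3
    refine h3.congr fun w => ?_
    simp [Real.sqrt_sq]
  have hpath : Tendsto (fun w => (w, T.rootA w)) (𝓝[≠] p.1) (𝓝[T.curve] p) := by
    refine tendsto_nhdsWithin_iff.2 ⟨?_, hreg'.mono fun w hw => ⟨hw.1, rootA_sq hw⟩⟩
    rw [show p = (p.1, 0) from Prod.ext rfl hp2]
    exact (tendsto_id.mono_left nhdsWithin_le_nhds).prodMk_nhds hroot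
  have hetac : ContinuousAt (etaInv g) p := by
    have h1 : ContinuousAt (fun q : ℂ × ℂ => (conj q.1)⁻¹) p :=
      (Complex.continuous_conj.comp continuous_fst).continuousAt.inv₀ (by simpa using hp0)
    exact h1.prodMk (((Complex.continuous_conj.comp continuous_snd).continuousAt.mul
      (h1.pow (g + 1))).neg)
  have hetat : Tendsto (etaInv g) (𝓝[T.curve] p) (𝓝[T.curve] (etaInv g p)) :=
    tendsto_nhdsWithin_iff.2 ⟨hetac.tendsto.mono_left nhdsWithin_le_nhds,
      eventually_mem_nhdsWithin.mono fun q hq => hT.etaInv_mem_curve hq⟩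
  have hm1 : Tendsto m (𝓝[T.curve] p) (𝓝 (m p)) :=
    HasLogDifferentialAt.continuousWithinAt (hm p hp) hp
  have hm2 : Tendsto m (𝓝[T.curve] (etaInv g p)) (𝓝 (m (etaInv g p))) :=
    HasLogDifferentialAt.continuousWithinAt (hm _ (hT.etaInv_mem_curve hp)) (hT.etaInv_mem_curve hp)
  have t1 := (Complex.continuous_conj.tendsto _).comp (hm2.comp (hetat.comp hpath))
  have t2 := hm1.comp hpath
  refine tendsto_nhds_unique (t1.congr' ?_) t2
  exact hreg'.mono fun w hw => hall w hw _ (rootA_sq hw)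

end SpectralData

end

section
open Polynomial Set Filter Topology
namespace SpectralData

variable {g : ℕ}

/-! ### Transport of the functions `μ` along a deformation -/

theorem continuous_eval_c (i : Fin 2) :
    Continuous fun p : Variation g × ℂ => (p.1.c i).eval p.2 := by
  simp only [Variation.c, coeffPoly_eval]
  fun_prop

theorem coeffPoly_derivative_eval {n : ℕ} (c : Fin n → ℂ) (z : ℂ) :
    (derivative (coeffPoly c)).eval z = ∑ k : Fin n, c k * (k : ℕ) * z ^ ((k : ℕ) - 1) := by
  simp [coeffPoly, eval_finsetSum, derivative_monomial]

theorem continuous_eval_derivative_c (i : Fin 2) :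
    Continuous fun p : Variation g × ℂ => (derivative (p.1.c i)).eval p.2 := by
  simp only [Variation.c, coeffPoly_derivative_eval]
  fun_prop

theorem continuous_eval_derivative_a :
    Continuous fun p : SpectralData g × ℂ => (derivative p.1.a).eval p.2 := by
  simp only [a, coeffPoly_derivative_eval]
  fun_prop

theorem hasDerivAt_sqrtRatio_snd {S T : SpectralData g} {z : ℂ}
    (h : T.a.eval z / S.a.eval z ∈ Complex.slitPlane) :
    HasDerivAt (sqrtRatio S T) (sqrtRatio S T z * ((derivative T.a).eval z / (2 * T.a.eval z) -
      (derivative S.a).eval z / (2 * S.a.eval z))) z := by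
  obtain ⟨h1, h0⟩ := ne_zero_of_mem_slitPlane h
  have hd := ((((T.a.hasDerivAt z).fun_div (S.a.hasDerivAt z) h0).clog h).div_const 2).cexp
  convert! hd using 1
  rw [sqrtRatio]
  field_simp

/-- A path of spectral data on `(-ε, ε)` whose velocity comes from infinitesimal deformations,
together with a region `Ω` of the `λ`-plane on which the polynomial `a` changes so little that
the values of `ν` can be transported by the principal branch of the square root. -/
structure IsDeformation (ε : ℝ) (D : ℝ → SpectralData g) (v : ℝ → Variation g) (Ω : Set ℂ) :
    Prop where
  pos : 0 < ε
  deriv : ∀ s ∈ Ioo (-ε) ε, HasDerivAt D ((D s).velocity (v s)) s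
  var_cont : ContinuousOn v (Ioo (-ε) ε)
  infinitesimal : ∀ s ∈ Ioo (-ε) ε, (D s).IsInfinitesimal (v s)
  isOpen : IsOpen Ω
  slit : ∀ s ∈ Ioo (-ε) ε, ∀ z ∈ Ω, (D s).a.eval z / (D 0).a.eval z ∈ Complex.slitPlane

/-- The numerator `∫ π c_i dt` of the logarithm of the quotient of the functions `μ_i` on the
curves of `D t` and `D 0`, with respect to `ν` on the curve of `D 0`. -/
def transportExponent (D : ℝ → SpectralData g) (v : ℝ → Variation g) (i : Fin 2) (t : ℝ) (z : ℂ) :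
    ℂ :=
  ∫ s in (0 : ℝ)..t, Real.pi * ((v s).c i).eval z / sqrtRatio (D 0) (D s) z

/-- The function `μ_i` on the curve of `D t` obtained from the function `m` on the curve of
`D 0`. -/
def transported (D : ℝ → SpectralData g) (v : ℝ → Variation g) (i : Fin 2) (m : ℂ × ℂ → ℂ)
    (t : ℝ) (p : ℂ × ℂ) : ℂ :=
  m (p.1, p.2 / sqrtRatio (D 0) (D t) p.1) *
    Complex.exp (transportExponent D v i t p.1 / (p.2 / sqrtRatio (D 0) (D t) p.1))

variable {ε : ℝ} {D : ℝ → SpectralData g} {v : ℝ → Variation g} {Ω : Set ℂ} {i : Fin 2}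
  {m : ℂ × ℂ → ℂ}

theorem IsDeformation.zero_mem (h : IsDeformation ε D v Ω) : (0 : ℝ) ∈ Ioo (-ε) ε :=
  ⟨neg_lt_zero.2 h.pos, h.pos⟩

theorem IsDeformation.uIcc_subset (h : IsDeformation ε D v Ω) {t : ℝ} (ht : t ∈ Ioo (-ε) ε) :
    uIcc 0 t ⊆ Ioo (-ε) ε := ordConnected_Ioo.uIcc_subset h.zero_mem ht

theorem IsDeformation.a_ne_zero (h : IsDeformation ε D v Ω) {z : ℂ} (hz : z ∈ Ω) {t : ℝ}
    (ht : t ∈ Ioo (-ε) ε) : (D t).a.eval z ≠ 0 :=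
  (ne_zero_of_mem_slitPlane (h.slit t ht z hz)).1

theorem IsDeformation.continuousOn_var (h : IsDeformation ε D v Ω) :
    ContinuousOn (fun p : ℂ × ℝ => (v p.2, p.1)) (Ω ×ˢ Ioo (-ε) ε) :=
  (h.var_cont.comp continuousOn_snd fun _ hp => hp.2).prodMk continuousOn_fst

theorem IsDeformation.continuousOn_data (h : IsDeformation ε D v Ω) :
    ContinuousOn (fun p : ℂ × ℝ => (D p.2, p.1)) (Ω ×ˢ Ioo (-ε) ε) := by
  have hD : ContinuousOn D (Ioo (-ε) ε) := fun s hs =>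
    (h.deriv s hs).continuousAt.continuousWithinAt
  exact (hD.comp continuousOn_snd fun _ hp => hp.2).prodMk continuousOn_fst

theorem IsDeformation.continuousOn_sqrtRatio (h : IsDeformation ε D v Ω) :
    ContinuousOn (fun p : ℂ × ℝ => sqrtRatio (D 0) (D p.2) p.1) (Ω ×ˢ Ioo (-ε) ε) := by
  rintro p hp
  exact ContinuousAt.comp_continuousWithinAt (f := fun p : ℂ × ℝ => (D p.2, p.1))
    (g := fun p : SpectralData g × ℂ => sqrtRatio (D 0) p.1 p.2)
    (continuousAt_sqrtRatio (h.slit _ hp.2 _ hp.1)) (h.continuousOn_data p hp)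

theorem IsDeformation.continuousOn_integrand (h : IsDeformation ε D v Ω) (i : Fin 2) :
    ContinuousOn (fun p : ℂ × ℝ => Real.pi * ((v p.2).c i).eval p.1 / sqrtRatio (D 0) (D p.2) p.1)
      (Ω ×ˢ Ioo (-ε) ε) :=
  (continuousOn_const.mul ((continuous_eval_c i).comp_continuousOn h.continuousOn_var)).div
    h.continuousOn_sqrtRatio fun _ _ => sqrtRatio_ne_zero _ _ _

theorem IsDeformation.continuousOn_integrand_slice (h : IsDeformation ε D v Ω) (i : Fin 2) {z : ℂ}
    (hz : z ∈ Ω) : ContinuousOn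
      (fun s : ℝ => Real.pi * ((v s).c i).eval z / sqrtRatio (D 0) (D s) z) (Ioo (-ε) ε) :=
  (h.continuousOn_integrand i).comp (f := fun s : ℝ => (z, s)) (by fun_prop) fun _ hs => ⟨hz, hs⟩

theorem IsDeformation.hasDerivAt_transportExponent (h : IsDeformation ε D v Ω) (i : Fin 2) {z : ℂ}
    (hz : z ∈ Ω) {t : ℝ} (ht : t ∈ Ioo (-ε) ε) :
    HasDerivAt (fun t => transportExponent D v i t z)
      (Real.pi * ((v t).c i).eval z / sqrtRatio (D 0) (D t) z) t := by
  have hc := h.continuousOn_integrand_slice i hz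
  exact intervalIntegral.integral_hasDerivAt_right
    (hc.mono (h.uIcc_subset ht)).intervalIntegrable
    (hc.stronglyMeasurableAtFilter isOpen_Ioo t ht) (hc.continuousAt (isOpen_Ioo.mem_nhds ht))

theorem whitham_eval {S : SpectralData g} {v : Variation g} {i : Fin 2} (h : S.whitham v i = 0)
    (z : ℂ) : 2 * (S.a.eval z * (v.1.b i).eval z) - (S.b i).eval z * v.1.a.eval z -
      2 * (S.a.eval z * (z * (derivative (v.c i)).eval z)) +
      (S.a.eval z + z * (derivative S.a).eval z) * (v.c i).eval z = 0 := by
  have := congrArg (eval z) h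
  simpa [whitham] using this

/-- The integrated Whitham equation. -/
theorem IsDeformation.exists_hasDerivAt_transportExponent (h : IsDeformation ε D v Ω) (i : Fin 2)
    {z : ℂ} (hz : z ∈ Ω) {t : ℝ} (ht : t ∈ Ioo (-ε) ε) :
    ∃ d, HasDerivAt (transportExponent D v i t) d z ∧
      z * d - (1 / 2 + z * ((derivative (D 0).a).eval z / (2 * (D 0).a.eval z))) *
        transportExponent D v i t z =
        Real.pi * (((D t).b i).eval z / sqrtRatio (D 0) (D t) z - ((D 0).b i).eval z) := by
  set F' : ℂ → ℝ → ℂ := fun z s => Real.pi * ((derivative ((v s).c i)).eval z - ((v s).c i).eval z *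
    ((derivative (D s).a).eval z / (2 * (D s).a.eval z) -
      (derivative (D 0).a).eval z / (2 * (D 0).a.eval z))) / sqrtRatio (D 0) (D s) z with hF'
  have hsub := h.uIcc_subset ht
  have hF'c : ContinuousOn (fun p : ℂ × ℝ => F' p.1 p.2) (Ω ×ˢ Ioo (-ε) ε) := by
    have c1 := (continuous_eval_c i).comp_continuousOn h.continuousOn_var
    have c2 := (continuous_eval_derivative_c i).comp_continuousOn h.continuousOn_var
    have c3 := continuous_eval_a.comp_continuousOn h.continuousOn_data
    have c4 := continuous_eval_derivative_a.comp_continuousOn h.continuousOn_data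
    have c5 : ContinuousOn (fun p : ℂ × ℝ => (D 0).a.eval p.1) (Ω ×ˢ Ioo (-ε) ε) :=
      ((D 0).a.continuous.comp continuous_fst).continuousOn
    have c6 : ContinuousOn (fun p : ℂ × ℝ => (derivative (D 0).a).eval p.1) (Ω ×ˢ Ioo (-ε) ε) :=
      ((derivative (D 0).a).continuous.comp continuous_fst).continuousOn
    exact (continuousOn_const.mul (c2.sub (c1.mul ((c4.div (continuousOn_const.mul c3)
      fun p hp => mul_ne_zero two_ne_zero (h.a_ne_zero hp.1 hp.2)).sub
      (c6.div (continuousOn_const.mul c5) fun p hp =>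
        mul_ne_zero two_ne_zero (h.a_ne_zero hp.1 h.zero_mem)))))).div
      h.continuousOn_sqrtRatio fun _ _ => sqrtRatio_ne_zero _ _ _
  have hFz := (h.continuousOn_integrand_slice i hz).mono hsub
  have hF'z : ContinuousOn (F' z) (uIcc 0 t) :=
    hF'c.comp (f := fun s : ℝ => (z, s)) (by fun_prop) fun s hs => ⟨hz, hsub hs⟩
  refine ⟨∫ s in (0 : ℝ)..t, F' z s, ?_, ?_⟩
  · refine hasDerivAt_intervalIntegral_of_continuousOn (F' := F') (h.isOpen.mem_nhds hz)
      (fun x hx => (h.continuousOn_integrand_slice i hx).mono hsub)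
      (hF'c.mono (prod_mono le_rfl hsub)) fun x hx s hs => ?_
    have hρ := hasDerivAt_sqrtRatio_snd (h.slit s (hsub hs) x hx)
    have hρ0 := sqrtRatio_ne_zero (D 0) (D s) x
    refine ((((v s).c i).hasDerivAt x).const_mul (Real.pi : ℂ)).fun_div hρ hρ0 |>.congr_deriv ?_
    simp only [hF']
    generalize (derivative (D s).a).eval x / (2 * (D s).a.eval x) -
      (derivative (D 0).a).eval x / (2 * (D 0).a.eval x) = k
    field_simp
  · have hd : ∀ s ∈ uIcc (0 : ℝ) t,
        HasDerivAt (fun s => Real.pi * (((D s).b i).eval z / sqrtRatio (D 0) (D s) z))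
        (z * F' z s - (1 / 2 + z * ((derivative (D 0).a).eval z / (2 * (D 0).a.eval z))) *
          (Real.pi * ((v s).c i).eval z / sqrtRatio (D 0) (D s) z)) s := by
      intro s hs
      have h1 := (hasDerivAt_b_div_sqrtRatio i (h.deriv s (hsub hs))
        (h.slit s (hsub hs) z hz)).const_mul (Real.pi : ℂ)
      refine h1.congr_deriv ?_
      have hW := whitham_eval ((h.infinitesimal s (hsub hs)).1 i) z
      have ha := h.a_ne_zero hz (hsub hs)
      have ha0 := h.a_ne_zero hz h.zero_mem
      have hρ0 := sqrtRatio_ne_zero (D 0) (D s) z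
      have e1 : ((D s).velocity (v s)).a = (v s).1.a := rfl
      have e2 : ((D s).velocity (v s)).b i = (v s).1.b i := rfl
      simp only [hF', e1, e2]
      field_simp
      linear_combination (D 0).a.eval z * hW
    have hint := intervalIntegral.integral_eq_sub_of_hasDerivAt hd
      ((continuousOn_const.mul hF'z).sub (continuousOn_const.mul hFz)).intervalIntegrable
    have i1 : IntervalIntegrable (fun s => z * F' z s) MeasureTheory.volume 0 t :=
      (continuousOn_const.mul hF'z).intervalIntegrable
    have i2 : IntervalIntegrable (fun s =>
        (1 / 2 + z * ((derivative (D 0).a).eval z / (2 * (D 0).a.eval z))) *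
          (Real.pi * ((v s).c i).eval z / sqrtRatio (D 0) (D s) z)) MeasureTheory.volume 0 t :=
      (continuousOn_const.mul hFz).intervalIntegrable
    rw [intervalIntegral.integral_sub i1 i2, intervalIntegral.integral_const_mul,
      intervalIntegral.integral_const_mul, sqrtRatio_self (h.a_ne_zero hz h.zero_mem)] at hint
    rw [transportExponent, hint]
    ring

/-- The transported function in the local coordinate `λ`. -/
theorem IsDeformation.hasDerivAt_mul_exp (h : IsDeformation ε D v Ω)
    (hm : (D 0).HasLogDifferential i m) {z₀ : ℂ} {r : ℝ} (hr : Metric.ball z₀ r ⊆ Ω) {ψ : ℂ → ℂ}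
    (hψ : (D 0).IsParam (Metric.ball z₀ r) (fun w => w) ψ fun _ => 1) {t : ℝ}
    (ht : t ∈ Ioo (-ε) ε) {z : ℂ} (hz : z ∈ Metric.ball z₀ r) :
    HasDerivAt (fun z => m (z, ψ z) * Complex.exp (transportExponent D v i t z / ψ z))
      (m (z, ψ z) * Complex.exp (transportExponent D v i t z / ψ z) *
        (Real.pi * ((D t).b i).eval z / (sqrtRatio (D 0) (D t) z * ψ z * z))) z := by
  have hz0 : z ≠ 0 := (hψ.regular z hz).1
  have ha0 : (D 0).a.eval z ≠ 0 := (hψ.regular z hz).2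
  have hψ0 : ψ z ≠ 0 := hψ.n_ne_zero hz
  have hψd := (hψ.n_diff.differentiableAt (Metric.isOpen_ball.mem_nhds hz)).hasDerivAt
  obtain ⟨d, hd, he⟩ := h.exists_hasDerivAt_transportExponent i (hr hz) ht
  have hev : ∀ᶠ w in 𝓝 z, (w, ψ w) ∈ (D 0).curve :=
    (Metric.isOpen_ball.eventually_mem hz).mono fun w hw => ⟨(hψ.regular w hw).1, hψ.curve w hw⟩
  have h1 := hm.hasDerivAt_param (hψ.l_deriv z hz) hψd hev hψ0
  have hψ' : 2 * ψ z * _root_.deriv ψ z = (D 0).a.eval z + z * (derivative (D 0).a).eval z := by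
    have h2 := hψd.fun_pow 2
    have h3 := (hasDerivAt_id z).fun_mul ((D 0).a.hasDerivAt z)
    have h4 := h2.unique (h3.congr_of_eventuallyEq (hev.mono fun w hw => hw.2))
    simpa using h4
  refine (h1.fun_mul (hd.fun_div hψd hψ0).cexp).congr_deriv ?_
  have hρ0 := sqrtRatio_ne_zero (D 0) (D t) z
  have hc := hψ.curve z hz
  generalize Complex.exp (transportExponent D v i t z / ψ z) = e
  generalize transportExponent D v i t z = N at *
  generalize m (z, ψ z) = M
  have hψ'' : _root_.deriv ψ z = ((D 0).a.eval z + z * (derivative (D 0).a).eval z) / (2 * ψ z) := by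
    rw [eq_div_iff (mul_ne_zero two_ne_zero hψ0), ← hψ']
    ring
  have key : Real.pi * ((D 0).b i).eval z / (ψ z * z) * 1 + (d * ψ z - N * _root_.deriv ψ z) / ψ z ^ 2 =
      Real.pi * ((D t).b i).eval z / (sqrtRatio (D 0) (D t) z * ψ z * z) := by
    have h5 : (d * ψ z - N * _root_.deriv ψ z) / ψ z ^ 2 = (z * d - (1 / 2 + z *
        ((derivative (D 0).a).eval z / (2 * (D 0).a.eval z))) * N) / (ψ z * z) := by
      rw [hψ'']
      have : (d * ψ z - N * (((D 0).a.eval z + z * (derivative (D 0).a).eval z) / (2 * ψ z))) /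
          ψ z ^ 2 = (d - N * (((D 0).a.eval z + z * (derivative (D 0).a).eval z) / (2 * ψ z ^ 2))) /
          ψ z := by field_simp
      rw [this, hc]
      field_simp
    rw [h5, he]
    field_simp
    ring
  rw [← key]
  ring

theorem IsDeformation.curve_div (h : IsDeformation ε D v Ω) {t : ℝ} (ht : t ∈ Ioo (-ε) ε)
    {p : ℂ × ℂ} (hp : p ∈ (D t).curve) (hz : p.1 ∈ Ω) :
    (p.1, p.2 / sqrtRatio (D 0) (D t) p.1) ∈ (D 0).curve := by
  refine ⟨hp.1, ?_⟩
  have h0 := h.a_ne_zero hz h.zero_mem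
  have h1 := h.a_ne_zero hz ht
  simp only
  rw [div_pow, sqrtRatio_sq (h.slit t ht _ hz), hp.2]
  field_simp

theorem IsDeformation.transported_hyp (h : IsDeformation ε D v Ω)
    (hh : ∀ p ∈ (D 0).curve, m (hyp p) = (m p)⁻¹) {t : ℝ} (ht : t ∈ Ioo (-ε) ε)
    {p : ℂ × ℂ} (hp : p ∈ (D t).curve) (hz : p.1 ∈ Ω) :
    transported D v i m t (hyp p) = (transported D v i m t p)⁻¹ := by
  have h1 := hh _ (h.curve_div ht hp hz)
  simp only [transported, hyp, neg_div, div_neg, Complex.exp_neg, mul_inv] at h1 ⊢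
  rw [h1]

theorem IsDeformation.exists_isParam (h : IsDeformation ε D v Ω) {z : ℂ} (hz : z ∈ Ω)
    (hz0 : z ≠ 0) : ∃ r > 0, Metric.ball z r ⊆ Ω ∧ ∃ ψ : ℂ → ℂ,
      (D 0).IsParam (Metric.ball z r) (fun w => w) ψ fun _ => 1 := by
  obtain ⟨r₁, hr₁, -, ψ, hψ⟩ := exists_isParam_id (S := D 0) (z := z)
    ⟨hz0, h.a_ne_zero hz h.zero_mem⟩
  obtain ⟨r₂, hr₂, hsub⟩ := Metric.isOpen_iff.1 h.isOpen z hz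
  have hs : Metric.ball z (min r₁ r₂) ⊆ Metric.ball z r₁ := Metric.ball_subset_ball (min_le_left _ _)
  exact ⟨min r₁ r₂, lt_min hr₁ hr₂, (Metric.ball_subset_ball (min_le_right _ _)).trans hsub, ψ,
    Metric.isOpen_ball, convex_ball _ _, fun w hw => hψ.l_deriv w (hs hw), hψ.n_diff.mono hs,
    fun w hw => hψ.regular w (hs hw), fun w hw => hψ.curve w (hs hw)⟩

/-- The transported functions have the logarithmic differential that belongs to `D t`, since the
linearized Whitham equation lets the derivatives with respect to `t` and `λ` commute. -/
theorem IsDeformation.hasLogDifferentialAt (h : IsDeformation ε D v Ω)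
    (hm : (D 0).HasLogDifferential i m) {t : ℝ} (ht : t ∈ Ioo (-ε) ε) {p : ℂ × ℂ}
    (hp : p ∈ (D t).curve) (hz : p.1 ∈ Ω) :
    (D t).HasLogDifferentialAt i (transported D v i m t) p := by
  obtain ⟨r, hr, hsub, ψ₀, hψ₀⟩ := h.exists_isParam hz hp.1
  have hzr := Metric.mem_ball_self (x := p.1) hr
  have hρ0 := fun z => sqrtRatio_ne_zero (D 0) (D t) z
  -- choose the branch of the square root which passes through the point
  obtain ⟨ψ, hψ, hψp⟩ : ∃ ψ : ℂ → ℂ,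
      (D 0).IsParam (Metric.ball p.1 r) (fun w => w) ψ (fun _ => 1) ∧
      ψ p.1 * sqrtRatio (D 0) (D t) p.1 = p.2 := by
    have h1 := (h.curve_div ht hp hz).2
    simp only at h1
    rcases sq_eq_sq_iff_eq_or_eq_neg.1 (h1.trans (hψ₀.curve _ hzr).symm) with h2 | h2
    · exact ⟨ψ₀, hψ₀, by rw [← h2, div_mul_cancel₀ _ (hρ0 _)]⟩
    · refine ⟨fun z => -ψ₀ z, ⟨hψ₀.isOpen, hψ₀.convex, hψ₀.l_deriv, hψ₀.n_diff.neg, hψ₀.regular,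
        fun w hw => by rw [neg_sq]; exact hψ₀.curve w hw⟩, ?_⟩
      simp only
      rw [← h2, div_mul_cancel₀ _ (hρ0 _)]
  have hT : (D t).IsParam (Metric.ball p.1 r) (fun w => w)
      (fun w => ψ w * sqrtRatio (D 0) (D t) w) fun _ => 1 := by
    refine ⟨hψ.isOpen, hψ.convex, hψ.l_deriv, hψ.n_diff.mul fun w hw =>
      (differentiableAt_sqrtRatio (h.slit t ht w (hsub hw))).differentiableWithinAt,
      fun w hw => ⟨(hψ.regular w hw).1, h.a_ne_zero (hsub hw) ht⟩, fun w hw => ?_⟩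
    exact (mem_curve_transport (h.slit t ht w (hsub hw))
      ⟨(hψ.regular w hw).1, hψ.curve w hw⟩).2
  have hval : ∀ z, transported D v i m t (z, ψ z * sqrtRatio (D 0) (D t) z) =
      m (z, ψ z) * Complex.exp (transportExponent D v i t z / ψ z) := fun z => by
    simp only [transported]
    rw [mul_div_cancel_right₀ _ (hρ0 z)]
  have hpe : p = (p.1, ψ p.1 * sqrtRatio (D 0) (D t) p.1) := Prod.ext rfl hψp.symm
  rw [hpe]
  refine hT.hasLogDifferentialAt hr ?_ fun z hzb => ?_
  · rw [hval]
    exact mul_ne_zero (hm (p.1, ψ p.1) ⟨hp.1, hψ.curve _ hzr⟩).1 (Complex.exp_ne_zero _)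
  · simp only [hval]
    refine (h.hasDerivAt_mul_exp hm hsub hψ ht hzb).congr_deriv ?_
    ring

end SpectralData

end

section
open Polynomial Set Filter Topology
namespace SpectralData

variable {g : ℕ} {ε : ℝ} {D : ℝ → SpectralData g} {v : ℝ → Variation g} {Ω : Set ℂ} {i : Fin 2}
  {m : ℂ × ℂ → ℂ}

/-! ### The values at the sym points -/

theorem IsDeformation.hasDerivAt_sym (h : IsDeformation ε D v Ω) (j : Fin 2) {s : ℝ}
    (hs : s ∈ Ioo (-ε) ε) :
    HasDerivAt (fun s => (D s).sym j) ((v s).1.sym j * (D s).sym j) s :=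
  hasDerivAt_pi.1 (h.deriv s hs).snd.snd j

theorem transportExponent_zero (i : Fin 2) (z : ℂ) : transportExponent D v i 0 z = 0 :=
  intervalIntegral.integral_same

/-- The value at a moving sym point is stationary. -/
theorem IsDeformation.hasDerivAt_value (h : IsDeformation ε D v Ω)
    (hm : (D 0).HasLogDifferential i m) {j : Fin 2} {s₀ : ℝ} (hs₀ : s₀ ∈ Ioo (-ε) ε)
    (hz₀ : (D s₀).sym j ≠ 0) {r : ℝ} (hr : 0 < r) (hsub : Metric.ball ((D s₀).sym j) r ⊆ Ω)
    {ψ : ℂ → ℂ} (hψ : (D 0).IsParam (Metric.ball ((D s₀).sym j) r) (fun w => w) ψ fun _ => 1) :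
    HasDerivAt (fun s => m ((D s).sym j, ψ ((D s).sym j)) *
      Complex.exp (transportExponent D v i s ((D s).sym j) / ψ ((D s).sym j))) 0 s₀ := by
  set z₀ := (D s₀).sym j with hz₀d
  have hzr : z₀ ∈ Metric.ball z₀ r := Metric.mem_ball_self hr
  have hI : ∀ᶠ s in 𝓝 s₀, s ∈ Ioo (-ε) ε := isOpen_Ioo.eventually_mem hs₀
  have hψ0 : ψ z₀ ≠ 0 := hψ.n_ne_zero hzr
  have hρ0 := fun s z => sqrtRatio_ne_zero (D 0) (D s) z
  set f : ℝ → ℂ → ℂ := fun s z =>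
    Real.pi * ((D s).b i).eval z / (sqrtRatio (D 0) (D s) z * ψ z * z) with hf
  have hfd : ∀ᶠ s in 𝓝 s₀, DifferentiableOn ℂ (f s) (Metric.ball z₀ r) := by
    filter_upwards [hI] with s hs
    refine (((D s).b i).differentiable.differentiableOn.const_mul _).div
      ((DifferentiableOn.mul (fun z hz => ?_) hψ.n_diff).mul differentiableOn_id) fun z hz => ?_
    · exact (differentiableAt_sqrtRatio (h.slit s hs z (hsub hz))).differentiableWithinAt
    · exact mul_ne_zero (mul_ne_zero (hρ0 _ _) (hψ.n_ne_zero hz)) (hψ.regular z hz).1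
  have hfc : ContinuousAt (Function.uncurry f) (s₀, z₀) := by
    have hsw : ContinuousAt (fun p : ℝ × ℂ => (p.2, p.1)) (s₀, z₀) := continuous_swap.continuousAt
    have hn : Ω ×ˢ Ioo (-ε) ε ∈ 𝓝 (z₀, s₀) :=
      (h.isOpen.prod isOpen_Ioo).mem_nhds ⟨hsub hzr, hs₀⟩
    have c1 : ContinuousAt (fun p : ℝ × ℂ => sqrtRatio (D 0) (D p.1) p.2) (s₀, z₀) :=
      ContinuousAt.comp (f := fun p : ℝ × ℂ => (p.2, p.1)) (x := (s₀, z₀))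
        (g := fun p : ℂ × ℝ => sqrtRatio (D 0) (D p.2) p.1)
        (h.continuousOn_sqrtRatio.continuousAt hn) hsw
    have c2 : ContinuousAt (fun p : ℝ × ℂ => ((D p.1).b i).eval p.2) (s₀, z₀) := by
      have := ((continuous_eval_b i).comp_continuousOn h.continuousOn_data).continuousAt hn
      exact ContinuousAt.comp (f := fun p : ℝ × ℂ => (p.2, p.1)) (x := (s₀, z₀)) this hsw
    have c3 : ContinuousAt (fun p : ℝ × ℂ => ψ p.2) (s₀, z₀) :=
      ContinuousAt.comp (f := Prod.snd) (x := (s₀, z₀))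
        (hψ.n_diff.differentiableAt (Metric.ball_mem_nhds z₀ hr)).continuousAt continuousAt_snd
    exact (continuousAt_const.mul c2).div ((c1.mul c3).mul continuousAt_snd)
      (mul_ne_zero (mul_ne_zero (hρ0 _ _) hψ0) hz₀)
  have hd : HasDerivAt (fun s => m (z₀, ψ z₀) * Complex.exp (transportExponent D v i s z₀ / ψ z₀))
      (m (z₀, ψ z₀) * Complex.exp (transportExponent D v i s₀ z₀ / ψ z₀) *
        (Real.pi * ((v s₀).c i).eval z₀ / sqrtRatio (D 0) (D s₀) z₀ / ψ z₀)) s₀ := by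
    refine (((h.hasDerivAt_transportExponent i (hsub hzr) hs₀).div_const
      (ψ z₀)).cexp.const_mul (m (z₀, ψ z₀))).congr_deriv ?_
    ring
  have := hasDerivAt_moving
    (h := fun s z => m (z, ψ z) * Complex.exp (transportExponent D v i s z / ψ z)) hr
    (hI.mono fun s hs z hz => h.hasDerivAt_mul_exp hm hsub hψ hs hz) hfd hfc hd
    (h.hasDerivAt_sym j hs₀) rfl
  refine this.congr_deriv ?_
  have hc := (h.infinitesimal s₀ hs₀).2 i j
  rw [closingDefect, ← hz₀d] at hc
  have hc' : ((v s₀).c i).eval z₀ = -(((D s₀).b i).eval z₀ * (v s₀).1.sym j) :=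
    eq_neg_of_add_eq_zero_left hc
  have := hρ0 s₀ z₀
  simp only [hc', ← hz₀d]
  field_simp
  ring

/-- The values at the sym points are preserved. -/
theorem IsDeformation.transported_sym (h : IsDeformation ε D v Ω)
    (hm : (D 0).HasLogDifferential i m) (hh : ∀ p ∈ (D 0).curve, m (hyp p) = (m p)⁻¹) {j : Fin 2}
    (hsym : ∀ s ∈ Ioo (-ε) ε, (D s).sym j ≠ 0 ∧ (D s).sym j ∈ Ω) {e : ℂ} (he : e ^ 2 = 1)
    (hval : ∀ p ∈ (D 0).curve, p.1 = (D 0).sym j → m p = e) {t : ℝ} (ht : t ∈ Ioo (-ε) ε)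
    {p : ℂ × ℂ} (hp : p ∈ (D t).curve) (hpt : p.1 = (D t).sym j) :
    transported D v i m t p = e := by
  set φ : ℝ → ℂ → ℂ → ℂ := fun s z n => m (z, n) * Complex.exp (transportExponent D v i s z / n)
    with hφ
  have hreg : ∀ s ∈ Ioo (-ε) ε, (D s).sym j ∈ (D 0).regularSet := fun s hs =>
    ⟨(hsym s hs).1, h.a_ne_zero (hsym s hs).2 h.zero_mem⟩
  have hφneg : ∀ s, ∀ z ≠ 0, ∀ n, n ^ 2 = z * (D 0).a.eval z → φ s z (-n) = (φ s z n)⁻¹ := by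
    intro s z hz n hn
    have := hh (z, n) ⟨hz, hn⟩
    rw [hyp] at this
    simp only [hφ, this, div_neg, Complex.exp_neg, mul_inv]
  -- a function of the parameter that does not depend on the choice of a branch of the square root
  set Y : ℝ → ℂ := fun s => φ s ((D s).sym j) ((D 0).rootA ((D s).sym j)) +
    (φ s ((D s).sym j) ((D 0).rootA ((D s).sym j)))⁻¹ with hY
  have hYn : ∀ s ∈ Ioo (-ε) ε, ∀ n, n ^ 2 = (D s).sym j * (D 0).a.eval ((D s).sym j) →
      Y s = φ s ((D s).sym j) n + (φ s ((D s).sym j) n)⁻¹ := by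
    intro s hs n hn
    rcases sq_eq_sq_iff_eq_or_eq_neg.1 (hn.trans (rootA_sq (hreg s hs)).symm) with h1 | h1
    · rw [h1]
    · rw [h1, hφneg s _ (hsym s hs).1 _ (rootA_sq (hreg s hs)), inv_inv, add_comm]
  have hYd : ∀ s₀ ∈ Ioo (-ε) ε, HasDerivAt Y 0 s₀ := by
    intro s₀ hs₀
    obtain ⟨r, hr, hsub, ψ, hψ⟩ := h.exists_isParam (hsym s₀ hs₀).2 (hsym s₀ hs₀).1
    have h1 := h.hasDerivAt_value hm hs₀ (hsym s₀ hs₀).1 hr hsub hψ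
    have hne : φ s₀ ((D s₀).sym j) (ψ ((D s₀).sym j)) ≠ 0 :=
      mul_ne_zero (hm _ ⟨(hsym s₀ hs₀).1, hψ.curve _ (Metric.mem_ball_self hr)⟩).1
        (Complex.exp_ne_zero _)
    have h2 := h1.fun_add (h1.fun_inv hne)
    refine (h2.congr_of_eventuallyEq ?_).congr_deriv (by simp)
    have hb : ∀ᶠ s in 𝓝 s₀, (D s).sym j ∈ Metric.ball ((D s₀).sym j) r :=
      (h.hasDerivAt_sym j hs₀).continuousAt.eventually_mem (Metric.ball_mem_nhds _ hr)
    filter_upwards [hb, isOpen_Ioo.eventually_mem hs₀] with s h3 h4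
    exact hYn s h4 _ (hψ.curve _ h3)
  have hconst : Y t = Y 0 := isOpen_Ioo.is_const_of_deriv_eq_zero isPreconnected_Ioo
    (fun s hs => (hYd s hs).differentiableAt.differentiableWithinAt)
    (fun s hs => (hYd s hs).deriv) ht h.zero_mem
  have he0 : e ≠ 0 := by
    rintro rfl
    simp at he
  have hinv : e⁻¹ = e := by
    field_simp
    exact he.symm
  have hY0 : Y 0 = 2 * e := by
    have h1 : φ 0 ((D 0).sym j) ((D 0).rootA ((D 0).sym j)) = e := by
      simp only [hφ, transportExponent_zero, zero_div, Complex.exp_zero, mul_one]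
      exact hval _ ⟨(hsym 0 h.zero_mem).1, rootA_sq (hreg 0 h.zero_mem)⟩ rfl
    simp only [hY, h1, hinv]
    ring
  have hp0 := h.curve_div ht hp (hpt ▸ (hsym t ht).2)
  have htr : transported D v i m t p = φ t ((D t).sym j) (p.2 / sqrtRatio (D 0) (D t) p.1) := by
    rw [← hpt]; rfl
  have hsum := hYn t ht (p.2 / sqrtRatio (D 0) (D t) p.1) (by rw [← hpt]; exact hp0.2)
  rw [← htr, hconst, hY0] at hsum
  have hne : transported D v i m t p ≠ 0 := mul_ne_zero (hm _ hp0).1 (Complex.exp_ne_zero _)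
  field_simp at hsum
  have hsq : (transported D v i m t p - e) ^ 2 = 0 := by
    linear_combination -hsum + he
  exact sub_eq_zero.1 (pow_eq_zero_iff two_ne_zero |>.1 hsq)

end SpectralData

end

section
open Polynomial Set Filter Topology
namespace SpectralData

variable {g : ℕ}

/-! ### The branch points of nearby curves -/

theorem pow_card_le_norm_prod {z : ℂ} {k : ℝ} (hk : 0 ≤ k) (s : Multiset ℂ)
    (h : ∀ α ∈ s, k ≤ ‖z - α‖) : k ^ s.card ≤ ‖(s.map fun α => z - α).prod‖ := by
  induction s using Multiset.induction with
  | empty => simp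
  | cons α s ih =>
    rw [Multiset.card_cons, pow_succ', Multiset.map_cons, Multiset.prod_cons, norm_mul]
    exact mul_le_mul (h α (Multiset.mem_cons_self α s))
      (ih fun β hβ => h β (Multiset.mem_cons_of_mem hβ)) (pow_nonneg hk _) (norm_nonneg _)

/-- A lower bound for a polynomial away from its roots. -/
theorem mul_pow_le_norm_eval {p : ℂ[X]} {n : ℕ} (hn : p.natDegree ≤ n) (h0 : p.coeff n ≠ 0) {z : ℂ}
    {k : ℝ} (hk : 0 ≤ k) (h : ∀ α, p.IsRoot α → k ≤ ‖z - α‖) :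
    ‖p.coeff n‖ * k ^ n ≤ ‖p.eval z‖ := by
  have hd : p.natDegree = n := natDegree_eq_of_coeff_ne_zero hn h0
  have hp : p ≠ 0 := by
    rintro rfl
    simp at h0
  have hs := IsAlgClosed.splits p
  have h1 := hs.eval_eq_prod_roots z
  have hcard : p.roots.card = n := hd ▸ hs.natDegree_eq_card_roots.symm
  have h2 := pow_card_le_norm_prod hk p.roots fun α hα => h α ((mem_roots hp).1 hα)
  rw [h1, leadingCoeff, hd, norm_mul]
  rw [hcard] at h2
  exact mul_le_mul_of_nonneg_left h2 (norm_nonneg _)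

theorem continuous_coeff_a (k : ℕ) : Continuous fun T : SpectralData g => T.a.coeff k := by
  simp only [a, coeff_coeffPoly]
  split_ifs <;> fun_prop

theorem finite_roots {S : SpectralData g} (h : S.a.coeff (2 * g) ≠ 0) : {α | S.a.IsRoot α}.Finite := by
  refine finite_setOfPred_isRoot ?_
  intro h0
  simp [h0] at h

theorem norm_eval_a_sub_le (S T : SpectralData g) (z : ℂ) :
    ‖T.a.eval z - S.a.eval z‖ ≤ (2 * g + 1) * ‖T - S‖ * (1 + ‖z‖) ^ (2 * g) := by
  simp only [a, coeffPoly_eval]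
  rw [← Finset.sum_sub_distrib]
  have h1 : ∀ k : Fin (2 * g + 1), ‖T.1 k * z ^ (k : ℕ) - S.1 k * z ^ (k : ℕ)‖ ≤
      ‖T - S‖ * (1 + ‖z‖) ^ (2 * g) := by
    intro k
    rw [← sub_mul, norm_mul, norm_pow]
    refine mul_le_mul ?_ ?_ (by positivity) (norm_nonneg _)
    · exact (norm_le_pi_norm (T.1 - S.1) k).trans (norm_fst_le (T - S))
    · calc ‖z‖ ^ (k : ℕ) ≤ (1 + ‖z‖) ^ (k : ℕ) := pow_le_pow_left₀ (norm_nonneg _) (by linarith) _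
        _ ≤ (1 + ‖z‖) ^ (2 * g) := pow_le_pow_right₀ (by linarith [norm_nonneg z]) (by omega)
  refine (norm_sum_le _ _).trans ((Finset.sum_le_sum fun k _ => h1 k).trans (le_of_eq ?_))
  rw [Finset.sum_const, Finset.card_univ, Fintype.card_fin, nsmul_eq_mul]
  push_cast
  ring

/-- Away from discs around the branch points, the quotient of `a` for nearby data stays close to `1`,
uniformly up to `λ = ∞`, as the degrees agree. -/
theorem eventually_forall_mem_slitPlane {S : SpectralData g} (h : S.a.coeff (2 * g) ≠ 0) {r : ℝ}
    (hr : 0 < r) : ∀ᶠ T in 𝓝 S, ∀ z, (∀ α, S.a.IsRoot α → r < dist z α) →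
      T.a.eval z / S.a.eval z ∈ Complex.slitPlane := by
  obtain ⟨A, hA⟩ := (finite_roots h).isBounded.exists_norm_le
  have hA' : ∀ α, S.a.IsRoot α → ‖α‖ ≤ |A| := fun α hα => (hA α hα).trans (le_abs_self A)
  set c : ℝ := ((1 + |A|) / r + 1)⁻¹ with hc
  have hc0 : 0 < c := by positivity
  have hlow : ∀ z, (∀ α, S.a.IsRoot α → r < dist z α) →
      ‖S.a.coeff (2 * g)‖ * (c * (1 + ‖z‖)) ^ (2 * g) ≤ ‖S.a.eval z‖ := by
    intro z hz
    refine mul_pow_le_norm_eval S.a_natDegree_le h (by positivity) fun α hα => ?_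
    have h1 := hz α hα
    rw [dist_eq_norm] at h1
    have h2 : ‖z‖ ≤ ‖z - α‖ + ‖α‖ := by
      simpa using norm_add_le (z - α) α
    have h3 : 1 + |A| ≤ (1 + |A|) / r * ‖z - α‖ := by
      rw [div_mul_eq_mul_div, le_div_iff₀ hr]
      exact mul_le_mul_of_nonneg_left h1.le (by positivity)
    rw [hc, inv_mul_le_iff₀ (by positivity)]
    have := hA' α hα
    linarith
  have hlead : 0 < ‖S.a.coeff (2 * g)‖ := norm_pos_iff.2 h
  have hev : ∀ᶠ T : SpectralData g in 𝓝 S,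
      (2 * g + 1) * ‖T - S‖ < ‖S.a.coeff (2 * g)‖ * c ^ (2 * g) := by
    have hcont : Continuous fun T : SpectralData g => (2 * g + 1 : ℝ) * ‖T - S‖ := by fun_prop
    refine hcont.continuousAt.eventually_lt continuousAt_const ?_
    simp only [sub_self, norm_zero, mul_zero]
    positivity
  filter_upwards [hev] with T hT z hz
  have h1 := hlow z hz
  have hz1 : 0 < (1 + ‖z‖) ^ (2 * g) := by positivity
  have h2 : 0 < ‖S.a.eval z‖ := lt_of_lt_of_le (by positivity) h1
  have h3 : ‖T.a.eval z - S.a.eval z‖ < ‖S.a.eval z‖ := by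
    refine (norm_eval_a_sub_le S T z).trans_lt (lt_of_lt_of_le ?_ h1)
    rw [mul_pow, ← mul_assoc]
    exact mul_lt_mul_of_pos_right hT hz1
  have h4 : T.a.eval z / S.a.eval z = 1 + (T.a.eval z - S.a.eval z) / S.a.eval z := by
    have := norm_pos_iff.1 h2
    field_simp
    ring
  rw [h4]
  refine Complex.mem_slitPlane_of_norm_lt_one ?_
  rwa [norm_div, div_lt_one h2]

/-- The roots of `a` depend continuously on the data: the product of the distances of `α` to the roots
of `T.a` is `|T.a(α)|` divided by the modulus of the leading coefficient. -/
theorem eventually_exists_root {S : SpectralData g} (h : S.a.coeff (2 * g) ≠ 0) {r : ℝ}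
    (hr : 0 < r) : ∀ᶠ T in 𝓝 S, ∀ α, S.a.IsRoot α → ∃ β, T.a.IsRoot β ∧ dist α β < r := by
  have key : ∀ᶠ T in 𝓝 S, ∀ α ∈ {α | S.a.IsRoot α}, ∃ β, T.a.IsRoot β ∧ dist α β < r := by
    rw [Filter.eventually_all_finite (finite_roots h)]
    intro α hα
    have hc : ContinuousAt (fun T : SpectralData g =>
        ‖T.a.coeff (2 * g)‖ * r ^ (2 * g) - ‖T.a.eval α‖) S := by
      have c1 := (continuous_coeff_a (g := g) (2 * g)).norm
      have c2 : Continuous fun T : SpectralData g => T.a.eval α :=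
        continuous_eval_a.comp (by fun_prop : Continuous fun T : SpectralData g => (T, α))
      exact ((c1.mul continuous_const).sub c2.norm).continuousAt
    have h0 : ∀ᶠ T : SpectralData g in 𝓝 S, 0 < ‖T.a.coeff (2 * g)‖ * r ^ (2 * g) - ‖T.a.eval α‖ := by
      refine hc.eventually (lt_mem_nhds ?_)
      have : S.a.eval α = 0 := hα
      simp only [this, norm_zero, sub_zero]
      have := norm_pos_iff.2 h
      positivity
    filter_upwards [h0, (continuous_coeff_a (g := g) (2 * g)).continuousAt.eventually_ne h] with T h1 h2
    by_contra! h3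
    have := mul_pow_le_norm_eval (z := α) T.a_natDegree_le h2 hr.le fun β hβ => by
      rw [← dist_eq_norm]; exact h3 β hβ
    linarith
  exact key

/-- For spectral data `T` near `S`, the roots of `T.a` are close to those of `S.a` in number and
position, and away from them the values of `ν` can be transported from one curve to the other. -/
theorem exists_region {S : SpectralData g} (hlead : S.a.coeff (2 * g) ≠ 0) (h0 : S.a.coeff 0 ≠ 0)
    (hsep : S.a.Separable) (hcirc : ∀ z : ℂ, ‖z‖ = 1 → S.a.eval z ≠ 0) :
    ∃ (ρ R : ℝ) (Ω : Set ℂ), 0 < ρ ∧ ρ < R ∧ IsOpen Ω ∧ ∀ᶠ T in 𝓝 S,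
      (∀ z ∈ Ω, T.a.eval z / S.a.eval z ∈ Complex.slitPlane) ∧
      (∀ β, T.a.IsRoot β → R ≤ ‖β‖) ∧
      (∀ β β', T.a.IsRoot β → T.a.IsRoot β' → β ≠ β' → 2 * R ≤ dist β β') ∧
      (∀ z, (∀ β, T.a.IsRoot β → ρ < dist z β) → z ∈ Ω) ∧
      ∀ z : ℂ, ‖z‖ = 1 → ∀ β, T.a.IsRoot β → ρ < dist z β := by
  classical
  have hfin := finite_roots hlead
  have hle : ∀ x : ℝ, 0 < x → ∀ᶠ R in 𝓝[>] (0 : ℝ), 4 * R ≤ x := by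
    intro x hx
    have : ∀ᶠ R in 𝓝 (0 : ℝ), 4 * R < x :=
      (continuous_const.mul continuous_id).continuousAt.eventually_lt continuousAt_const (by simpa)
    exact mem_nhdsWithin_of_mem_nhds (this.mono fun _ h => h.le)
  obtain ⟨R, ⟨h1, h2⟩, hR⟩ : ∃ R : ℝ, ((∀ α ∈ {α | S.a.IsRoot α},
      4 * R ≤ ‖α‖ ∧ 4 * R ≤ |‖α‖ - 1|) ∧ ∀ α ∈ {α | S.a.IsRoot α}, ∀ α' ∈ {α | S.a.IsRoot α},
        α ≠ α' → 4 * R ≤ dist α α') ∧ 0 < R := by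
    refine Eventually.exists (f := 𝓝[>] (0 : ℝ)) (((Filter.eventually_all_finite hfin).2
      fun α hα => ?_).and ((Filter.eventually_all_finite hfin).2 fun α hα =>
        (Filter.eventually_all_finite hfin).2 fun α' hα' => ?_) |>.and self_mem_nhdsWithin)
    · refine (hle _ (norm_pos_iff.2 ?_)).and (hle _ (abs_pos.2 (sub_ne_zero.2 fun hn => ?_)))
      · rintro rfl
        exact h0 ((coeff_zero_eq_eval_zero _).trans hα)
      · exact hcirc α hn hα
    · by_cases hne : α = α'
      · exact Eventually.of_forall fun _ h => absurd hne h
      · exact (hle _ (dist_pos.2 hne)).mono fun _ h _ => h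
  refine ⟨R / 2, R, {z | ∀ α, S.a.IsRoot α → R / 4 < dist z α}, by linarith, by linarith, ?_, ?_⟩
  · have : {z : ℂ | ∀ α, S.a.IsRoot α → R / 4 < dist z α} =
        ⋂ α ∈ {α | S.a.IsRoot α}, {z | R / 4 < dist z α} := by
      ext z; simp
    rw [this]
    exact hfin.isOpen_biInter fun α _ => isOpen_lt continuous_const (continuous_id.dist continuous_const)
  have hr : 0 < R / 4 := by linarith
  filter_upwards [eventually_forall_mem_slitPlane hlead hr, eventually_exists_root hlead hr,
    (continuous_coeff_a (g := g) (2 * g)).continuousAt.eventually_ne hlead] with T t1 t2 t3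
  -- every root of `T.a` is close to a root of `S.a`, since there are equally many
  choose! f hf hfd using t2
  have hS0 : S.a ≠ 0 := by rintro h; simp [h] at hlead
  have hT0 : T.a ≠ 0 := by rintro h; simp [h] at t3
  have hinj : ∀ α, S.a.IsRoot α → ∀ α', S.a.IsRoot α' → f α = f α' → α = α' := by
    intro α hα α' hα' he
    by_contra hne
    have k1 := h2 α hα α' hα' hne
    have k2 := hfd α hα
    have k3 := hfd α' hα'
    rw [← he] at k3
    have := dist_triangle_right α α' (f α)
    linarith
  have hsurj : ∀ β, T.a.IsRoot β → ∃ α, S.a.IsRoot α ∧ f α = β := by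
    have hcardS : S.a.roots.toFinset.card = 2 * g := by
      rw [Multiset.toFinset_card_of_nodup (nodup_roots hsep),
        ← (IsAlgClosed.splits S.a).natDegree_eq_card_roots,
        natDegree_eq_of_coeff_ne_zero S.a_natDegree_le hlead]
    have hcardT : T.a.roots.toFinset.card ≤ 2 * g :=
      (Multiset.toFinset_card_le _).trans ((card_roots' _).trans T.a_natDegree_le)
    have hsub : S.a.roots.toFinset.image f ⊆ T.a.roots.toFinset := by
      intro β hβ
      obtain ⟨α, hα, rfl⟩ := Finset.mem_image.1 hβ
      rw [Multiset.mem_toFinset, mem_roots hS0] at hα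
      rw [Multiset.mem_toFinset, mem_roots hT0]
      exact hf α hα
    have hcard : (S.a.roots.toFinset.image f).card = 2 * g := by
      rw [Finset.card_image_of_injOn, hcardS]
      intro α hα α' hα' he
      rw [Finset.mem_coe, Multiset.mem_toFinset, mem_roots hS0] at hα hα'
      exact hinj α hα α' hα' he
    have heq := Finset.eq_of_subset_of_card_le hsub (by rw [hcard]; exact hcardT)
    intro β hβ
    have : β ∈ S.a.roots.toFinset.image f := by
      rw [heq, Multiset.mem_toFinset, mem_roots hT0]; exact hβ
    obtain ⟨α, hα, h⟩ := Finset.mem_image.1 this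
    rw [Multiset.mem_toFinset, mem_roots hS0] at hα
    exact ⟨α, hα, h⟩
  refine ⟨t1, fun β hβ => ?_, fun β β' hβ hβ' hne => ?_, fun z hz α hα => ?_, fun z hz β hβ => ?_⟩
  · obtain ⟨α, hα, rfl⟩ := hsurj β hβ
    have k1 := (h1 α hα).1
    have k2 := hfd α hα
    have k3 := norm_sub_norm_le α (f α)
    rw [← dist_eq_norm] at k3
    linarith
  · obtain ⟨α, hα, rfl⟩ := hsurj β hβ
    obtain ⟨α', hα', rfl⟩ := hsurj β' hβ'
    have k1 := h2 α hα α' hα' fun h => hne (by rw [h])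
    have k2 := hfd α hα
    have k3 := hfd α' hα'
    have k4 := dist_triangle4_right α α' (f α) (f α')
    linarith
  · have k1 := hz (f α) (hf α hα)
    have k2 := hfd α hα
    have k3 := dist_triangle z α (f α)
    linarith
  · obtain ⟨α, hα, rfl⟩ := hsurj β hβ
    have k1 := (h1 α hα).2
    have k2 := hfd α hα
    have k3 := abs_norm_sub_norm_le α z
    rw [hz, ← dist_eq_norm, dist_comm] at k3
    have k4 := dist_triangle z (f α) α
    rw [dist_comm (f α)] at k4
    linarith

end SpectralData

end

section
open Polynomial Set Filter Topology
namespace SpectralData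

variable {g : ℕ}

/-! ### Existence of the family -/

/-- Over a sym point, the function `μ_i` has one value. -/
theorem IsSpectral.exists_sym_value {S : SpectralData g} {μ : Fin 2 → ℂ × ℂ → ℂ}
    (hS : S.IsSpectral μ) (i j : Fin 2) : ∃ e : ℂ, (e = 1 ∨ e = -1) ∧
      ∀ p ∈ S.curve, p.1 = S.sym j → μ i p = e := by
  have hreg := hS.sym_mem_regularSet j
  have hc : (S.sym j, S.rootA (S.sym j)) ∈ S.curve := ⟨hreg.1, rootA_sq hreg⟩
  have he := hS.closing i j _ hc rfl
  refine ⟨_, he, ?_⟩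
  rintro ⟨z, n⟩ hp rfl
  rcases sq_eq_sq_iff_eq_or_eq_neg.1 (hp.2.trans (rootA_sq hreg).symm) with h | h
  · simp only at h
    rw [h]
  · simp only at h
    have h1 := hS.mu_hyp i _ hc
    rw [hyp] at h1
    rw [h, h1]
    rcases he with he | he <;> rw [he] <;> norm_num

/-- The sign condition on the unit circle persists as long as the quotient of the polynomials `a`
does not meet the negative half-axis. -/
theorem IsReal.nonneg_of_slit {S T : SpectralData g} (hS : S.IsReal) (hT : T.IsReal) {z : ℂ}
    (hz : ‖z‖ = 1) (h : ∃ x : ℝ, 0 ≤ x ∧ (z⁻¹) ^ g * S.a.eval z = x)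
    (hslit : T.a.eval z / S.a.eval z ∈ Complex.slitPlane) :
    ∃ x : ℝ, 0 ≤ x ∧ (z⁻¹) ^ g * T.a.eval z = x := by
  obtain ⟨x, hx, he⟩ := h
  have hz0 : z ≠ 0 := by
    rintro rfl
    simp at hz
  have h1 := hS.ratio_inv_conj hT hz0
  rw [inv_conj_of_norm_eq_one hz] at h1
  obtain ⟨y, hy⟩ := Complex.conj_eq_iff_real.1 h1.symm
  have hy0 : 0 ≤ y := by
    rw [hy, Complex.mem_slitPlane_iff] at hslit
    simp only [Complex.ofReal_re, Complex.ofReal_im, ne_eq, not_true_eq_false, or_false] at hslit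
    exact hslit.le
  have h0 := (ne_zero_of_mem_slitPlane hslit).2
  refine ⟨y * x, mul_nonneg hy0 hx, ?_⟩
  rw [Complex.ofReal_mul, ← he, ← hy]
  field_simp

variable {ε : ℝ} {D : ℝ → SpectralData g} {v : ℝ → Variation g} {Ω : Set ℂ}

/-- The functions `μ` extend along a deformation of spectral data, with the same values at the sym
points. -/
theorem IsDeformation.exists_isSpectral (h : IsDeformation ε D v Ω) {μ : Fin 2 → ℂ × ℂ → ℂ}
    (hS : (D 0).IsSpectral μ) {ρ R : ℝ} (hρ : 0 < ρ) (hρR : ρ < R)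
    (hreal : ∀ s ∈ Ioo (-ε) ε, (D s).IsReal) {t : ℝ} (ht : t ∈ Ioo (-ε) ε)
    (hR : ∀ β, (D t).a.IsRoot β → R ≤ ‖β‖)
    (hsep : ∀ β β', (D t).a.IsRoot β → (D t).a.IsRoot β' → β ≠ β' → 2 * R ≤ dist β β')
    (hΩ : ∀ z, (∀ β, (D t).a.IsRoot β → ρ < dist z β) → z ∈ Ω)
    (hcirc : ∀ s ∈ Ioo (-ε) ε, ∀ z : ℂ, ‖z‖ = 1 → z ∈ Ω)
    (hcirct : ∀ z : ℂ, ‖z‖ = 1 → ∀ β, (D t).a.IsRoot β → ρ < dist z β)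
    (hlead : (D t).a.coeff (2 * g) ≠ 0) (hsepar : (D t).a.Separable)
    (hplus : LinearIndependent ℝ fun i : Fin 2 => ((D t).b i).coeff 0)
    (hminus : LinearIndependent ℝ fun i : Fin 2 => ((D t).b i).coeff (g + 1))
    (hsym : (D t).sym 0 ≠ (D t).sym 1) :
    ∃ M : Fin 2 → ℂ × ℂ → ℂ, (D t).IsSpectral M ∧
      ∀ i j, ∀ p ∈ (D t).curve, ∀ q ∈ (D 0).curve, p.1 = (D t).sym j → q.1 = (D 0).sym j →
        M i p = μ i q := by
  have hT := hreal t ht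
  have hX := separable_X_mul hsepar (hT.coeff_zero_ne_zero hlead)
  choose e he hval using hS.exists_sym_value
  have hsymΩ : ∀ j, ∀ s ∈ Ioo (-ε) ε, (D s).sym j ≠ 0 ∧ (D s).sym j ∈ Ω := fun j s hs =>
    ⟨(hreal s hs).sym_ne_zero j, hcirc s hs _ ((hreal s hs).sym j)⟩
  have hex : ∀ i, ∃ m : ℂ × ℂ → ℂ, (D t).HasLogDifferential i m ∧
      (∀ p ∈ (D t).curve, m (hyp p) = (m p)⁻¹) ∧
      ∀ j, ∀ p ∈ (D t).curve, p.1 = (D t).sym j → m p = e i j := by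
    intro i
    obtain ⟨m, h1, h2, h3⟩ := exists_glue hX i hρ hρR hR hsep (O := transported D v i (μ i) t)
      (fun p hp hz => h.hasLogDifferentialAt (hS.mu_log i) ht hp (hΩ _ hz))
      fun p hp hz => h.transported_hyp (hS.mu_hyp i) ht hp (hΩ _ hz)
    refine ⟨m, h1, h2, fun j p hp hpj => ?_⟩
    rw [h3 p (hcirct _ (by rw [hpj]; exact hT.sym j))]
    refine h.transported_sym (hS.mu_log i) (hS.mu_hyp i) (hsymΩ j) ?_ (hval i j) ht hp hpj
    rcases he i j with h4 | h4 <;> rw [h4] <;> norm_num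
  choose M hlog hhyp hMe using hex
  have hreg : (D t).sym 0 ∈ (D t).regularSet :=
    ⟨(hsymΩ 0 t ht).1, h.a_ne_zero (hsymΩ 0 t ht).2 ht⟩
  have heta : ∀ i, ∀ p ∈ (D t).curve, M i (etaInv g p) = conj (M i p) := fun i p hp =>
    hT.conj_etaInv (hlog i) (hhyp i) (hT.sym 0) hreg
      (fun p hp hp0 => by rw [hMe i 0 p hp hp0]; exact he i 0) hp
  refine ⟨M, ?_, fun i j p hp q hq hpj hqj => by rw [hMe i j p hp hpj, hval i j q hq hqj]⟩
  exact
    { a_degree := hlead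
      a_simple := hsepar
      a_real := fun z hz => (hT.eval_a hz).symm
      a_nonneg := fun z hz => hS.isReal.nonneg_of_slit hT hz (hS.a_nonneg z hz)
        (h.slit t ht z (hcirc t ht z hz))
      b_real := fun i z hz => (hT.eval_b i hz).symm
      indep_plus := hplus
      indep_minus := hminus
      mu_log := hlog
      mu_hyp := hhyp
      mu_eta := heta
      mu_rho := fun i p hp => by
        have e1 : rhoInv g p = etaInv g (hyp p) := by simp [rhoInv, etaInv, hyp]
        rw [e1, heta i _ (hyp_mem_curve hp), hhyp i p hp, map_inv₀]
      sym_norm := hT.sym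
      sym_ne := hsym
      closing := fun i j p hp hpj => by rw [hMe i j p hp hpj]; exact he i j }

theorem continuous_coeff_b (i : Fin 2) (k : ℕ) :
    Continuous fun T : SpectralData g => (T.b i).coeff k := by
  simp only [b, coeff_coeffPoly]
  split_ifs <;> fun_prop

theorem continuous_unitSpeed : Continuous (unitSpeed (g := g)) := contDiff_unitSpeed.continuous

theorem eventually_linearIndependent {S : SpectralData g} {k : ℕ}
    (h : LinearIndependent ℝ fun i : Fin 2 => (S.b i).coeff k) :
    ∀ᶠ T in 𝓝 S, LinearIndependent ℝ fun i : Fin 2 => (T.b i).coeff k := by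
  have hc : Continuous fun (T : SpectralData g) (i : Fin 2) => (T.b i).coeff k :=
    continuous_pi fun i => continuous_coeff_b i k
  exact hc.continuousAt.eventually (LinearIndependent.eventually h)

/-- The integral curve of the normalized infinitesimal deformations consists of spectral data of
cmc tori. -/
theorem IsSpectral.exists_family {S : SpectralData g} {μ : Fin 2 → ℂ × ℂ → ℂ}
    (hS : S.IsSpectral μ) (hb : Function.Bijective S.linearization) (hmid : S.a.coeff g ≠ 0)
    (hu : S.unitSpeed ≠ 0) :
    ∃ ε > 0, ∃ D : ℝ → SpectralData g, D 0 = S ∧ ContDiffOn ℝ ∞ D (Ioo (-ε) ε) ∧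
      ∀ t ∈ Ioo (-ε) ε, Function.Bijective (D t).linearization ∧ (D t).a.coeff g ≠ 0 ∧
        (D t).unitSpeed ≠ 0 ∧ HasDerivAt D ((D t).velocity (D t).unitVar) t ∧
        ∃ M : Fin 2 → ℂ × ℂ → ℂ, (D t).IsSpectral M ∧
          ∀ i j, ∀ p ∈ (D t).curve, ∀ q ∈ S.curve, p.1 = (D t).sym j → q.1 = S.sym j →
            M i p = μ i q := by
  obtain ⟨ρ, R, Ω, hρ, hρR, hΩo, hΩ⟩ := exists_region hS.a_degree
    (hS.isReal.coeff_zero_ne_zero hS.a_degree) hS.a_simple fun z hz => hS.eval_a_ne_zero hz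
  have hsymc : ∀ᶠ T : SpectralData g in 𝓝 S, T.sym 0 - T.sym 1 ≠ 0 := by
    have hc : Continuous fun T : SpectralData g => T.sym 0 - T.sym 1 := by
      simp only [sym]; fun_prop
    exact hc.continuousAt.eventually_ne (sub_ne_zero.2 hS.sym_ne)
  obtain ⟨ε, hε, D, hD0, hDs, hD⟩ := exists_integralCurve hb hS.isReal
    (hΩ.and (((continuous_coeff_a (g := g) (2 * g)).continuousAt.eventually_ne hS.a_degree).and
      (((continuous_coeff_a (g := g) g).continuousAt.eventually_ne hmid).and
      ((continuous_unitSpeed.continuousAt.eventually_ne hu).and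
      (hsymc.and ((eventually_linearIndependent hS.indep_plus).and
        (eventually_linearIndependent hS.indep_minus)))))))
  subst hD0
  have hdef : IsDeformation ε D (fun s => (D s).unitVar) Ω := by
    refine ⟨hε, fun s hs => (hD s hs).2.2.2, fun s hs => ?_, fun s hs => ?_, hΩo, fun s hs =>
      (hD s hs).1.1.1⟩
    · exact (ContinuousAt.comp (contDiffAt_unitVar (hD s hs).2.1).continuousAt
        (hD s hs).2.2.2.continuousAt).continuousWithinAt
    · exact (((D s).isUnitVariation_iff _).1 (isUnitVariation_unitVar (hD s hs).2.1)).1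
  refine ⟨ε, hε, D, rfl, hDs, fun t ht => ?_⟩
  obtain ⟨⟨⟨-, r1, r2, r3, r4⟩, h1, h2, h3, h4, h5, h6⟩, hbt, -, hdt⟩ := hD t ht
  refine ⟨hbt, h2, h3, hdt, ?_⟩
  refine hdef.exists_isSpectral hS hρ hρR (fun s hs => (hD s hs).2.2.1) ht r1 r2 r3
    (fun s hs z hz => ?_) r4 h1 (separable_of_surjective hbt.2) h5 h6 (sub_ne_zero.1 h4)
  obtain ⟨⟨⟨-, -, -, k3, k4⟩, -⟩, -⟩ := hD s hs
  exact k3 z (k4 z hz)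

end SpectralData

end

end

theorem mainTheorem7 (g : ℕ) (S : SpectralData g) (μ : Fin 2 → ℂ × ℂ → ℂ)
    (hS : S.IsSpectral μ) (hroots : S.NoCommonRoots) :
    ∃ (ε : ℝ) (D : ℝ → SpectralData g),
      -- a smooth one dimensional family that contains the given curve
      IsSmoothSpectralFamily ε D ∧ IsOneDimensional ε D ∧ D 0 = S ∧
      -- along which the values of the functions `μ₁`, `μ₂` at the sym points are preserved
      (∃ M : ℝ → Fin 2 → ℂ × ℂ → ℂ, M 0 = μ ∧ ∀ t ∈ Set.Ioo (-ε) ε,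
        (D t).IsSpectral (M t) ∧
        ∀ i j, ∀ p ∈ (D t).curve, ∀ q ∈ S.curve, p.1 = (D t).sym j → q.1 = S.sym j →
          M t i p = μ i q) ∧
      -- and every smooth family through the given curve is locally a smooth reparametrization of
      -- it, up to rotations of `λ` and rescalings of `ν`
      ∀ (δ : ℝ) (E : ℝ → SpectralData g), IsSmoothSpectralFamily δ E → E 0 = S →
        ∃ δ' : ℝ, 0 < δ' ∧ δ' ≤ δ ∧ ∃ τ r θ : ℝ → ℝ,
          ContDiffOn ℝ ∞ τ (Set.Ioo (-δ') δ') ∧ ContDiffOn ℝ ∞ r (Set.Ioo (-δ') δ') ∧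
          ContDiffOn ℝ ∞ θ (Set.Ioo (-δ') δ') ∧ τ 0 = 0 ∧ r 0 = 1 ∧ θ 0 = 0 ∧
          ∀ s ∈ Set.Ioo (-δ') δ', τ s ∈ Set.Ioo (-ε) ε ∧ 0 < r s ∧
            E s = (D (τ s)).transform (r s) (θ s) := by
  have hreg := hS.regular hroots
  have hb := hreg.linearization_bijective
  have hu : S.unitSpeed ≠ 0 := mul_ne_zero (sub_ne_zero.2 hS.sym_ne.symm)
    (mul_ne_zero hreg.const hreg.lead)
  obtain ⟨ε, hε, D, hD0, hDs, hD⟩ := hS.exists_family hb hreg.mid hu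
  have hM : ∀ t, ∃ M : Fin 2 → ℂ × ℂ → ℂ, t ∈ Set.Ioo (-ε) ε → (D t).IsSpectral M ∧
      ∀ i j, ∀ p ∈ (D t).curve, ∀ q ∈ S.curve, p.1 = (D t).sym j → q.1 = S.sym j →
        M i p = μ i q := by
    intro t
    by_cases ht : t ∈ Set.Ioo (-ε) ε
    · obtain ⟨M, h⟩ := (hD t ht).2.2.2.2
      exact ⟨M, fun _ => h⟩
    · exact ⟨μ, fun h => absurd h ht⟩
  choose M hM using hM
  refine ⟨ε, D, ⟨hε, hDs, fun t ht => ⟨M t, (hM t ht).1⟩⟩, fun t ht x y => ?_, hD0,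
    ⟨fun t => if t = 0 then μ else M t, if_pos rfl, fun t ht => ?_⟩, fun δ E hE hE0 => ?_⟩
  · obtain ⟨hbt, hmid, hut, hd, -⟩ := hD t ht
    rw [hd.deriv]
    exact SpectralData.velocity_unitVar_ne hbt (hM t ht).1.a_degree hmid hut
      (hM t ht).1.isReal.sym_ne_zero x y
  · by_cases h0 : t = 0
    · subst h0
      simp only [if_true]
      rw [hD0]
      refine ⟨hS, fun i j p hp q hq hpj hqj => ?_⟩
      obtain ⟨e, -, he⟩ := hS.exists_sym_value i j
      rw [he p hp hpj, he q hq hqj]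
    · simp only [if_neg h0]
      exact hM t ht
  · refine SpectralData.exists_reparametrization hb hreg.lead hreg.mid hu hε hD0
      (fun t ht => ⟨(hD t ht).1, (hD t ht).2.2.2.1⟩) hE.1 hE.2.1 hE0 (fun s hs => ?_)
      fun s hs => hE.exists_variation hs
    obtain ⟨m, hm⟩ := hE.2.2 s hs
    exact hm.isReal
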